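/- Let $h>0$, $G=(0,1)^2$, $\Omega=G\times(-h,0)$, $\Gamma_u=G\times\{0\}$, $\Gamma_b=G\times\{-h\}$; all functions are complex valued. For $f$ on $\Omega$ put $\bar f(x,y)=\frac1h\int_{-h}^0 f(x,y,z)\,dz$. Write $\nabla_H=(\partial_x,\partial_y)^T$, $\mathrm{div}_H v=\partial_xv_1+\partial_yv_2$. For $m\ge 1$ let $H^m_{\mathrm{per}}(\Omega)$ be the space of all $f\in H^m(\Omega)$ such that, for $0\le\alpha\le m-1$, the traces of $\partial_x^\alpha f$ on $\{x=0\}$ and $\{x=1\}$ coincide and the traces of $\partial_y^\alpha f$ on $\{y=0\}$ and $\{y=1\}$ coincide; $H^m_{\mathrm{per}}(G)$ is defined in the same way. For $v\in L^2(\Omega)^2$ let $\pi\in H^1_{\mathrm{per}}(G)$ be the unique function with $\int_G\pi=0$ and $\langle\nabla_H\pi,\nabla_H\phi\rangle_{L^2(G)}=\langle\bar v,\nabla_H\phi\rangle_{L^2(G)}$ for all $\phi\in H^1_{\mathrm{per}}(G)$ with $\int_G\phi=0$, and put $P_2v:=v-\nabla_H\pi$ (the hydrostatic Helmholtz projection)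 and $X_2:=\mathrm{Ran}\,P_2\subset L^2(\Omega)^2$. The hydrostatic Stokes operator $A_2$ in $X_2$ is $$A_2v=-P_2\Delta v,\qquad D(A_2)=\{v\in H^2_{\mathrm{per}}(\Omega)^2:\ \mathrm{div}_H\,\bar v=0\text{ in }G,\ \partial_zv=0\text{ on }\Gamma_u,\ v=0\text{ on }\Gamma_b\},$$ and $D(A_2)$ carries the graph norm. Let $V_{1/2,2}=[X_2,D(A_2)]_{1/2}$ be the complex interpolation space, and $$V_\sigma=\{v\in H^1_{\mathrm{per}}(\Omega)^2:\ \mathrm{div}_H\,\bar v=0\text{ in }G,\ v=0\text{ on }\Gamma_b\}$$ with the norm of $H^1(\Omega)^2$. **Proposition.** $V_{1/2,2}=V_\sigma$, as subsets of $L^2(\Omega)^2$ and with equivalent norms: there are constants $c,C>0$ (depending only on $h$) such that $c\|v\|_{H^1(\Omega)}\le\|v\|_{V_{1/2,2}}\le C\|v\|_{H^1(\Omega)}$ for all $v\in V_\sigma$. -/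

import Mathlib

open MeasureTheory Set Filter
open scoped ContDiff Topology ENNReal ComplexConjugate

noncomputable section

/-! ### Sobolev spaces on open boxes -/

/-- The open box `∏ (aᵢ, bᵢ)`. -/
def openBox {d : ℕ} (a b : Fin d → ℝ) : Set (Fin d → ℝ) :=
  Set.univ.pi fun i => Ioo (a i) (b i)

/-- `L²` of the box with Lebesgue measure, complex valued. -/
abbrev L2Box {d : ℕ} (a b : Fin d → ℝ) : Type :=
  Lp ℂ 2 ((volume : Measure (Fin d → ℝ)).restrict (openBox a b))

/-- The classical partial derivative `∂ᵢ φ`. -/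
def pderiv {d : ℕ} (i : Fin d) (φ : (Fin d → ℝ) → ℂ) (x : Fin d → ℝ) : ℂ :=
  fderiv ℝ φ x (Pi.single i 1)

/-- `φ ∈ C_c^∞(U)`. -/
def IsTestFunction {d : ℕ} (U : Set (Fin d → ℝ)) (φ : (Fin d → ℝ) → ℂ) : Prop :=
  ContDiff ℝ ∞ φ ∧ HasCompactSupport φ ∧ tsupport φ ⊆ U

/-- `g = ∂ᵢ f` in the sense of distributions on the box. -/
def HasWeakDeriv {d : ℕ} {a b : Fin d → ℝ} (i : Fin d) (f g : L2Box a b) : Prop :=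
  ∀ φ : (Fin d → ℝ) → ℂ, IsTestFunction (openBox a b) φ →
    ∫ x in openBox a b, f x * pderiv i φ x = -∫ x in openBox a b, g x * φ x

open Classical in
/-- The weak derivative `∂ᵢ f ∈ L²`, when it exists (and `0` otherwise). -/
def weakDeriv {d : ℕ} {a b : Fin d → ℝ} (i : Fin d) (f : L2Box a b) : L2Box a b :=
  if h : ∃ g, HasWeakDeriv i f g then h.choose else 0

/-- `f ∈ H¹`. -/
def MemH1 {d : ℕ} {a b : Fin d → ℝ} (f : L2Box a b) : Prop :=
  ∀ i, ∃ g, HasWeakDeriv i f g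

/-- `f ∈ H²`. -/
def MemH2 {d : ℕ} {a b : Fin d → ℝ} (f : L2Box a b) : Prop :=
  MemH1 f ∧ ∀ i, MemH1 (weakDeriv i f)

/-- `g` is the trace of `f ∈ H¹` on the part `{xᵢ = c}` of the boundary of the box (so `c = aᵢ` or
`c = bᵢ`): functions smooth up to the boundary converge to `f` in `H¹` of the box while their
restrictions to the face converge to `g` in `L²` of the face. -/
def HasTrace {n : ℕ} {a b : Fin (n + 1) → ℝ} (i : Fin (n + 1)) (c : ℝ) (f : L2Box a b)
    (g : L2Box (fun j => a (i.succAbove j)) (fun j => b (i.succAbove j))) : Prop :=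
  ∃ F : ℕ → (Fin (n + 1) → ℝ) → ℂ, (∀ k, ContDiff ℝ ∞ (F k)) ∧
    Tendsto (fun k => eLpNorm (fun x => F k x - f x) 2 (volume.restrict (openBox a b)))
      atTop (𝓝 0) ∧
    (∀ j, Tendsto (fun k => eLpNorm (fun x => pderiv j (F k) x - weakDeriv j f x) 2
      (volume.restrict (openBox a b))) atTop (𝓝 0)) ∧
    Tendsto (fun k => eLpNorm (fun y : Fin n → ℝ => F k (i.insertNth c y) - g y) 2
      (volume.restrict (openBox (fun j => a (i.succAbove j)) (fun j => b (i.succAbove j)))))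
      atTop (𝓝 0)

/-- The traces of `f` on the two opposite faces `{xᵢ = aᵢ}` and `{xᵢ = bᵢ}` coincide. -/
def PeriodicTrace {n : ℕ} {a b : Fin (n + 1) → ℝ} (i : Fin (n + 1)) (f : L2Box a b) : Prop :=
  ∃ g, HasTrace i (a i) f g ∧ HasTrace i (b i) f g

/-! ### The domain -/

/-- Lower corner of `Ω = (0,1)² × (-h,0)`. -/
def loΩ (h : ℝ) : Fin 3 → ℝ := ![0, 0, -h]

/-- Upper corner of `Ω`. -/
def hiΩ : Fin 3 → ℝ := ![1, 1, 0]

/-- Lower corner of `G = (0,1)²`. -/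
def loG : Fin 2 → ℝ := ![0, 0]

/-- Upper corner of `G`. -/
def hiG : Fin 2 → ℝ := ![1, 1]

/-- `L²(Ω)`. -/
abbrev L2Ω (h : ℝ) : Type := L2Box (loΩ h) hiΩ

/-- `L²(G)`. -/
abbrev L2G : Type := L2Box loG hiG

/-- The Hilbert space `L²(Ω)²`. -/
abbrev L2Ωvec (h : ℝ) : Type := PiLp 2 fun _ : Fin 2 => L2Ω h

/-- `H¹_per(Ω)`: periodic (of order `0`) in the two horizontal directions. -/
def MemH1perΩ {h : ℝ} (f : L2Ω h) : Prop :=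
  MemH1 f ∧ PeriodicTrace 0 f ∧ PeriodicTrace 1 f

/-- `H²_per(Ω)`: periodic of order `1` in the two horizontal directions. -/
def MemH2perΩ {h : ℝ} (f : L2Ω h) : Prop :=
  MemH2 f ∧ PeriodicTrace 0 f ∧ PeriodicTrace 1 f ∧
    PeriodicTrace 0 (weakDeriv 0 f) ∧ PeriodicTrace 1 (weakDeriv 1 f)

/-- `H¹_per(G)`. -/
def MemH1perG (f : L2G) : Prop :=
  MemH1 f ∧ PeriodicTrace 0 f ∧ PeriodicTrace 1 f

/-- The vertical average `f̄(x,y) = h⁻¹ ∫_{-h}^0 f(x,y,z) dz`. -/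
def vertAvg {h : ℝ} (f : L2Ω h) (y : Fin 2 → ℝ) : ℂ :=
  (h : ℂ)⁻¹ * ∫ z in Ioo (-h) 0, f ((2 : Fin 3).insertNth z y)

/-- `div_H v̄ = 0` in `G` (in the sense of distributions). -/
def DivFreeAvg {h : ℝ} (v : L2Ωvec h) : Prop :=
  ∀ φ : (Fin 2 → ℝ) → ℂ, IsTestFunction (openBox loG hiG) φ →
    ∑ j : Fin 2, ∫ y in openBox loG hiG, vertAvg (v j) y * pderiv j φ y = 0

/-! ### Auxiliary facts: linearity and uniqueness -/

lemma isOpen_openBox {d : ℕ} (a b : Fin d → ℝ) : IsOpen (openBox a b) :=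
  isOpen_set_pi Set.finite_univ fun _ _ => isOpen_Ioo

lemma measurableSet_openBox {d : ℕ} (a b : Fin d → ℝ) : MeasurableSet (openBox a b) :=
  (isOpen_openBox a b).measurableSet

instance {d : ℕ} (a b : Fin d → ℝ) :
    IsFiniteMeasure ((volume : Measure (Fin d → ℝ)).restrict (openBox a b)) := by
  refine ⟨?_⟩
  rw [Measure.restrict_apply_univ, openBox, Real.volume_pi_Ioo]
  exact ENNReal.prod_lt_top fun _ _ => ENNReal.ofReal_lt_top

lemma IsTestFunction.memLp {d : ℕ} {U : Set (Fin d → ℝ)} {φ : (Fin d → ℝ) → ℂ}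
    (hφ : IsTestFunction U φ) (V : Set (Fin d → ℝ)) : MemLp φ 2 (volume.restrict V) :=
  (hφ.1.continuous.memLp_of_hasCompactSupport hφ.2.1).restrict V

lemma IsTestFunction.memLp_pderiv {d : ℕ} {U : Set (Fin d → ℝ)} {φ : (Fin d → ℝ) → ℂ}
    (hφ : IsTestFunction U φ) (V : Set (Fin d → ℝ)) (i : Fin d) :
    MemLp (pderiv i φ) 2 (volume.restrict V) := by
  have hc : Continuous (pderiv i φ) :=
    (hφ.1.continuous_fderiv (by simp)).clm_apply continuous_const
  exact (hc.memLp_of_hasCompactSupport (hφ.2.1.fderiv_apply ℝ _)).restrict V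

lemma integrable_L2_mul {d : ℕ} {a b : Fin d → ℝ} (f : L2Box a b) {c : (Fin d → ℝ) → ℂ}
    (hc : MemLp c 2 (volume.restrict (openBox a b))) :
    Integrable (fun x => f x * c x) (volume.restrict (openBox a b)) :=
  MemLp.integrable_mul (Lp.memLp f) hc

lemma integral_L2_add_mul {d : ℕ} {a b : Fin d → ℝ} (f g : L2Box a b) {c : (Fin d → ℝ) → ℂ}
    (hc : MemLp c 2 (volume.restrict (openBox a b))) :
    ∫ x in openBox a b, (f + g : L2Box a b) x * c x
      = (∫ x in openBox a b, f x * c x) + ∫ x in openBox a b, g x * c x := by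
  rw [← integral_add (integrable_L2_mul f hc) (integrable_L2_mul g hc)]
  refine integral_congr_ae ?_
  filter_upwards [Lp.coeFn_add f g] with x hx
  rw [hx, Pi.add_apply, add_mul]

lemma integral_L2_smul_mul {d : ℕ} {a b : Fin d → ℝ} (r : ℂ) (f : L2Box a b)
    (c : (Fin d → ℝ) → ℂ) :
    ∫ x in openBox a b, (r • f : L2Box a b) x * c x = r * ∫ x in openBox a b, f x * c x := by
  rw [← integral_const_mul]
  refine integral_congr_ae ?_
  filter_upwards [Lp.coeFn_smul r f] with x hx
  rw [hx, Pi.smul_apply, smul_eq_mul, mul_assoc]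

section Linear

variable {d : ℕ} {a b : Fin d → ℝ}

lemma HasWeakDeriv.add {i : Fin d} {f f' g g' : L2Box a b} (h : HasWeakDeriv i f g)
    (h' : HasWeakDeriv i f' g') : HasWeakDeriv i (f + f') (g + g') := by
  intro φ hφ
  rw [integral_L2_add_mul _ _ (hφ.memLp_pderiv _ i), integral_L2_add_mul _ _ (hφ.memLp _),
    h φ hφ, h' φ hφ, neg_add]

lemma HasWeakDeriv.smul {i : Fin d} {f g : L2Box a b} (r : ℂ) (h : HasWeakDeriv i f g) :
    HasWeakDeriv i (r • f) (r • g) := by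
  intro φ hφ
  rw [integral_L2_smul_mul, integral_L2_smul_mul, h φ hφ, mul_neg]

lemma HasWeakDeriv.unique {i : Fin d} {f g g' : L2Box a b} (h : HasWeakDeriv i f g)
    (h' : HasWeakDeriv i f g') : g = g' := by
  have h0 : HasWeakDeriv i (0 : L2Box a b) (g - g') := by
    have := h.add (h'.smul (-1))
    simpa [sub_eq_add_neg] using this
  have key := (isOpen_openBox a b).ae_eq_zero_of_integral_contDiff_smul_eq_zero
    (f := fun x => (g - g' : L2Box a b) x) (μ := volume.restrict (openBox a b))
    ((((Lp.memLp (g - g')).integrable (by norm_num)).locallyIntegrable).locallyIntegrableOn _) (by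
      intro ψ h1 h2 h3
      have hsup : IsTestFunction (openBox a b) (fun x => (ψ x : ℂ)) :=
        ⟨Complex.ofRealCLM.contDiff.comp h1, h2.comp_left (g := fun t : ℝ => (t : ℂ)) rfl,
          (closure_mono (Function.support_comp_subset (g := fun t : ℝ => (t : ℂ)) rfl ψ)).trans h3⟩
      have h4 := h0 _ hsup
      have h5 : ∫ x in openBox a b, (0 : L2Box a b) x * pderiv i (fun x => (ψ x : ℂ)) x = 0 := by
        simpa using integral_L2_smul_mul 0 (0 : L2Box a b) (pderiv i (fun x => (ψ x : ℂ)))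
      rw [h5] at h4
      rw [← neg_eq_zero, h4]
      congr 1
      refine integral_congr_ae (Eventually.of_forall fun x => ?_)
      simp [mul_comm])
  have h6 : g - g' = 0 := by
    rw [Lp.eq_zero_iff_ae_eq_zero]
    filter_upwards [key, ae_restrict_mem (measurableSet_openBox a b)] with x hx hm
    exact hx hm
  exact sub_eq_zero.1 h6

lemma MemH1.hasWeakDeriv {f : L2Box a b} (hf : MemH1 f) (i : Fin d) :
    HasWeakDeriv i f (weakDeriv i f) := by
  rw [weakDeriv, dif_pos (hf i)]
  exact (hf i).choose_spec

lemma HasWeakDeriv.eq {i : Fin d} {f g : L2Box a b} (h : HasWeakDeriv i f g) :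
    weakDeriv i f = g := by
  have h' : ∃ g, HasWeakDeriv i f g := ⟨g, h⟩
  rw [weakDeriv, dif_pos h']
  exact h'.choose_spec.unique h

lemma hasWeakDeriv_zero (i : Fin d) : HasWeakDeriv i (0 : L2Box a b) 0 := by
  intro φ _
  have h1 := integral_L2_smul_mul 0 (0 : L2Box a b) φ
  have h2 := integral_L2_smul_mul 0 (0 : L2Box a b) (pderiv i φ)
  rw [zero_smul, zero_mul] at h1 h2
  rw [h1, h2, neg_zero]

lemma memH1_zero : MemH1 (0 : L2Box a b) := fun i => ⟨0, hasWeakDeriv_zero i⟩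

lemma MemH1.add {f g : L2Box a b} (hf : MemH1 f) (hg : MemH1 g) : MemH1 (f + g) :=
  fun i => ⟨_, (hf.hasWeakDeriv i).add (hg.hasWeakDeriv i)⟩

lemma MemH1.smul {f : L2Box a b} (r : ℂ) (hf : MemH1 f) : MemH1 (r • f) :=
  fun i => ⟨_, (hf.hasWeakDeriv i).smul r⟩

lemma weakDeriv_zero (i : Fin d) : weakDeriv i (0 : L2Box a b) = 0 := (hasWeakDeriv_zero i).eq

lemma weakDeriv_add {f g : L2Box a b} (hf : MemH1 f) (hg : MemH1 g) (i : Fin d) :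
    weakDeriv i (f + g) = weakDeriv i f + weakDeriv i g :=
  ((hf.hasWeakDeriv i).add (hg.hasWeakDeriv i)).eq

lemma weakDeriv_smul {f : L2Box a b} (r : ℂ) (hf : MemH1 f) (i : Fin d) :
    weakDeriv i (r • f) = r • weakDeriv i f :=
  ((hf.hasWeakDeriv i).smul r).eq

lemma memH2_zero : MemH2 (0 : L2Box a b) :=
  ⟨memH1_zero, fun i => by rw [weakDeriv_zero]; exact memH1_zero⟩

lemma MemH2.add {f g : L2Box a b} (hf : MemH2 f) (hg : MemH2 g) : MemH2 (f + g) :=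
  ⟨hf.1.add hg.1, fun i => by rw [weakDeriv_add hf.1 hg.1]; exact (hf.2 i).add (hg.2 i)⟩

lemma MemH2.smul {f : L2Box a b} (r : ℂ) (hf : MemH2 f) : MemH2 (r • f) :=
  ⟨hf.1.smul r, fun i => by rw [weakDeriv_smul r hf.1]; exact (hf.2 i).smul r⟩

lemma tendsto_eLpNorm_add {α : Type*} [MeasurableSpace α] {μ : Measure α}
    {F F' : ℕ → α → ℂ} (u v w : Lp ℂ 2 μ) (hw : w = u + v)
    (hm : ∀ k, AEStronglyMeasurable (F k) μ) (hm' : ∀ k, AEStronglyMeasurable (F' k) μ)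
    (h : Tendsto (fun k => eLpNorm (fun x => F k x - u x) 2 μ) atTop (𝓝 0))
    (h' : Tendsto (fun k => eLpNorm (fun x => F' k x - v x) 2 μ) atTop (𝓝 0)) :
    Tendsto (fun k => eLpNorm (fun x => (F k x + F' k x) - w x) 2 μ) atTop (𝓝 0) := by
  subst hw
  refine tendsto_of_tendsto_of_tendsto_of_le_of_le tendsto_const_nhds
    (by simpa using h.add h') (fun _ => zero_le) fun k => ?_
  have e : eLpNorm (fun x => (F k x + F' k x) - (u + v : Lp ℂ 2 μ) x) 2 μ
      = eLpNorm ((fun x => F k x - u x) + fun x => F' k x - v x) 2 μ := by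
    refine eLpNorm_congr_ae ?_
    filter_upwards [Lp.coeFn_add u v] with x hx
    simp only [hx, Pi.add_apply]; ring
  change eLpNorm _ 2 μ ≤ _
  rw [e]
  exact eLpNorm_add_le ((hm k).sub (Lp.aestronglyMeasurable u))
    ((hm' k).sub (Lp.aestronglyMeasurable v)) (by norm_num)

lemma tendsto_eLpNorm_smul {α : Type*} [MeasurableSpace α] {μ : Measure α}
    {F : ℕ → α → ℂ} (r : ℂ) (u w : Lp ℂ 2 μ) (hw : w = r • u)
    (h : Tendsto (fun k => eLpNorm (fun x => F k x - u x) 2 μ) atTop (𝓝 0)) :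
    Tendsto (fun k => eLpNorm (fun x => r * F k x - w x) 2 μ) atTop (𝓝 0) := by
  subst hw
  have e : ∀ k, eLpNorm (fun x => r * F k x - (r • u : Lp ℂ 2 μ) x) 2 μ
      = ‖r‖ₑ * eLpNorm (fun x => F k x - u x) 2 μ := by
    intro k
    rw [← eLpNorm_const_smul]
    refine eLpNorm_congr_ae ?_
    filter_upwards [Lp.coeFn_smul r u] with x hx
    simp only [hx, Pi.smul_apply, smul_eq_mul, mul_sub]
  simp only [e]
  simpa using ENNReal.Tendsto.const_mul h (Or.inr enorm_ne_top)

end Linear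

section LinearTrace

variable {n : ℕ} {a b : Fin (n + 1) → ℝ}

lemma continuous_pderiv {d : ℕ} {φ : (Fin d → ℝ) → ℂ} (h : ContDiff ℝ ∞ φ) (i : Fin d) :
    Continuous (pderiv i φ) :=
  (h.continuous_fderiv (by simp)).clm_apply continuous_const

lemma hasTrace_zero (i : Fin (n + 1)) (c : ℝ) : HasTrace i c (0 : L2Box a b) 0 := by
  have key : ∀ {m : ℕ} (a' b' : Fin m → ℝ),
      eLpNorm (fun x => (0 : ℂ) - (0 : L2Box a' b') x) 2 (volume.restrict (openBox a' b')) = 0 := by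
    intro m a' b'
    rw [eLpNorm_congr_ae (g := fun _ => (0 : ℂ))]
    · simp
    · filter_upwards [Lp.coeFn_zero ℂ 2 (volume.restrict (openBox a' b'))] with x hx
      rw [hx, Pi.zero_apply, sub_zero]
  refine ⟨fun _ _ => 0, fun _ => contDiff_const, ?_, fun j => ?_, ?_⟩
  · simp only [key]; exact tendsto_const_nhds
  · have : pderiv j (fun _ : Fin (n + 1) → ℝ => (0 : ℂ)) = fun _ => 0 := by
      funext x; simp [pderiv]
    simp only [weakDeriv_zero, this, key]; exact tendsto_const_nhds
  · simp only [key]; exact tendsto_const_nhds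

lemma HasTrace.add {i : Fin (n + 1)} {c : ℝ} {f f' : L2Box a b}
    {g g' : L2Box (fun j => a (i.succAbove j)) (fun j => b (i.succAbove j))}
    (hf : MemH1 f) (hf' : MemH1 f') (h : HasTrace i c f g) (h' : HasTrace i c f' g') :
    HasTrace i c (f + f') (g + g') := by
  obtain ⟨F, h1, h2, h3, h4⟩ := h
  obtain ⟨F', h1', h2', h3', h4'⟩ := h'
  have hins : Continuous fun y : Fin n → ℝ => (i.insertNth c y : Fin (n + 1) → ℝ) :=
    Continuous.finInsertNth i continuous_const continuous_id
  refine ⟨fun k x => F k x + F' k x, fun k => (h1 k).add (h1' k), ?_, fun j => ?_, ?_⟩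
  · exact tendsto_eLpNorm_add f f' _ rfl (fun k => (h1 k).continuous.aestronglyMeasurable)
      (fun k => (h1' k).continuous.aestronglyMeasurable) h2 h2'
  · have e : ∀ k, pderiv j (fun x => F k x + F' k x)
        = fun x => pderiv j (F k) x + pderiv j (F' k) x := by
      intro k; funext x
      have hd := fderiv_fun_add (((h1 k).differentiable (by simp)) x)
        (((h1' k).differentiable (by simp)) x)
      simp only [pderiv, hd, add_apply]
    simp only [e]
    exact tendsto_eLpNorm_add _ _ _ (weakDeriv_add hf hf' j)
      (fun k => (continuous_pderiv (h1 k) j).aestronglyMeasurable)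
      (fun k => (continuous_pderiv (h1' k) j).aestronglyMeasurable) (h3 j) (h3' j)
  · exact tendsto_eLpNorm_add g g' _ rfl
      (fun k => ((h1 k).continuous.comp hins).aestronglyMeasurable)
      (fun k => ((h1' k).continuous.comp hins).aestronglyMeasurable) h4 h4'

lemma HasTrace.smul {i : Fin (n + 1)} {c : ℝ} {f : L2Box a b}
    {g : L2Box (fun j => a (i.succAbove j)) (fun j => b (i.succAbove j))}
    (r : ℂ) (hf : MemH1 f) (h : HasTrace i c f g) : HasTrace i c (r • f) (r • g) := by
  obtain ⟨F, h1, h2, h3, h4⟩ := h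
  refine ⟨fun k x => r * F k x, fun k => contDiff_const.mul (h1 k), ?_, fun j => ?_, ?_⟩
  · exact tendsto_eLpNorm_smul r f _ rfl h2
  · have e : ∀ k, pderiv j (fun x => r * F k x) = fun x => r * pderiv j (F k) x := by
      intro k; funext x
      have hd := fderiv_const_mul (((h1 k).differentiable (by simp)) x) r
      simp only [pderiv, hd, smul_apply, smul_eq_mul]
    simp only [e]
    exact tendsto_eLpNorm_smul r _ _ (weakDeriv_smul r hf j) (h3 j)
  · exact tendsto_eLpNorm_smul r g _ rfl h4

lemma periodicTrace_zero (i : Fin (n + 1)) : PeriodicTrace i (0 : L2Box a b) :=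
  ⟨0, hasTrace_zero i _, hasTrace_zero i _⟩

lemma PeriodicTrace.add {i : Fin (n + 1)} {f f' : L2Box a b} (hf : MemH1 f) (hf' : MemH1 f')
    (h : PeriodicTrace i f) (h' : PeriodicTrace i f') : PeriodicTrace i (f + f') := by
  obtain ⟨g, h1, h2⟩ := h
  obtain ⟨g', h1', h2'⟩ := h'
  exact ⟨g + g', h1.add hf hf' h1', h2.add hf hf' h2'⟩

lemma PeriodicTrace.smul {i : Fin (n + 1)} {f : L2Box a b} (r : ℂ) (hf : MemH1 f)
    (h : PeriodicTrace i f) : PeriodicTrace i (r • f) := by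
  obtain ⟨g, h1, h2⟩ := h
  exact ⟨r • g, h1.smul r hf, h2.smul r hf⟩

end LinearTrace

lemma memH1perG_zero : MemH1perG 0 := ⟨memH1_zero, periodicTrace_zero 0, periodicTrace_zero 1⟩

lemma MemH1perG.add {f g : L2G} (hf : MemH1perG f) (hg : MemH1perG g) : MemH1perG (f + g) :=
  ⟨hf.1.add hg.1, hf.2.1.add hf.1 hg.1 hg.2.1, hf.2.2.add hf.1 hg.1 hg.2.2⟩

lemma MemH1perG.smul {f : L2G} (r : ℂ) (hf : MemH1perG f) : MemH1perG (r • f) :=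
  ⟨hf.1.smul r, hf.2.1.smul r hf.1, hf.2.2.smul r hf.1⟩

lemma memH2perΩ_zero {h : ℝ} : MemH2perΩ (0 : L2Ω h) := by
  refine ⟨memH2_zero, periodicTrace_zero 0, periodicTrace_zero 1, ?_, ?_⟩ <;>
  · rw [weakDeriv_zero]; exact periodicTrace_zero _

lemma MemH2perΩ.add {h : ℝ} {f g : L2Ω h} (hf : MemH2perΩ f) (hg : MemH2perΩ g) :
    MemH2perΩ (f + g) := by
  obtain ⟨f1, f2, f3, f4, f5⟩ := hf
  obtain ⟨g1, g2, g3, g4, g5⟩ := hg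
  refine ⟨f1.add g1, f2.add f1.1 g1.1 g2, f3.add f1.1 g1.1 g3, ?_, ?_⟩ <;>
    rw [weakDeriv_add f1.1 g1.1]
  · exact f4.add (f1.2 0) (g1.2 0) g4
  · exact f5.add (f1.2 1) (g1.2 1) g5

lemma MemH2perΩ.smul {h : ℝ} {f : L2Ω h} (r : ℂ) (hf : MemH2perΩ f) : MemH2perΩ (r • f) := by
  obtain ⟨f1, f2, f3, f4, f5⟩ := hf
  refine ⟨f1.smul r, f2.smul r f1.1, f3.smul r f1.1, ?_, ?_⟩ <;> rw [weakDeriv_smul r f1.1]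
  · exact f4.smul r (f1.2 0)
  · exact f5.smul r (f1.2 1)

lemma measurePreserving_split (h : ℝ) :
    MeasurePreserving (MeasurableEquiv.piFinSuccAbove (fun _ : Fin 3 => ℝ) 2)
      ((volume : Measure (Fin 3 → ℝ)).restrict (openBox (loΩ h) hiΩ))
      (((volume : Measure ℝ).restrict (Ioo (-h) 0)).prod
        ((volume : Measure (Fin 2 → ℝ)).restrict (openBox loG hiG))) := by
  have h1 := (volume_preserving_piFinSuccAbove (fun _ : Fin 3 => ℝ) 2).restrict_preimage
    (measurableSet_Ioo.prod (measurableSet_openBox loG hiG) :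
      MeasurableSet (Ioo (-h) 0 ×ˢ openBox loG hiG))
  have h2 : (MeasurableEquiv.piFinSuccAbove (fun _ : Fin 3 => ℝ) 2) ⁻¹'
      (Ioo (-h) 0 ×ˢ openBox loG hiG) = openBox (loΩ h) hiΩ := by
    ext x
    simp only [openBox, loΩ, hiΩ, loG, hiG, MeasurableEquiv.piFinSuccAbove, Set.mem_preimage,
      Set.mem_prod, Set.mem_univ_pi, Fin.forall_fin_succ]
    simp [Fin.insertNthEquiv, Fin.removeNth, Fin.succAbove]
    tauto
  rw [h2, Measure.volume_eq_prod, ← Measure.prod_restrict] at h1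
  exact h1

/-- Forgetting the vertical coordinate. -/
def horiz (x : Fin 3 → ℝ) : Fin 2 → ℝ := (2 : Fin 3).removeNth x

lemma measurePreserving_memLp_horiz {h : ℝ} {c : (Fin 2 → ℝ) → ℂ}
    (hc : MemLp c 2 (volume.restrict (openBox loG hiG))) :
    MemLp (fun x => c (horiz x)) 2 (volume.restrict (openBox (loΩ h) hiΩ)) :=
  (hc.comp_snd (volume.restrict (Ioo (-h) 0))).comp_measurePreserving (measurePreserving_split h)

lemma integral_vertAvg_mul {h : ℝ} (f : L2Ω h) {c : (Fin 2 → ℝ) → ℂ}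
    (hc : MemLp c 2 (volume.restrict (openBox loG hiG))) :
    ∫ y in openBox loG hiG, vertAvg f y * c y
      = (h : ℂ)⁻¹ * ∫ x in openBox (loΩ h) hiΩ, f x * c (horiz x) := by
  have hmp := measurePreserving_split h
  have hint := integrable_L2_mul f (measurePreserving_memLp_horiz (h := h) hc)
  set e := MeasurableEquiv.piFinSuccAbove (fun _ : Fin 3 => ℝ) 2 with he
  have e1 : ∀ p : ℝ × (Fin 2 → ℝ), e.symm p = (2 : Fin 3).insertNth p.1 p.2 := fun p => rfl
  have e2 : ∀ p : ℝ × (Fin 2 → ℝ), horiz (e.symm p) = p.2 := fun p => by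
    rw [e1, horiz, Fin.removeNth_insertNth]
  have hmp' := hmp.symm e
  have hint' : Integrable (fun p : ℝ × (Fin 2 → ℝ) => f ((2 : Fin 3).insertNth p.1 p.2) * c p.2)
      (((volume : Measure ℝ).restrict (Ioo (-h) 0)).prod
        ((volume : Measure (Fin 2 → ℝ)).restrict (openBox loG hiG))) := by
    have := (hmp'.integrable_comp_emb e.symm.measurableEmbedding).2 hint
    refine this.congr (Eventually.of_forall fun p => ?_)
    simp only [Function.comp_apply, e2]
    rw [e1]
  rw [← hmp'.integral_comp e.symm.measurableEmbedding]
  simp only [e2]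
  simp only [e1]
  rw [integral_prod_symm _ hint', ← integral_const_mul]
  refine integral_congr_ae (Eventually.of_forall fun y => ?_)
  simp only [vertAvg]
  rw [integral_mul_const, mul_assoc]

lemma integral_vertAvg_add_mul {h : ℝ} (f g : L2Ω h) {c : (Fin 2 → ℝ) → ℂ}
    (hc : MemLp c 2 (volume.restrict (openBox loG hiG))) :
    ∫ y in openBox loG hiG, vertAvg (f + g) y * c y
      = (∫ y in openBox loG hiG, vertAvg f y * c y)
        + ∫ y in openBox loG hiG, vertAvg g y * c y := by
  rw [integral_vertAvg_mul _ hc, integral_vertAvg_mul _ hc, integral_vertAvg_mul _ hc,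
    integral_L2_add_mul _ _ (measurePreserving_memLp_horiz hc), mul_add]

lemma integral_vertAvg_smul_mul {h : ℝ} (r : ℂ) (f : L2Ω h) {c : (Fin 2 → ℝ) → ℂ}
    (hc : MemLp c 2 (volume.restrict (openBox loG hiG))) :
    ∫ y in openBox loG hiG, vertAvg (r • f) y * c y
      = r * ∫ y in openBox loG hiG, vertAvg f y * c y := by
  rw [integral_vertAvg_mul _ hc, integral_vertAvg_mul _ hc, integral_L2_smul_mul]
  ring

lemma DivFreeAvg.add {h : ℝ} {v w : L2Ωvec h} (hv : DivFreeAvg v) (hw : DivFreeAvg w) :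
    DivFreeAvg (v + w) := by
  intro φ hφ
  simp only [PiLp.add_apply, integral_vertAvg_add_mul _ _ (hφ.memLp_pderiv _ _),
    Finset.sum_add_distrib, hv φ hφ, hw φ hφ, add_zero]

lemma DivFreeAvg.smul {h : ℝ} {v : L2Ωvec h} (r : ℂ) (hv : DivFreeAvg v) :
    DivFreeAvg (r • v) := by
  intro φ hφ
  simp only [PiLp.smul_apply, integral_vertAvg_smul_mul _ _ (hφ.memLp_pderiv _ _),
    ← Finset.mul_sum, hv φ hφ, mul_zero]

lemma memLp_conj {d : ℕ} {a b : Fin d → ℝ} (f : L2Box a b) :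
    MemLp (fun x => conj (f x)) 2 (volume.restrict (openBox a b)) :=
  (Lp.memLp f).star

/-! ### The hydrostatic Helmholtz projection -/

/-- `π ∈ H¹_per(G) ∩ L²₀(G)` solves
`⟨∇_H π, ∇_H φ⟩ = ⟨v̄, ∇_H φ⟩` for all `φ ∈ H¹_per(G) ∩ L²₀(G)`. -/
def IsPressure {h : ℝ} (v : L2Ωvec h) (π : L2G) : Prop :=
  MemH1perG π ∧ ∫ y in openBox loG hiG, π y = 0 ∧
    ∀ φ : L2G, MemH1perG φ → ∫ y in openBox loG hiG, φ y = 0 →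
      ∑ j : Fin 2, ∫ y in openBox loG hiG, weakDeriv j π y * conj (weakDeriv j φ y)
        = ∑ j : Fin 2, ∫ y in openBox loG hiG, vertAvg (v j) y * conj (weakDeriv j φ y)

/-- `u = v - ∇_H π`, where `π` is the solution of the above weak problem. -/
def IsHelmholtz {h : ℝ} (v u : L2Ωvec h) : Prop :=
  ∃ π : L2G, IsPressure v π ∧ ∀ j : Fin 2,
    u j =ᵐ[volume.restrict (openBox (loΩ h) hiΩ)] fun x => v j x - weakDeriv j π (horiz x)

lemma integral_L2_add {d : ℕ} {a b : Fin d → ℝ} (f g : L2Box a b) :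
    ∫ x in openBox a b, (f + g : L2Box a b) x
      = (∫ x in openBox a b, f x) + ∫ x in openBox a b, g x := by
  simpa using integral_L2_add_mul f g (memLp_const (1 : ℂ))

lemma integral_L2_smul {d : ℕ} {a b : Fin d → ℝ} (r : ℂ) (f : L2Box a b) :
    ∫ x in openBox a b, (r • f : L2Box a b) x = r * ∫ x in openBox a b, f x := by
  simpa using integral_L2_smul_mul r f fun _ => 1

lemma ae_comp_horiz {h : ℝ} {p : (Fin 2 → ℝ) → Prop}
    (hp : ∀ᵐ y ∂(volume.restrict (openBox loG hiG)), p y) :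
    ∀ᵐ x ∂(volume.restrict (openBox (loΩ h) hiΩ)), p (horiz x) :=
  (Measure.quasiMeasurePreserving_snd.comp
    (measurePreserving_split h).quasiMeasurePreserving).ae hp

lemma IsPressure.add {h : ℝ} {v v' : L2Ωvec h} {π π' : L2G} (H : IsPressure v π)
    (H' : IsPressure v' π') : IsPressure (v + v') (π + π') := by
  refine ⟨H.1.add H'.1, by rw [integral_L2_add, H.2.1, H'.2.1, add_zero], fun φ h1 h2 => ?_⟩
  simp only [weakDeriv_add H.1.1 H'.1.1, PiLp.add_apply, integral_L2_add_mul _ _ (memLp_conj _),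
    integral_vertAvg_add_mul _ _ (memLp_conj _), Finset.sum_add_distrib, H.2.2 φ h1 h2,
    H'.2.2 φ h1 h2]

lemma IsPressure.smul {h : ℝ} {v : L2Ωvec h} {π : L2G} (r : ℂ) (H : IsPressure v π) :
    IsPressure (r • v) (r • π) := by
  refine ⟨H.1.smul r, by rw [integral_L2_smul, H.2.1, mul_zero], fun φ h1 h2 => ?_⟩
  have e := integral_L2_smul_mul (a := loG) (b := hiG) r
  simp only [weakDeriv_smul r H.1.1, PiLp.smul_apply, e,
    integral_vertAvg_smul_mul _ _ (memLp_conj _), ← Finset.mul_sum, H.2.2 φ h1 h2]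

lemma IsHelmholtz.add {h : ℝ} {v v' u u' : L2Ωvec h} (H : IsHelmholtz v u)
    (H' : IsHelmholtz v' u') : IsHelmholtz (v + v') (u + u') := by
  obtain ⟨π, h1, h2⟩ := H
  obtain ⟨π', h1', h2'⟩ := H'
  refine ⟨π + π', h1.add h1', fun j => ?_⟩
  rw [weakDeriv_add h1.1.1 h1'.1.1, PiLp.add_apply, PiLp.add_apply]
  filter_upwards [h2 j, h2' j, Lp.coeFn_add (u j) (u' j), Lp.coeFn_add (v j) (v' j),
    ae_comp_horiz (h := h) (Lp.coeFn_add (weakDeriv j π) (weakDeriv j π'))] with x a1 a2 a3 a4 a5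
  rw [a3, a4, a5, Pi.add_apply, Pi.add_apply, Pi.add_apply, a1, a2]
  ring

lemma IsHelmholtz.smul {h : ℝ} {v u : L2Ωvec h} (r : ℂ) (H : IsHelmholtz v u) :
    IsHelmholtz (r • v) (r • u) := by
  obtain ⟨π, h1, h2⟩ := H
  refine ⟨r • π, h1.smul r, fun j => ?_⟩
  rw [weakDeriv_smul r h1.1.1, PiLp.smul_apply, PiLp.smul_apply]
  filter_upwards [h2 j, Lp.coeFn_smul r (u j), Lp.coeFn_smul r (v j),
    ae_comp_horiz (h := h) (Lp.coeFn_smul r (weakDeriv j π))] with x a1 a3 a4 a5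
  rw [a3, a4, a5, Pi.smul_apply, Pi.smul_apply, Pi.smul_apply, a1, smul_eq_mul, smul_eq_mul,
    smul_eq_mul]
  ring

lemma isHelmholtz_zero {h : ℝ} : IsHelmholtz (0 : L2Ωvec h) 0 := by
  refine ⟨0, ⟨memH1perG_zero, ?_, fun φ _ _ => ?_⟩, fun j => ?_⟩
  · simpa using integral_L2_smul (a := loG) (b := hiG) 0 0
  · refine Finset.sum_congr rfl fun j _ => ?_
    have e1 := integral_L2_smul_mul (a := loG) (b := hiG) 0 0 fun y => conj (weakDeriv j φ y)
    have e2 := integral_vertAvg_smul_mul (h := h) 0 0 (memLp_conj (weakDeriv j φ))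
    rw [zero_smul, zero_mul] at e1 e2
    rw [weakDeriv_zero, e1]
    exact e2.symm
  · rw [weakDeriv_zero]
    filter_upwards [Lp.coeFn_zero ℂ 2 (volume.restrict (openBox (loΩ h) hiΩ)),
      ae_comp_horiz (h := h) (Lp.coeFn_zero ℂ 2 (volume.restrict (openBox loG hiG)))] with x a1 a2
    rw [PiLp.zero_apply, a1, a2, Pi.zero_apply, Pi.zero_apply, sub_zero]

lemma IsHelmholtz.eq_zero {h : ℝ} {u : L2Ωvec h} (H : IsHelmholtz 0 u) : u = 0 := by
  obtain ⟨π, h1, h2⟩ := H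
  have e := h1.2.2 π h1.1 h1.2.1
  have e0 : ∀ j : Fin 2, ∫ y in openBox loG hiG,
      vertAvg ((0 : L2Ωvec h) j) y * conj (weakDeriv j π y) = 0 := fun j => by
    simpa using integral_vertAvg_smul_mul (h := h) 0 0 (memLp_conj (weakDeriv j π))
  simp only [e0, Finset.sum_const_zero] at e
  have e1 : ∀ j : Fin 2, ∫ y in openBox loG hiG, weakDeriv j π y * conj (weakDeriv j π y)
      = ((‖weakDeriv j π‖ ^ 2 : ℝ) : ℂ) := fun j => by
    have := L2.inner_def (𝕜 := ℂ) (weakDeriv j π) (weakDeriv j π)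
    rw [inner_self_eq_norm_sq_to_K] at this
    push_cast
    refine Eq.trans ?_ this.symm
    exact integral_congr_ae (Eventually.of_forall fun y => by simp [Complex.mul_conj'])
  simp only [e1, Fin.sum_univ_two] at e
  have e2 : ‖weakDeriv 0 π‖ ^ 2 + ‖weakDeriv 1 π‖ ^ 2 = 0 := by exact_mod_cast e
  have e3 : ∀ j : Fin 2, weakDeriv j π = 0 := by
    have p0 := sq_nonneg ‖weakDeriv 0 π‖
    have p1 := sq_nonneg ‖weakDeriv 1 π‖
    have q0 : ‖weakDeriv 0 π‖ = 0 := pow_eq_zero_iff two_ne_zero |>.1 (by linarith)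
    have q1 : ‖weakDeriv 1 π‖ = 0 := pow_eq_zero_iff two_ne_zero |>.1 (by linarith)
    exact Fin.forall_fin_two.2 ⟨norm_eq_zero.1 q0, norm_eq_zero.1 q1⟩
  ext1 j
  change u j = 0
  rw [Lp.eq_zero_iff_ae_eq_zero]
  have h3 := h2 j
  rw [e3] at h3
  filter_upwards [h3, Lp.coeFn_zero ℂ 2 (volume.restrict (openBox (loΩ h) hiΩ)),
    ae_comp_horiz (h := h) (Lp.coeFn_zero ℂ 2 (volume.restrict (openBox loG hiG)))] with x a1 a2 a3
  rw [a1, a3, PiLp.zero_apply, a2]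
  simp

/-- The graph of the hydrostatic Helmholtz projection. -/
def helmholtzGraph (h : ℝ) : Submodule ℂ (L2Ωvec h × L2Ωvec h) where
  carrier := {p | IsHelmholtz p.1 p.2}
  add_mem' := fun hp hq => IsHelmholtz.add hp hq
  zero_mem' := isHelmholtz_zero
  smul_mem' := fun r _ hp => IsHelmholtz.smul r hp

/-- The hydrostatic Helmholtz projection `P₂ v = v - ∇_H π` in `L²(Ω)²`. -/
def helmholtz (h : ℝ) : L2Ωvec h →ₗ.[ℂ] L2Ωvec h := (helmholtzGraph h).toLinearPMap

lemma mem_graph_helmholtz {h : ℝ} (p : L2Ωvec h × L2Ωvec h) :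
    p ∈ (helmholtz h).graph ↔ IsHelmholtz p.1 p.2 := by
  rw [helmholtz, Submodule.toLinearPMap_graph_eq]
  · rfl
  · rintro ⟨v, u⟩ H hv
    change v = 0 at hv
    subst hv
    exact IsHelmholtz.eq_zero H

/-- The ground space `X₂ = Ran P₂`, a subspace of `L²(Ω)²`. -/
def X2 (h : ℝ) : Submodule ℂ (L2Ωvec h) := LinearMap.range (helmholtz h).toFun

instance (h : ℝ) : NormedAddCommGroup (X2 h) := Submodule.normedAddCommGroup _

instance (h : ℝ) : NormedSpace ℂ (X2 h) := Submodule.normedSpace _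

/-! ### The hydrostatic Stokes operator -/

/-- `D(A₂)`: fields in `H²_per(Ω)²` with `div_H v̄ = 0`, `∂_z v = 0` on `Γ_u = {z = 0}` and `v = 0`
on `Γ_b = {z = -h}`. -/
def MemDomA2 {h : ℝ} (v : L2Ωvec h) : Prop :=
  (∀ j, MemH2perΩ (v j)) ∧ DivFreeAvg v ∧ (∀ j, HasTrace 2 0 (weakDeriv 2 (v j)) 0) ∧
    ∀ j, HasTrace 2 (-h) (v j) 0

/-- The (three dimensional, weak) Laplacian, componentwise. -/
def vecLaplacian {h : ℝ} (v : L2Ωvec h) : L2Ωvec h :=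
  WithLp.toLp 2 fun j => ∑ i : Fin 3, weakDeriv i (weakDeriv i (v j))

lemma MemDomA2.add {h : ℝ} {v w : L2Ωvec h} (hv : MemDomA2 v) (hw : MemDomA2 w) :
    MemDomA2 (v + w) := by
  obtain ⟨a1, a2, a3, a4⟩ := hv
  obtain ⟨b1, b2, b3, b4⟩ := hw
  refine ⟨fun j => (a1 j).add (b1 j), a2.add b2, fun j => ?_, fun j => ?_⟩
  · rw [PiLp.add_apply, weakDeriv_add (a1 j).1.1 (b1 j).1.1]
    simpa using (a3 j).add ((a1 j).1.2 2) ((b1 j).1.2 2) (b3 j)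
  · simpa using (a4 j).add (a1 j).1.1 (b1 j).1.1 (b4 j)

lemma MemDomA2.smul {h : ℝ} {v : L2Ωvec h} (r : ℂ) (hv : MemDomA2 v) : MemDomA2 (r • v) := by
  obtain ⟨a1, a2, a3, a4⟩ := hv
  refine ⟨fun j => (a1 j).smul r, a2.smul r, fun j => ?_, fun j => ?_⟩
  · rw [PiLp.smul_apply, weakDeriv_smul r (a1 j).1.1]
    simpa using (a3 j).smul r ((a1 j).1.2 2)
  · simpa using (a4 j).smul r (a1 j).1.1

lemma memDomA2_zero {h : ℝ} : MemDomA2 (0 : L2Ωvec h) := by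
  refine ⟨fun j => memH2perΩ_zero, ?_, fun j => ?_, fun j => hasTrace_zero _ _⟩
  · intro φ hφ
    refine Finset.sum_eq_zero fun j _ => ?_
    simpa using integral_vertAvg_smul_mul (h := h) 0 0 (hφ.memLp_pderiv _ j)
  · rw [PiLp.zero_apply, weakDeriv_zero]
    exact hasTrace_zero _ _

lemma vecLaplacian_add {h : ℝ} {v w : L2Ωvec h} (hv : MemDomA2 v) (hw : MemDomA2 w) :
    vecLaplacian (v + w) = vecLaplacian v + vecLaplacian w := by
  ext1 j
  simp only [vecLaplacian, WithLp.ofLp_add, Pi.add_apply]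
  rw [← Finset.sum_add_distrib]
  refine Finset.sum_congr rfl fun i _ => ?_
  rw [weakDeriv_add (hv.1 j).1.1 (hw.1 j).1.1,
    weakDeriv_add ((hv.1 j).1.2 i) ((hw.1 j).1.2 i)]

lemma vecLaplacian_smul {h : ℝ} {v : L2Ωvec h} (r : ℂ) (hv : MemDomA2 v) :
    vecLaplacian (r • v) = r • vecLaplacian v := by
  ext1 j
  simp only [vecLaplacian, WithLp.ofLp_smul, Pi.smul_apply]
  rw [Finset.smul_sum]
  refine Finset.sum_congr rfl fun i _ => ?_
  rw [weakDeriv_smul r (hv.1 j).1.1, weakDeriv_smul r ((hv.1 j).1.2 i)]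

lemma vecLaplacian_zero {h : ℝ} : vecLaplacian (0 : L2Ωvec h) = 0 := by
  simpa using vecLaplacian_smul 0 (memDomA2_zero (h := h))

/-- The graph of `A₂`: pairs `(v, f)` with `v ∈ D(A₂)` and `f = -P₂ Δ v`. -/
def stokesGraph (h : ℝ) : Submodule ℂ (X2 h × X2 h) where
  carrier := {p | MemDomA2 (p.1 : L2Ωvec h) ∧
    (vecLaplacian (p.1 : L2Ωvec h), -(p.2 : L2Ωvec h)) ∈ (helmholtz h).graph}
  add_mem' := by
    rintro p q ⟨hp, hp'⟩ ⟨hq, hq'⟩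
    refine ⟨hp.add hq, ?_⟩
    have := add_mem hp' hq'
    rw [Prod.mk_add_mk] at this
    convert this using 2
    · exact vecLaplacian_add hp hq
    · simp [add_comm]
  zero_mem' := by
    refine ⟨memDomA2_zero, ?_⟩
    have := (helmholtz h).graph.zero_mem
    convert this using 2
    · exact vecLaplacian_zero
    · simp
  smul_mem' := by
    rintro r p ⟨hp, hp'⟩
    refine ⟨hp.smul r, ?_⟩
    have := Submodule.smul_mem _ r hp'
    rw [Prod.smul_mk] at this
    convert this using 2
    · exact vecLaplacian_smul r hp
    · simp

/-- The hydrostatic Stokes operator `A₂ = -P₂ Δ` with domain `D(A₂)` in `X₂`. -/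
def stokesOperator (h : ℝ) : X2 h →ₗ.[ℂ] X2 h := (stokesGraph h).toLinearPMap

lemma mem_graph_stokesOperator {h : ℝ} (p : X2 h × X2 h) :
    p ∈ (stokesOperator h).graph ↔ MemDomA2 (p.1 : L2Ωvec h) ∧
      (vecLaplacian (p.1 : L2Ωvec h), -(p.2 : L2Ωvec h)) ∈ (helmholtz h).graph := by
  rw [stokesOperator, Submodule.toLinearPMap_graph_eq]
  · rfl
  · rintro ⟨v, f⟩ ⟨_, H⟩ hv
    change v = 0 at hv
    subst hv
    have H' := (mem_graph_helmholtz _).1 H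
    simp only [Submodule.coe_zero, vecLaplacian_zero] at H'
    simpa using H'.eq_zero

/-! ### Complex interpolation -/

/-- The domain of a linear operator `A` with its graph norm `‖x‖ + ‖A x‖`, realised isometrically
as the graph of `A` with the `ℓ¹` norm of the product. -/
def GraphDomain {E : Type*} [NormedAddCommGroup E] [NormedSpace ℂ E] (A : E →ₗ.[ℂ] E) :
    Submodule ℂ (WithLp 1 (E × E)) :=
  A.graph.comap (WithLp.linearEquiv 1 ℂ (E × E)).toLinearMap

instance {E : Type*} [NormedAddCommGroup E] [NormedSpace ℂ E] (A : E →ₗ.[ℂ] E) :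
    NormedAddCommGroup (GraphDomain A) := Submodule.normedAddCommGroup _

instance {E : Type*} [NormedAddCommGroup E] [NormedSpace ℂ E] (A : E →ₗ.[ℂ] E) :
    NormedSpace ℂ (GraphDomain A) := Submodule.normedSpace _

/-- The continuous embedding of `D(A)`, with the graph norm, into the underlying space. -/
def graphDomainIncl {E : Type*} [NormedAddCommGroup E] [NormedSpace ℂ E] (A : E →ₗ.[ℂ] E) :
    GraphDomain A →L[ℂ] E :=
  (WithLp.fstL 1 ℂ E E).comp (GraphDomain A).subtypeL

/-- `f` belongs to Calderón's space of admissible functions on the strip `0 ≤ Re z ≤ 1` for the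
couple `E₁ ↪ E₀` (embedding `ι`, so that `E₀ + E₁ = E₀`): `f` is continuous and bounded on the
closed strip with values in `E₀`, holomorphic inside, and `f (1 + i t) = g t` is continuous with
values in `E₁`. The norm `max (sup ‖f (i t)‖_{E₀}) (sup ‖f (1 + i t)‖_{E₁})` is at most `M`. -/
structure IsAdmissible {E₀ E₁ : Type*} [NormedAddCommGroup E₀] [NormedSpace ℂ E₀]
    [NormedAddCommGroup E₁] [NormedSpace ℂ E₁] (ι : E₁ →L[ℂ] E₀)
    (f : ℂ → E₀) (g : ℝ → E₁) (M : ℝ) : Prop where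
  diffContOnCl : DiffContOnCl ℂ f (Complex.re ⁻¹' Ioo 0 1)
  bounded : ∃ C : ℝ, ∀ z : ℂ, z.re ∈ Icc (0 : ℝ) 1 → ‖f z‖ ≤ C
  continuous_right : Continuous g
  right_eq : ∀ t : ℝ, f (1 + t * Complex.I) = ι (g t)
  left_le : ∀ t : ℝ, ‖f (t * Complex.I)‖ ≤ M
  right_le : ∀ t : ℝ, ‖g t‖ ≤ M

/-- The complex interpolation space `[E₀, E₁]_θ = {f(θ) : f admissible}`. -/
def complexInterp {E₀ E₁ : Type*} [NormedAddCommGroup E₀] [NormedSpace ℂ E₀]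
    [NormedAddCommGroup E₁] [NormedSpace ℂ E₁] (ι : E₁ →L[ℂ] E₀) (θ : ℝ) : Set E₀ :=
  {x | ∃ f g M, IsAdmissible ι f g M ∧ f θ = x}

/-- The norm of `[E₀, E₁]_θ`: the infimum of the norms of the admissible `f` with `f(θ) = x`. -/
def complexInterpNorm {E₀ E₁ : Type*} [NormedAddCommGroup E₀] [NormedSpace ℂ E₀]
    [NormedAddCommGroup E₁] [NormedSpace ℂ E₁] (ι : E₁ →L[ℂ] E₀) (θ : ℝ) (x : E₀) : ℝ :=
  sInf {M | ∃ f g, IsAdmissible ι f g M ∧ f θ = x}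

/-- `V_{θ,2} = [X₂, D(A₂)]_θ`, as a set of fields in `L²(Ω)²`. -/
def VInterp (h θ : ℝ) : Set (L2Ωvec h) :=
  Subtype.val '' complexInterp (graphDomainIncl (stokesOperator h)) θ

/-- The norm of `V_{θ,2}`. -/
def VInterpNorm (h θ : ℝ) (v : X2 h) : ℝ :=
  complexInterpNorm (graphDomainIncl (stokesOperator h)) θ v

/-! ### The space `V_σ` -/

/-- `V_σ`: fields in `H¹_per(Ω)²` with `div_H v̄ = 0` in `G` and `v = 0` on `Γ_b`. -/
def Vσ (h : ℝ) : Set (L2Ωvec h) :=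
  {v | (∀ j, MemH1perΩ (v j)) ∧ DivFreeAvg v ∧ ∀ j, HasTrace 2 (-h) (v j) 0}

/-- The norm of `H¹(Ω)²`. -/
def H1norm {h : ℝ} (v : L2Ωvec h) : ℝ :=
  Real.sqrt (∑ j : Fin 2, (‖v j‖ ^ 2 + ∑ i : Fin 3, ‖weakDeriv i (v j)‖ ^ 2))

end

/-!
All spaces are diagonalised by Fourier series. On `Ω` the modes are
`√(2/h) e^{2πi k·(x,y)} sin (μₙ (z + h))` with `k ∈ ℤ²` and `μₙ = (n + 1/2) π / h`; they are the
eigenfunctions of `-Δ`, with eigenvalues `λ = |2πk|² + μₙ²`, under horizontal periodicity, the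
Dirichlet condition on `Γ_b` and the Neumann condition on `Γ_u`, and they form an orthonormal basis
of `L²(Ω)`. In terms of Fourier coefficients `c`, membership in `H¹_per(Ω)` with zero trace on `Γ_b`
means `∑ λ |c|² < ∞` (`memH1perΩ_iff_summable`), and the regularity and boundary conditions of
`D(A₂)` mean `∑ λ² |c|² < ∞` (`memDomScalar_iff_summable`). The condition `div_H v̄ = 0` becomes
`∑ⱼ kⱼ ⟪e_k, v̄ⱼ⟫ = 0` for every `k`, which defines a closed subspace `solenoidal`; it equals `X₂`
(`mem_X2_iff`) and is orthogonal to all horizontal gradients `∇_H π`.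

Let `J` be `(1 - Δ)^{-1/2}` acting on the Hilbert space `V` of those fields `a ∈ L²(Ω)²` for which
`(1 - Δ)^{-1/2} a` is solenoidal. Then `J : V → X₂` is injective with range `V_σ`, and
`‖a‖ = ‖J a‖_{H¹}` (`range_formIncl`, `H1norm_formIncl`). The operator `1 + A₂` is the one
associated with the form `‖·‖²_{H¹}` on `V_σ`, that is `(1 + A₂)⁻¹ = J J†`
(`mem_graph_stokesOperator_iff_eq`). One inclusion is the orthogonality of pressure gradients to
solenoidal fields. The other is the regularity statement that `u - Δu + ∇_H π = x`, `div_H ū = 0`,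
has a solution with `u ∈ D(A₂)` and `π ∈ H¹_per(G)` (`exists_stokes_solution`). The problem
decouples in `k`: since `(1 - Δ)⁻¹` preserves horizontal frequencies, the constraint on `u`
determines the Fourier coefficient of `π` at `k` as a quotient whose denominator is
`|k|² ⟪e_k, (1 - Δ)⁻¹ e_k⟫`, and the bound `norm_resMode_le` for this denominator, uniform in `k`,
makes `∇_H π` square integrable.

It remains to show that `[X, D(A)]_{1/2} = Ran J`, with equivalent norms, whenever
`(1 + A)⁻¹ = K = J J†` in Hilbert spaces (`complexInterp_half_of_inverse`). If `f` is admissible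
with norm `M`, the three lines theorem for `z ↦ ⟪f (1 - z̄), (K + ε)⁻¹ f z⟫` bounds
`⟪u, (K + ε)⁻¹ u⟫`, `u = f (1/2)`, by `M²`; hence `J† (K + ε)⁻¹ u` is bounded in `V` by `M`, and a
weak limit as `ε → 0` is a preimage of `u` under `J`. Conversely, for `u = K y` the function
`(K + δ)^{z - 1/2} u` with small `δ` has boundary values bounded by any given number larger than
`‖J† y‖`, and every element of `V` is a rapidly convergent series of vectors `J† y`.
-/

open MeasureTheory Set Filter
open scoped ContDiff Topology ENNReal ComplexConjugate

noncomputable section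

/-! ### Complex interpolation between a Hilbert space and an operator domain -/

section AbstractInterp

open scoped InnerProductSpace

variable {X V : Type*} [NormedAddCommGroup X] [InnerProductSpace ℂ X] [CompleteSpace X]
  [NormedAddCommGroup V] [InnerProductSpace ℂ V] [CompleteSpace V]

lemma ContinuousLinearMap.IsPositive.exists_resolvent {K : X →L[ℂ] X} (hK : K.IsPositive)
    {ε : ℝ} (hε : 0 < ε) :
    ∃ R : X →L[ℂ] X, (∀ x, K (R x) + (ε : ℂ) • R x = x) ∧ (∀ x, R (K x + (ε : ℂ) • x) = x) := by
  have hu : IsUnit (K + (ε : ℂ) • (1 : X →L[ℂ] X)) := by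
    refine ContinuousLinearMap.isUnit_of_forall_le_norm_inner_map _ (c := ⟨ε, hε.le⟩) hε fun x => ?_
    refine le_trans ?_ (RCLike.re_le_norm _)
    have h1 := hK.re_inner_nonneg_left x
    simp only [add_apply, inner_add_left, map_add, smul_apply, one_apply_eq_self,
      inner_smul_left, Complex.conj_ofReal]
    have h2 : RCLike.re ((ε : ℂ) * ⟪x, x⟫_ℂ) = ε * ‖x‖ ^ 2 := by
      rw [inner_self_eq_norm_sq_to_K]
      simp [← Complex.ofReal_pow]
    change ‖x‖ ^ 2 * ε ≤ _
    rw [h2]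
    linarith
  obtain ⟨U, hU⟩ := hu
  have e1 : (U : X →L[ℂ] X) * (U⁻¹ : (X →L[ℂ] X)ˣ) = 1 := U.mul_inv
  have e2 : ((U⁻¹ : (X →L[ℂ] X)ˣ) : X →L[ℂ] X) * U = 1 := U.inv_mul
  rw [hU] at e1 e2
  exact ⟨_, fun x => DFunLike.congr_fun e1 x, fun x => DFunLike.congr_fun e2 x⟩

/-- The contraction property `‖(K + ε)⁻¹ K x‖ ≤ ‖x‖`. -/
lemma ContinuousLinearMap.IsPositive.norm_le_norm_add_smul {H : Type*} [NormedAddCommGroup H]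
    [InnerProductSpace ℂ H] {K : H →L[ℂ] H} (hK : K.IsPositive) {ε : ℝ} (hε : 0 < ε) (x : H) :
    ‖K x‖ ≤ ‖K x + (ε : ℂ) • x‖ := by
  refine le_of_sq_le_sq ?_ (norm_nonneg _)
  rw [@norm_add_sq ℂ]
  have h1 := hK.re_inner_nonneg_left x
  have h2 : RCLike.re ⟪K x, (ε : ℂ) • x⟫_ℂ = ε * RCLike.re ⟪K x, x⟫_ℂ := by
    rw [inner_smul_right]; simp
  rw [h2]
  have := mul_nonneg hε.le h1
  nlinarith [sq_nonneg ‖(ε : ℂ) • x‖]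

/-- If `f` is holomorphic at `z̄`, then `w ↦ ⟪f w̄, ·⟫` is holomorphic at `z`. -/
lemma hasDerivAt_toDual_conj {f : ℂ → X} {f' : X} {z : ℂ} (hf : HasDerivAt f f' (conj z)) :
    HasDerivAt (fun w => InnerProductSpace.toDual ℂ X (f (conj w)))
      (InnerProductSpace.toDual ℂ X f') z := by
  rw [hasDerivAt_iff_isLittleO] at hf ⊢
  have h1 := hf.comp_tendsto (k := fun w : ℂ => conj w) (l' := 𝓝 z)
    (Complex.continuous_conj.tendsto z)
  refine (h1.norm_left.norm_right.congr (fun w => ?_) (fun w => ?_)).of_norm_left.of_norm_right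
  · simp only [Function.comp_apply]
    rw [← (InnerProductSpace.toDual ℂ X).norm_map]
    congr 1
    simp [map_sub, map_smulₛₗ]
  · simp only [Function.comp_apply]
    rw [← map_sub, RCLike.norm_conj]

/-- The image of a closed ball under a bounded operator between Hilbert spaces is closed, by weak
compactness. -/
lemma exists_preimage_of_approx (J : V →L[ℂ] X) {M : ℝ} {u : X} (v : ℕ → V) (hv : ∀ n, ‖v n‖ ≤ M)
    (hu : Tendsto (fun n => J (v n)) atTop (𝓝 u)) : ∃ w : V, J w = u ∧ ‖w‖ ≤ M := by
  let Φ : WeakDual ℂ V → (X → ℂ) := fun φ y => φ (J.adjoint y)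
  have hΦ : Continuous Φ := continuous_pi fun y => WeakDual.eval_continuous _
  have hcl := ((WeakDual.isCompact_closedBall (𝕜 := ℂ) (E := V) 0 M).image hΦ).isClosed
  have hmem : (fun y => ⟪u, y⟫_ℂ) ∈ Φ '' (WeakDual.toStrongDual ⁻¹' Metric.closedBall 0 M) := by
    refine hcl.mem_of_tendsto (f := fun n y => ⟪J (v n), y⟫_ℂ) (b := atTop) ?_
      (Eventually.of_forall fun n => ?_)
    · exact tendsto_pi_nhds.2 fun y => hu.inner tendsto_const_nhds
    · refine ⟨StrongDual.toWeakDual (InnerProductSpace.toDual ℂ V (v n)), ?_, ?_⟩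
      · simpa using hv n
      · funext y
        change ⟪v n, J.adjoint y⟫_ℂ = _
        rw [ContinuousLinearMap.adjoint_inner_right]
  obtain ⟨φ, hφ, hφ'⟩ := hmem
  refine ⟨(InnerProductSpace.toDual ℂ V).symm (WeakDual.toStrongDual φ), ?_, ?_⟩
  · refine ext_inner_right ℂ fun y => ?_
    rw [← ContinuousLinearMap.adjoint_inner_right, InnerProductSpace.toDual_symm_apply]
    exact congrFun hφ' y
  · rw [LinearIsometryEquiv.norm_map]
    simpa using hφ

variable {J : V →L[ℂ] X} {A : X →ₗ.[ℂ] X}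

/-- The embedding `[X, D(A)]_{1/2} ⊆ Ran J`: the three lines theorem applied to
`z ↦ ⟪f (1 - z̄), (K + ε)⁻¹ f z⟫` with `K = J J†`, followed by `ε → 0`. -/
lemma exists_of_isAdmissible
    (hA : ∀ p : X × X, p ∈ A.graph ↔ p.1 = J (J.adjoint (p.1 + p.2)))
    {f : ℂ → X} {g : ℝ → GraphDomain A} {M : ℝ}
    (hf : IsAdmissible (graphDomainIncl A) f g M) :
    ∃ v : V, J v = f (1 / 2) ∧ ‖v‖ ≤ M := by
  have hM : 0 ≤ M := (norm_nonneg _).trans (hf.left_le 0)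
  set K : X →L[ℂ] X := J ∘L J.adjoint with hKdef
  have hK : K.IsPositive := ContinuousLinearMap.isPositive_self_comp_adjoint J
  have hstrip : closure (Complex.re ⁻¹' Ioo (0 : ℝ) 1) = Complex.re ⁻¹' Icc (0 : ℝ) 1 := by
    rw [Complex.closure_preimage_re, closure_Ioo zero_ne_one]
  set u : X := f (1 / 2) with hu
  have key : ∀ ε : ℝ, 0 < ε → ∃ v : V, ‖v‖ ≤ M ∧ ‖u - J v‖ ^ 2 ≤ ε * M ^ 2 := by
    intro ε hε
    obtain ⟨R, hR1, hR2⟩ := hK.exists_resolvent hε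
    let τ : ℂ → ℂ := fun z => 1 - conj z
    have hτm : ∀ z : ℂ, (τ z).re = 1 - z.re := fun z => by simp [τ]
    let F : ℂ → ℂ := fun z => ⟪f (τ z), R (f z)⟫_ℂ
    obtain ⟨C, hC⟩ := hf.bounded
    have hedge : ∀ t : ℝ, ‖R (f (1 + t * Complex.I))‖ ≤ M := by
      intro t
      set q : X × X := WithLp.ofLp (g t : WithLp 1 (X × X)) with hq
      have hmem : q ∈ A.graph := (g t).2
      have e1 : f (1 + t * Complex.I) = q.1 := hf.right_eq t
      have e2 : q.1 = K (q.1 + q.2) := (hA q).1 hmem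
      have e3 : ‖g t‖ = ‖q.1‖ + ‖q.2‖ := by
        change ‖(g t : WithLp 1 (X × X))‖ = _
        rw [WithLp.prod_norm_eq_of_L1]
        rfl
      have e4 : R (K (q.1 + q.2)) = K (R (q.1 + q.2)) := by
        have := hR2 (R (q.1 + q.2))
        have h3 := hR1 (q.1 + q.2)
        rw [h3] at this
        have h5 := hR2 (q.1 + q.2)
        rw [map_add, map_smul] at h5
        exact add_right_cancel (h5.trans h3.symm)
      rw [e1, e2, e4]
      refine (hK.norm_le_norm_add_smul hε _).trans ?_
      rw [hR1]
      exact (norm_add_le _ _).trans (e3 ▸ hf.right_le t)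
    have hRs : ∀ x y, ⟪R x, y⟫_ℂ = ⟪x, R y⟫_ℂ := by
      intro x y
      conv_lhs => rw [← hR1 y]
      conv_rhs => rw [← hR1 x]
      rw [inner_add_left, inner_add_right, inner_smul_left, inner_smul_right, Complex.conj_ofReal,
        hK.isSymmetric.apply_clm]
    have h3 := Complex.HadamardThreeLines.norm_le_interp_of_mem_verticalClosedStrip₀₁' F
      (z := 1 / 2) (a := M * M) (b := M * M) ?_ ?_ ?_ ?_ ?_
    rotate_left
    · simp only [Complex.HadamardThreeLines.verticalClosedStrip, Set.mem_preimage]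
      norm_num
    · refine ⟨fun z hz => ?_, ?_⟩
      · have hz' : (conj (1 - conj z) : ℂ) = 1 - z := by simp
        have hmem : τ z ∈ Complex.re ⁻¹' Ioo (0 : ℝ) 1 := by
          have h1 : 0 < z.re := hz.1
          have h2 : z.re < 1 := hz.2
          constructor <;> rw [hτm] <;> linarith
        have hop : IsOpen (Complex.re ⁻¹' Ioo (0 : ℝ) 1) :=
          isOpen_Ioo.preimage Complex.continuous_re
        have d1 := (hf.diffContOnCl.1.differentiableAt (hop.mem_nhds hmem)).hasDerivAt
        have d2 := (hf.diffContOnCl.1.differentiableAt (hop.mem_nhds hz)).hasDerivAt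
        have d3 : HasDerivAt (fun w => f (1 - w)) (-(deriv f (τ z))) (conj z) := by
          have := HasDerivAt.scomp (h := fun w => 1 - w) (h' := -1) (conj z)
            (g₁ := f) (by exact d1) (by simpa using (hasDerivAt_id (conj z)).const_sub 1)
          rwa [neg_one_smul] at this
        have d4 := (hasDerivAt_toDual_conj d3).clm_apply
          ((R.hasFDerivAt (x := f z)).comp_hasDerivAt z d2)
        exact d4.differentiableAt.differentiableWithinAt
      · have hcl : closure (Complex.HadamardThreeLines.verticalStrip 0 1)
            = Complex.re ⁻¹' Icc (0 : ℝ) 1 := hstrip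
        rw [hcl]
        have hfc : ContinuousOn f (Complex.re ⁻¹' Icc (0 : ℝ) 1) := hstrip ▸ hf.diffContOnCl.2
        refine ContinuousOn.inner ?_ (R.continuous.comp_continuousOn hfc)
        refine hfc.comp (by fun_prop) fun z hz => ?_
        have h1 : 0 ≤ z.re := hz.1
        have h2 : z.re ≤ 1 := hz.2
        constructor <;> rw [hτm] <;> linarith
    · refine ⟨C * (‖R‖ * C), ?_⟩
      rintro _ ⟨z, hz, rfl⟩
      have h1 : 0 ≤ z.re := hz.1
      have h2 : z.re ≤ 1 := hz.2
      have b1 := hC (τ z) ⟨by rw [hτm]; linarith, by rw [hτm]; linarith⟩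
      have b2 := hC z hz
      refine (norm_inner_le_norm _ _).trans ?_
      refine mul_le_mul b1 ((R.le_opNorm _).trans ?_) (norm_nonneg _) ((norm_nonneg _).trans b1)
      gcongr
    · intro z hz
      have e1 : z = z.im * Complex.I := by
        apply Complex.ext <;> simp [show z.re = 0 from hz]
      have e2 : τ z = 1 + z.im * Complex.I := by
        apply Complex.ext <;> simp [τ, show z.re = 0 from hz]
      have h4 : F z = ⟪R (f (τ z)), f z⟫_ℂ := (hRs _ _).symm
      rw [h4]
      refine (norm_inner_le_norm _ _).trans (mul_le_mul ?_ ?_ (norm_nonneg _) hM)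
      · rw [e2]; exact hedge _
      · rw [e1]; exact hf.left_le _
    · intro z hz
      have e1 : z = 1 + z.im * Complex.I := by
        apply Complex.ext <;> simp [show z.re = 1 from hz]
      have e2 : τ z = z.im * Complex.I := by
        apply Complex.ext <;> simp [τ, show z.re = 1 from hz]
      refine (norm_inner_le_norm _ _).trans (mul_le_mul ?_ ?_ (norm_nonneg _) hM)
      · rw [e2]; exact hf.left_le _
      · rw [e1]; exact hedge _
    have hτ : τ (1 / 2) = 1 / 2 := by
      simp only [τ, map_div₀, map_one, Complex.conj_ofNat]; norm_num
    have h5 : ‖⟪u, R u⟫_ℂ‖ ≤ M * M := by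
      have e : F (1 / 2) = ⟪u, R u⟫_ℂ := by simp only [F]; rw [hτ]
      rw [e] at h3
      refine h3.trans_eq ?_
      have : (1 - (1 / 2 : ℂ).re) = 1 / 2 := by norm_num
      rw [this]
      have : (1 / 2 : ℂ).re = 1 / 2 := by norm_num
      rw [this, ← Real.sqrt_eq_rpow, Real.mul_self_sqrt (mul_nonneg hM hM)]
    -- `⟪u, R u⟫ = ⟪K R u, R u⟫ + ε ‖R u‖²` with both terms nonnegative
    have h6 : RCLike.re ⟪u, R u⟫_ℂ = ‖J.adjoint (R u)‖ ^ 2 + ε * ‖R u‖ ^ 2 := by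
      have e0 : ⟪u, R u⟫_ℂ = ⟪K (R u) + (ε : ℂ) • R u, R u⟫_ℂ := by rw [hR1]
      rw [e0]
      have : ⟪K (R u), R u⟫_ℂ = ⟪J.adjoint (R u), J.adjoint (R u)⟫_ℂ := by
        rw [ContinuousLinearMap.adjoint_inner_right]; rfl
      rw [inner_add_left, inner_smul_left, this, inner_self_eq_norm_sq_to_K,
        inner_self_eq_norm_sq_to_K]
      simp [← Complex.ofReal_pow]
    have h7 : ‖J.adjoint (R u)‖ ^ 2 + ε * ‖R u‖ ^ 2 ≤ M ^ 2 := by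
      rw [← h6, sq]; exact (RCLike.re_le_norm _).trans h5
    refine ⟨J.adjoint (R u), ?_, ?_⟩
    · refine le_of_sq_le_sq ?_ hM
      have := mul_nonneg hε.le (sq_nonneg ‖R u‖)
      linarith
    · have e : u - J (J.adjoint (R u)) = (ε : ℂ) • R u := by
        nth_rewrite 1 [← hR1 u]
        simp [hKdef]
      rw [e, norm_smul, mul_pow, Complex.norm_real, Real.norm_eq_abs, sq_abs]
      have := sq_nonneg ‖J.adjoint (R u)‖
      nlinarith
  choose v hv1 hv2 using fun n : ℕ => key (1 / (n + 1 : ℝ)) (by positivity)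
  refine exists_preimage_of_approx J v hv1 ?_
  rw [tendsto_iff_norm_sub_tendsto_zero]
  have hlim : Tendsto (fun n : ℕ => Real.sqrt (1 / ((n : ℝ) + 1) * M ^ 2)) atTop (𝓝 0) := by
    have := (tendsto_one_div_add_atTop_nhds_zero_nat (𝕜 := ℝ)).mul_const (M ^ 2)
    rw [zero_mul] at this
    rw [← Real.sqrt_zero]
    exact (Real.continuous_sqrt.tendsto _).comp this
  refine squeeze_zero (fun _ => norm_nonneg _) (fun n => ?_) hlim
  rw [norm_sub_rev]
  exact Real.le_sqrt_of_sq_le (hv2 n)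

/-- For self-adjoint `L` the norm of `e^{zL} x` depends on `Re z` only, since
`(e^{zL})† e^{zL} = e^{2 Re z L}`. -/
lemma norm_exp_smul_apply_sq {L : X →L[ℂ] X} (hL : IsSelfAdjoint L) (z : ℂ) (x : X) :
    ‖NormedSpace.exp (z • L) x‖ ^ 2
      = RCLike.re ⟪NormedSpace.exp ((2 * z.re : ℂ) • L) x, x⟫_ℂ := by
  let +nondep : NormedAlgebra ℚ (X →L[ℂ] X) := .restrictScalars ℚ ℂ _
  have h1 : ContinuousLinearMap.adjoint (NormedSpace.exp (z • L))
      = NormedSpace.exp (conj z • L) := by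
    rw [← ContinuousLinearMap.star_eq_adjoint, NormedSpace.star_exp, star_smul, hL.star_eq]
    rfl
  have h2 : NormedSpace.exp ((2 * z.re : ℂ) • L)
      = NormedSpace.exp (conj z • L) * NormedSpace.exp (z • L) := by
    rw [← NormedSpace.exp_add_of_commute (((Commute.refl L).smul_left _).smul_right _), ← add_smul]
    congr 2
    rw [add_comm, Complex.add_conj]
    push_cast
    rfl
  have h3 : NormedSpace.exp ((2 * z.re : ℂ) • L) x
      = ContinuousLinearMap.adjoint (NormedSpace.exp (z • L)) (NormedSpace.exp (z • L) x) := by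
    rw [h2, h1, mul_apply_eq_comp]
  rw [h3, ContinuousLinearMap.adjoint_inner_left, ← inner_self_eq_norm_sq (𝕜 := ℂ)]

lemma exists_isSelfAdjoint_exp_eq {B : Type*} [CStarAlgebra B] [PartialOrder B] [StarOrderedRing B]
    {b : B} (hb : IsStrictlyPositive b) : ∃ L : B, IsSelfAdjoint L ∧ NormedSpace.exp L = b :=
  ⟨CFC.log b, IsSelfAdjoint.log, CFC.exp_log b hb⟩

lemma ContinuousLinearMap.IsPositive.exists_exp_eq_add {K : X →L[ℂ] X} (hK : K.IsPositive)
    {δ : ℝ} (hδ : 0 < δ) :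
    ∃ L : X →L[ℂ] X, IsSelfAdjoint L ∧ NormedSpace.exp L = K + (δ : ℂ) • 1 := by
  have hpos : IsStrictlyPositive (K + (δ : ℂ) • (1 : X →L[ℂ] X)) := by
    refine IsStrictlyPositive.iff_of_unital.2 ⟨?_, ?_⟩
    · rw [ContinuousLinearMap.nonneg_iff_isPositive]
      exact hK.add (ContinuousLinearMap.isPositive_one.smul_of_nonneg
        (by exact_mod_cast hδ.le))
    · obtain ⟨R, h1, h2⟩ := hK.exists_resolvent hδ
      exact ⟨⟨K + (δ : ℂ) • 1, R, by ext x; simpa using h1 x, by ext x; simpa using h2 x⟩, rfl⟩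
  exact exists_isSelfAdjoint_exp_eq hpos

/-- For `u = K y` in the range of `K = J J†`, the function `z ↦ (K + δ)^(z - 1/2) u`, with `δ`
small depending on `y`, has boundary norms controlled by `‖J† y‖`. -/
lemma exists_strip_function_of_range (J : V →L[ℂ] X) (y : X) {N : ℝ} (hN : ‖J.adjoint y‖ < N) :
    ∃ (f : ℂ → X) (η : ℝ → X), DiffContOnCl ℂ f (Complex.re ⁻¹' Ioo 0 1) ∧
      (∀ z : ℂ, z.re ∈ Icc (0 : ℝ) 1 → ‖f z‖ ≤ (1 + ‖J ∘L J.adjoint‖) * N) ∧ Continuous η ∧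
      (∀ t : ℝ, f (1 + t * Complex.I) = J (J.adjoint (η t))) ∧
      (∀ t : ℝ, ‖f (t * Complex.I)‖ ≤ N) ∧ (∀ t : ℝ, ‖η t‖ ≤ N) ∧
      f (1 / 2) = J (J.adjoint y) := by
  set K : X →L[ℂ] X := J ∘L J.adjoint with hKdef
  have hK : K.IsPositive := ContinuousLinearMap.isPositive_self_comp_adjoint J
  have hN0 : 0 < N := (norm_nonneg _).trans_lt hN
  have hKy : ⟪K y, y⟫_ℂ = ((‖J.adjoint y‖ ^ 2 : ℝ) : ℂ) := by
    have : ⟪K y, y⟫_ℂ = ⟪J.adjoint y, J.adjoint y⟫_ℂ := by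
      rw [ContinuousLinearMap.adjoint_inner_right]; rfl
    rw [this, inner_self_eq_norm_sq_to_K]
    norm_cast
  obtain ⟨δ, hδ, hδ'⟩ : ∃ δ : ℝ, 0 < δ ∧ ‖J.adjoint y‖ ^ 2 + δ * ‖y‖ ^ 2 ≤ N ^ 2 := by
    have h1 : ‖J.adjoint y‖ ^ 2 < N ^ 2 := pow_lt_pow_left₀ hN (norm_nonneg _) two_ne_zero
    refine ⟨(N ^ 2 - ‖J.adjoint y‖ ^ 2) / (‖y‖ ^ 2 + 1), by
      have := sq_nonneg ‖y‖
      exact div_pos (by linarith) (by linarith), ?_⟩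
    have h2 : ‖y‖ ^ 2 / (‖y‖ ^ 2 + 1) ≤ 1 := (div_le_one (by positivity)).2 (by linarith)
    have h3 : (N ^ 2 - ‖J.adjoint y‖ ^ 2) / (‖y‖ ^ 2 + 1) * ‖y‖ ^ 2
        = (N ^ 2 - ‖J.adjoint y‖ ^ 2) * (‖y‖ ^ 2 / (‖y‖ ^ 2 + 1)) := by ring
    rw [h3]
    nlinarith
  obtain ⟨L, hL, hLexp⟩ := hK.exists_exp_eq_add hδ
  have hcomm : ∀ (z : ℂ) (x : X),
      NormedSpace.exp (z • L) (K x) = K (NormedSpace.exp (z • L) x) := by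
    intro z x
    have h1 : Commute (NormedSpace.exp (z • L)) (NormedSpace.exp L) :=
      letI : NormedAlgebra ℚ (X →L[ℂ] X) := .restrictScalars ℚ ℂ _
      ((Commute.refl L).smul_left z).exp
    rw [hLexp] at h1
    have h2 := DFunLike.congr_fun h1.eq x
    simpa using h2
  set T : ℂ → X →L[ℂ] X := fun z => NormedSpace.exp ((z - 1 / 2) • L) with hT
  have hTd : ∀ z, HasDerivAt T (T z * L) z := fun z => by
    have h1 := hasDerivAt_exp_smul_const L (z - 1 / 2)
    exact h1.comp_sub_const z (1 / 2)
  have hTc : Continuous T := continuous_iff_continuousAt.2 fun z => (hTd z).continuousAt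
  have hleft : ∀ t : ℝ, ‖T (t * Complex.I) (K y)‖ ≤ N := by
    intro t
    refine le_of_sq_le_sq ?_ hN0.le
    rw [hT, norm_exp_smul_apply_sq hL]
    have e1 : (2 * ((t * Complex.I - 1 / 2 : ℂ).re : ℂ)) = -1 := by
      simp
    rw [e1, neg_one_smul]
    let +nondep : NormedAlgebra ℚ (X →L[ℂ] X) := .restrictScalars ℚ ℂ _
    set y' := NormedSpace.exp (-L) (K y) with hy'
    have e2 : K y' + (δ : ℂ) • y' = K y := by
      have h1 : NormedSpace.exp L * NormedSpace.exp (-L) = 1 := by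
        rw [← NormedSpace.exp_add_of_commute (Commute.refl L).neg_right, add_neg_cancel,
          NormedSpace.exp_zero]
      rw [hLexp] at h1
      simpa using DFunLike.congr_fun h1 (K y)
    set d := y - y' with hd
    have e3 : K d + (δ : ℂ) • d = (δ : ℂ) • y := by
      rw [hd, map_sub, smul_sub, ← e2]; abel
    have e4 : 0 ≤ δ * RCLike.re ⟪d, K y⟫_ℂ := by
      have h1 : δ * RCLike.re ⟪d, K y⟫_ℂ = RCLike.re ⟪d, K ((δ : ℂ) • y)⟫_ℂ := by
        rw [map_smul, inner_smul_right]; simp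
      have h2 : RCLike.re ⟪d, K ((δ : ℂ) • d)⟫_ℂ = δ * RCLike.re ⟪d, K d⟫_ℂ := by
        rw [map_smul, inner_smul_right]; simp
      have h3 : ⟪d, K (K d)⟫_ℂ = ⟪K d, K d⟫_ℂ := (hK.isSymmetric.apply_clm d (K d)).symm
      rw [h1, ← e3, map_add, inner_add_right, map_add, h2, h3, inner_self_eq_norm_sq]
      have := mul_nonneg hδ.le (hK.re_inner_nonneg_right d)
      have := sq_nonneg ‖K d‖
      linarith
    have e5 : 0 ≤ RCLike.re ⟪d, K y⟫_ℂ := nonneg_of_mul_nonneg_right e4 hδ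
    have e6 : RCLike.re ⟪y, K y⟫_ℂ = ‖J.adjoint y‖ ^ 2 := by
      rw [← hK.isSymmetric.apply_clm, hKy]
      exact RCLike.ofReal_re _
    have e7 : RCLike.re ⟪y', K y⟫_ℂ = RCLike.re ⟪y, K y⟫_ℂ - RCLike.re ⟪d, K y⟫_ℂ := by
      rw [← map_sub, ← inner_sub_left, hd, sub_sub_cancel]
    rw [e7, e6]
    have := mul_nonneg hδ.le (sq_nonneg ‖y‖)
    linarith
  have hright : ∀ t : ℝ, ‖T (1 + t * Complex.I) y‖ ≤ N := by
    intro t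
    refine le_of_sq_le_sq ?_ hN0.le
    rw [hT, norm_exp_smul_apply_sq hL]
    have e1 : (2 * ((1 + t * Complex.I - 1 / 2 : ℂ).re : ℂ)) = 1 := by
      simp only [Complex.sub_re, Complex.add_re, Complex.one_re, Complex.mul_re, Complex.ofReal_re,
        Complex.I_re, Complex.ofReal_im, Complex.I_im]
      norm_num
    rw [e1, one_smul, hLexp]
    refine le_trans (le_of_eq ?_) hδ'
    simp only [add_apply, smul_apply, one_apply_eq_self, inner_add_left, inner_smul_left,
      Complex.conj_ofReal, hKy, inner_self_eq_norm_sq_to_K]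
    simp [← Complex.ofReal_pow]
  -- on the strip the operator norm of `(K + δ)^(z - 1/2)` depends on `Re z` only
  have hbdd : ∃ B : ℝ, ∀ z : ℂ, z.re ∈ Icc (0 : ℝ) 1 → ‖T z (K y)‖ ≤ B := by
    have hc : Continuous fun σ : ℝ => NormedSpace.exp ((σ : ℂ) • L) :=
      continuous_iff_continuousAt.2 fun σ => ContinuousAt.comp (g := fun z : ℂ =>
        NormedSpace.exp (z • L)) (hasDerivAt_exp_smul_const L (σ : ℂ)).continuousAt
        Complex.continuous_ofReal.continuousAt
    obtain ⟨B, hB⟩ := (isCompact_Icc (a := (-1 : ℝ)) (b := 1)).exists_bound_of_continuousOn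
      hc.continuousOn
    refine ⟨B * ‖K y‖ * ‖K y‖ + 1, fun z hz => ?_⟩
    have h1 : ‖T z (K y)‖ ^ 2 ≤ B * ‖K y‖ * ‖K y‖ := by
      rw [hT, norm_exp_smul_apply_sq hL]
      refine (RCLike.re_le_norm _).trans ((norm_inner_le_norm _ _).trans ?_)
      gcongr
      refine ContinuousLinearMap.le_of_opNorm_le _ ?_ _
      have e1 : (2 * ((z - 1 / 2 : ℂ).re : ℂ)) = ((2 * z.re - 1 : ℝ) : ℂ) := by
        simp; ring
      rw [e1]
      exact hB _ ⟨by linarith [hz.1], by linarith [hz.2]⟩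
    nlinarith [norm_nonneg (T z (K y)), sq_nonneg (‖T z (K y)‖ - 1)]
  have hdc : DiffContOnCl ℂ (fun z => T z (K y)) (Complex.re ⁻¹' Ioo 0 1) :=
    Differentiable.diffContOnCl fun z =>
      ((hTd z).clm_apply (hasDerivAt_const z (K y))).differentiableAt
  have hN1 : N ≤ (1 + ‖K‖) * N := by nlinarith [norm_nonneg K]
  have hN2 : 0 ≤ (1 + ‖K‖) * N := hN0.le.trans hN1
  have hTK : ∀ t : ℝ, T (1 + t * Complex.I) (K y) = K (T (1 + t * Complex.I) y) :=
    fun t => hcomm _ _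
  refine ⟨fun z => T z (K y), fun t => T (1 + t * Complex.I) y, hdc, fun z hz => ?_, ?_, hTK,
    hleft, hright, ?_⟩
  · have h3 := Complex.HadamardThreeLines.norm_le_interp_of_mem_verticalClosedStrip₀₁'
      (fun z => T z (K y)) (z := z) (a := (1 + ‖K‖) * N) (b := (1 + ‖K‖) * N) hz hdc ?_ ?_ ?_
    · refine h3.trans_eq ?_
      have hpos : 0 < (1 + ‖K‖) * N := hN0.trans_le hN1
      rw [← Real.rpow_add hpos, sub_add_cancel, Real.rpow_one]
    · obtain ⟨B, hB⟩ := hbdd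
      exact ⟨B, by rintro _ ⟨w, hw, rfl⟩; exact hB w hw⟩
    · intro w hw
      have e1 : w = w.im * Complex.I := by
        apply Complex.ext <;> simp [show w.re = 0 from hw]
      rw [e1]
      exact (hleft _).trans hN1
    · intro w hw
      have e1 : w = 1 + w.im * Complex.I := by
        apply Complex.ext <;> simp [show w.re = 1 from hw]
      rw [e1, hTK]
      refine (K.le_opNorm _).trans ?_
      have := mul_le_mul_of_nonneg_left (hright w.im) (norm_nonneg K)
      nlinarith
  · exact (hTc.comp (by fun_prop)).clm_apply continuous_const
  · simp [hT, hKdef]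

/-- The embedding `Ran J ⊆ [X, D(A)]_{1/2}`: a vector of `V` is a rapidly convergent series of
vectors `J† yₙ`, and the functions of `exists_strip_function_of_range` can be added up. -/
lemma exists_isAdmissible_of_apply (hJ : Function.Injective J)
    (hA : ∀ p : X × X, p ∈ A.graph ↔ p.1 = J (J.adjoint (p.1 + p.2))) :
    ∃ C : ℝ, 0 < C ∧ ∀ v : V,
      ∃ f g, IsAdmissible (graphDomainIncl A) f g (C * ‖v‖) ∧ f (1 / 2) = J v := by
  set K : X →L[ℂ] X := J ∘L J.adjoint with hKdef
  refine ⟨6 * (1 + 2 * ‖K‖), by positivity, fun v => ?_⟩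
  rcases eq_or_ne v 0 with rfl | hv
  · exact ⟨fun _ => 0, fun _ => 0, ⟨diffContOnCl_const, ⟨0, by simp⟩, continuous_const, by simp,
      by simp, by simp⟩, by simp⟩
  have hv0 : 0 < ‖v‖ := norm_pos_iff.2 hv
  have hdense : v ∈ closure ((J.adjoint : X →ₗ[ℂ] V).range.toAddSubgroup : Set V) := by
    have h1 : (J.adjoint : X →ₗ[ℂ] V).range.topologicalClosure = ⊤ := by
      rw [Submodule.topologicalClosure_eq_top_iff, Submodule.eq_bot_iff]
      intro w hw
      refine hJ ?_
      rw [map_zero, ← inner_self_eq_zero (𝕜 := ℂ), ← ContinuousLinearMap.adjoint_inner_left]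
      exact hw _ (LinearMap.mem_range_self _ _)
    have : v ∈ (J.adjoint : X →ₗ[ℂ] V).range.topologicalClosure := h1 ▸ Submodule.mem_top
    exact this
  obtain ⟨w, hw1, hw2, hw3, hw4⟩ := controlled_sum_of_mem_closure hdense
    (b := fun n => ‖v‖ * (1 / 2) ^ n) (fun n => by positivity)
  choose y hy using hw2
  have hyN : ∀ n, ‖J.adjoint (y n)‖ < 3 * ‖v‖ * (1 / 2) ^ n := by
    intro n
    have e : J.adjoint (y n) = w n := hy n
    rw [e]
    rcases Nat.eq_zero_or_pos n with rfl | hn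
    · have h1 : ‖w 0 - v‖ < ‖v‖ := by
        rw [norm_sub_rev, ← neg_add_eq_sub]; simpa using hw3
      have h2 := norm_le_norm_add_norm_sub' (w 0) v
      simp only [pow_zero, mul_one]
      linarith
    · have := hw4 n hn
      have h5 : 0 < ‖v‖ * (1 / 2) ^ n := by positivity
      linarith
  choose f η h1 h2 h3 h4 h5 h6 h7 using fun n => exists_strip_function_of_range J (y n) (hyN n)
  have hs : HasSum (fun n : ℕ => 3 * ‖v‖ * (1 / 2) ^ n) (6 * ‖v‖) := by
    have := hasSum_geometric_two.mul_left (3 * ‖v‖)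
    rwa [show 3 * ‖v‖ * 2 = 6 * ‖v‖ by ring] at this
  have hs' : HasSum (fun n : ℕ => (1 + ‖K‖) * (3 * ‖v‖ * (1 / 2) ^ n)) ((1 + ‖K‖) * (6 * ‖v‖)) :=
    hs.mul_left _
  have hηs : ∀ t, Summable fun n => η n t := fun t =>
    Summable.of_norm_bounded hs.summable fun n => h6 n t
  have hηn : ∀ t, ‖∑' n, η n t‖ ≤ 6 * ‖v‖ := fun t =>
    tsum_of_norm_bounded hs fun n => h6 n t
  -- the isomorphism `X ≃ D(A)`, `η ↦ (K η, η - K η)`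
  have hG : ∀ x : X, (WithLp.toLp 1 (K x, x - K x) : WithLp 1 (X × X)) ∈ GraphDomain A := by
    intro x
    change (K x, x - K x) ∈ A.graph
    rw [hA]
    simp [hKdef]
  have hcl : closure (Complex.re ⁻¹' Ioo (0 : ℝ) 1) = Complex.re ⁻¹' Icc (0 : ℝ) 1 := by
    rw [Complex.closure_preimage_re, closure_Ioo zero_ne_one]
  refine ⟨fun z => ∑' n, f n z, fun t => ⟨_, hG (∑' n, η n t)⟩, ⟨⟨?_, ?_⟩, ?_, ?_, ?_, ?_, ?_⟩, ?_⟩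
  · exact Complex.differentiableOn_tsum_of_summable_norm hs'.summable (fun n => (h1 n).1)
      (isOpen_Ioo.preimage Complex.continuous_re) fun n z hz => h2 n z (Ioo_subset_Icc_self hz)
  · rw [hcl]
    exact continuousOn_tsum (fun n => hcl ▸ (h1 n).2) hs'.summable fun n z hz => h2 n z hz
  · exact ⟨_, fun z hz => tsum_of_norm_bounded hs' fun n => h2 n z hz⟩
  · have hηc : Continuous fun t => ∑' n, η n t := continuous_tsum h3 hs.summable h6
    refine Continuous.subtype_mk ?_ _
    refine (WithLp.prod_continuous_toLp 1 X X).comp ?_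
    fun_prop
  · intro t
    simp only [h4]
    change _ = K (∑' n, η n t)
    rw [K.map_tsum (hηs t)]
    rfl
  · intro t
    refine (tsum_of_norm_bounded hs fun n => h5 n t).trans ?_
    nlinarith [norm_nonneg K]
  · intro t
    change ‖(WithLp.toLp 1 (K (∑' n, η n t), ∑' n, η n t - K (∑' n, η n t)) : WithLp 1 (X × X))‖ ≤ _
    rw [WithLp.prod_norm_eq_of_L1]
    set x := ∑' n, η n t
    have b1 : ‖K x‖ ≤ ‖K‖ * ‖x‖ := K.le_opNorm x
    have b2 : ‖x - K x‖ ≤ ‖x‖ + ‖K x‖ := norm_sub_le _ _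
    have b3 : ‖x‖ ≤ 6 * ‖v‖ := hηn t
    have b4 : ‖K‖ * ‖x‖ ≤ ‖K‖ * (6 * ‖v‖) := mul_le_mul_of_nonneg_left b3 (norm_nonneg _)
    change ‖K x‖ + ‖x - K x‖ ≤ _
    nlinarith
  · simp only [h7]
    have hsum : Tendsto (fun n => ∑ i ∈ Finset.range (n + 1), J (J.adjoint (y i))) atTop
        (𝓝 (J v)) := by
      have := (J.continuous.tendsto v).comp hw1
      refine this.congr fun n => ?_
      simp only [Function.comp_apply, map_sum]
      exact Finset.sum_congr rfl fun i _ => by rw [← hy i]; rfl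
    have hsm : Summable fun n => J (J.adjoint (y n)) := by
      refine Summable.of_norm_bounded (g := fun n => ‖J‖ * (3 * ‖v‖ * (1 / 2) ^ n))
        (hs.summable.mul_left _) fun n => ?_
      exact (J.le_opNorm _).trans (mul_le_mul_of_nonneg_left (hyN n).le (norm_nonneg _))
    exact tendsto_nhds_unique ((tendsto_add_atTop_iff_nat 1).2 hsm.hasSum.tendsto_sum_nat) hsum

/-- If `1 + A` has the inverse `J J†`, then `[X, D(A)]_{1/2} = Ran J` with equivalent norms. -/
theorem complexInterp_half_of_inverse (hJ : Function.Injective J)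
    (hA : ∀ p : X × X, p ∈ A.graph ↔ p.1 = J (J.adjoint (p.1 + p.2))) :
    complexInterp (graphDomainIncl A) (1 / 2) = Set.range J ∧
      ∃ C : ℝ, 0 < C ∧ ∀ v : V, ‖v‖ ≤ complexInterpNorm (graphDomainIncl A) (1 / 2) (J v) ∧
        complexInterpNorm (graphDomainIncl A) (1 / 2) (J v) ≤ C * ‖v‖ := by
  have hhalf : (((1 / 2 : ℝ) : ℂ)) = 1 / 2 := by norm_num
  obtain ⟨C, hC, H⟩ := exists_isAdmissible_of_apply hJ hA
  refine ⟨?_, C, hC, fun v => ⟨?_, ?_⟩⟩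
  · ext x
    constructor
    · rintro ⟨f, g, M, hf, rfl⟩
      obtain ⟨v, hv, -⟩ := exists_of_isAdmissible hA hf
      exact ⟨v, by rw [hv, hhalf]⟩
    · rintro ⟨v, rfl⟩
      obtain ⟨f, g, hf, h⟩ := H v
      exact ⟨f, g, _, hf, by rw [hhalf, h]⟩
  · obtain ⟨f, g, hf, h⟩ := H v
    refine le_csInf ⟨_, f, g, hf, by rw [hhalf, h]⟩ ?_
    rintro M ⟨f', g', hf', h'⟩
    obtain ⟨w, hw, hwM⟩ := exists_of_isAdmissible hA hf'
    rw [hhalf] at h'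
    rwa [← hJ (hw.trans h')]
  · obtain ⟨f, g, hf, h⟩ := H v
    refine csInf_le ⟨0, ?_⟩ ⟨f, g, hf, by rw [hhalf, h]⟩
    rintro M ⟨f', g', hf', -⟩
    exact (norm_nonneg _).trans (hf'.left_le 0)

end AbstractInterp

/-! ### Smooth functions, traces and integration by parts on boxes -/

section BoxLp

variable {d : ℕ} (a b : Fin d → ℝ)

lemma openBox_subset_Icc : openBox a b ⊆ Icc a b := fun _ hx =>
  ⟨fun i => (hx i trivial).1.le, fun i => (hx i trivial).2.le⟩

lemma openBox_ae_eq_Icc : openBox a b =ᵐ[volume] Icc a b := Measure.univ_pi_Ioo_ae_eq_Icc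

lemma Continuous.memLp_openBox {F : (Fin d → ℝ) → ℂ} (hF : Continuous F) (p : ℝ≥0∞) :
    MemLp F p (volume.restrict (openBox a b)) := by
  obtain ⟨C, hC⟩ := (isCompact_Icc (a := a) (b := b)).exists_bound_of_continuousOn hF.continuousOn
  refine MemLp.of_bound hF.aestronglyMeasurable C ?_
  filter_upwards [ae_restrict_mem (measurableSet_openBox a b)] with x hx
  exact hC x (openBox_subset_Icc a b hx)

/-- The class in `L²` of the box of a continuous function on the whole space. -/
def boxLp {F : (Fin d → ℝ) → ℂ} (hF : Continuous F) : L2Box a b := (hF.memLp_openBox a b 2).toLp F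

variable {a b}

lemma coeFn_boxLp {F : (Fin d → ℝ) → ℂ} (hF : Continuous F) :
    boxLp a b hF =ᵐ[volume.restrict (openBox a b)] F := MemLp.coeFn_toLp _

lemma tendsto_boxLp_iff {F : ℕ → (Fin d → ℝ) → ℂ} (hF : ∀ k, Continuous (F k)) {f : L2Box a b} :
    Tendsto (fun k => boxLp a b (hF k)) atTop (𝓝 f) ↔
      Tendsto (fun k => eLpNorm (fun x => F k x - f x) 2 (volume.restrict (openBox a b)))
        atTop (𝓝 0) := by
  rw [Lp.tendsto_Lp_iff_tendsto_eLpNorm']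
  refine tendsto_congr fun k => eLpNorm_congr_ae ?_
  filter_upwards [coeFn_boxLp (a := a) (b := b) (hF k)] with x hx
  rw [Pi.sub_apply, hx]

lemma integral_boxLp_mul {F : (Fin d → ℝ) → ℂ} (hF : Continuous F) (η : (Fin d → ℝ) → ℂ) :
    ∫ x in openBox a b, boxLp a b hF x * η x = ∫ x in openBox a b, F x * η x := by
  refine integral_congr_ae ?_
  filter_upwards [coeFn_boxLp (a := a) (b := b) hF] with x hx
  rw [hx]

lemma inner_boxLp {F : (Fin d → ℝ) → ℂ} (hF : Continuous F) (f : L2Box a b) :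
    inner ℂ (boxLp a b hF) f = ∫ x in openBox a b, f x * conj (F x) := by
  rw [L2.inner_def]
  refine integral_congr_ae ?_
  filter_upwards [coeFn_boxLp (a := a) (b := b) hF] with x hx
  rw [hx]
  rfl

lemma inner_eq_integral (g f : L2Box a b) :
    inner ℂ g f = ∫ x in openBox a b, f x * conj (g x) := by
  rw [L2.inner_def]
  rfl

/-- Integration against a continuous function is continuous on `L²`. -/
lemma tendsto_integral_mul {ι : Type*} {l : Filter ι} {f : ι → L2Box a b} {g : L2Box a b}
    (h : Tendsto f l (𝓝 g)) {η : (Fin d → ℝ) → ℂ} (hη : Continuous η) :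
    Tendsto (fun k => ∫ x in openBox a b, f k x * η x) l (𝓝 (∫ x in openBox a b, g x * η x)) := by
  have hc : Continuous fun x => conj (η x) := Complex.continuous_conj.comp hη
  have e : ∀ u : L2Box a b, ∫ x in openBox a b, u x * η x = inner ℂ (boxLp a b hc) u := fun u => by
    rw [inner_boxLp]; simp
  simp only [e]
  exact tendsto_const_nhds.inner h

lemma norm_sq_eq_integral (f : L2Box a b) :
    ‖f‖ ^ 2 = ∫ x in openBox a b, ‖f x‖ ^ 2 := by
  have h1 := inner_eq_integral f f
  have h2 : (∫ x in openBox a b, f x * conj (f x)) = ((∫ x in openBox a b, ‖f x‖ ^ 2 : ℝ) : ℂ) := by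
    rw [← integral_complex_ofReal]
    refine integral_congr_ae (Eventually.of_forall fun x => ?_)
    simp [Complex.mul_conj']
  rw [h2, inner_self_eq_norm_sq_to_K] at h1
  refine Complex.ofReal_injective (Eq.trans ?_ h1)
  push_cast
  rfl

lemma norm_sq_boxLp {F : (Fin d → ℝ) → ℂ} (hF : Continuous F) :
    ‖boxLp a b hF‖ ^ 2 = ∫ x in openBox a b, ‖F x‖ ^ 2 := by
  rw [norm_sq_eq_integral]
  refine integral_congr_ae ?_
  filter_upwards [coeFn_boxLp (a := a) (b := b) hF] with x hx
  rw [hx]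

lemma pderiv_mul {F η : (Fin d → ℝ) → ℂ} (hF : ContDiff ℝ ∞ F) (hη : ContDiff ℝ ∞ η) (i : Fin d)
    (x : Fin d → ℝ) :
    pderiv i (fun x => F x * η x) x = pderiv i F x * η x + F x * pderiv i η x := by
  have h := fderiv_fun_mul (hF.differentiable (by simp) x) (hη.differentiable (by simp) x)
  simp only [pderiv, h, add_apply, smul_apply, smul_eq_mul]
  ring

lemma pderiv_conj {F : (Fin d → ℝ) → ℂ} (hF : ContDiff ℝ ∞ F) (i : Fin d) (x : Fin d → ℝ) :
    pderiv i (fun x => conj (F x)) x = conj (pderiv i F x) := by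
  have h := (Complex.conjCLE.toContinuousLinearMap.hasFDerivAt (x := F x)).comp x
    (hF.differentiable (by simp) x).hasFDerivAt
  have h' : HasFDerivAt (fun x => conj (F x))
      (Complex.conjCLE.toContinuousLinearMap.comp (fderiv ℝ F x)) x := h
  simp [pderiv, h'.fderiv]

lemma contDiff_conj {F : (Fin d → ℝ) → ℂ} (hF : ContDiff ℝ ∞ F) :
    ContDiff ℝ ∞ fun x => conj (F x) :=
  Complex.conjCLE.contDiff.comp hF

end BoxLp

section Green

variable {n : ℕ} {a b : Fin (n + 1) → ℝ}

/-- The lower (or upper) corner of the face of a box orthogonal to the `i`-th axis. -/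
abbrev faceCorner (a : Fin (n + 1) → ℝ) (i : Fin (n + 1)) : Fin n → ℝ := fun j => a (i.succAbove j)

lemma integral_pderiv_openBox (hab : ∀ i, a i < b i) (i : Fin (n + 1)) {F : (Fin (n + 1) → ℝ) → ℂ}
    (hF : ContDiff ℝ ∞ F) :
    ∫ x in openBox a b, pderiv i F x
      = (∫ y in openBox (faceCorner a i) (faceCorner b i), F (i.insertNth (b i) y))
        - ∫ y in openBox (faceCorner a i) (faceCorner b i), F (i.insertNth (a i) y) := by
  have hd : ∀ (j : Fin (n + 1)) (x : Fin (n + 1) → ℝ),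
      HasFDerivAt (fun x => if j = i then F x else 0) (if j = i then fderiv ℝ F x else 0) x := by
    intro j x
    split_ifs
    · exact (hF.differentiable (by simp) x).hasFDerivAt
    · exact hasFDerivAt_const 0 x
  have hsum : ∀ x,
      (∑ j, (if j = i then fderiv ℝ F x else 0) (Pi.single j (1 : ℝ))) = pderiv i F x := by
    intro x
    rw [Finset.sum_eq_single i]
    · rw [if_pos rfl]; rfl
    · intro j _ hj; rw [if_neg hj]; rfl
    · intro h; exact absurd (Finset.mem_univ i) h
  have key := integral_divergence_of_hasFDerivAt_off_countable' a b (fun i => (hab i).le)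
    (fun j x => if j = i then F x else 0) (fun j x => if j = i then fderiv ℝ F x else 0) ∅
    countable_empty (fun j x _ => ((hd j x).continuousAt).continuousWithinAt)
    (fun x _ j => hd j x) (by
      simp only [hsum]
      exact (continuous_pderiv hF i).continuousOn.integrableOn_Icc)
  simp only [hsum] at key
  rw [Finset.sum_eq_single i (by intro j _ hj; simp [hj]) (by simp)] at key
  simp only [if_true] at key
  rw [setIntegral_congr_set (openBox_ae_eq_Icc a b), key,
    setIntegral_congr_set (openBox_ae_eq_Icc (faceCorner a i) (faceCorner b i)),
    setIntegral_congr_set (openBox_ae_eq_Icc (faceCorner a i) (faceCorner b i))]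
  rfl

lemma continuous_insertNth (i : Fin (n + 1)) (c : ℝ) :
    Continuous fun y : Fin n → ℝ => (i.insertNth c y : Fin (n + 1) → ℝ) :=
  Continuous.finInsertNth i continuous_const continuous_id

lemma integral_mul_add_integral_mul (hab : ∀ i, a i < b i) (i : Fin (n + 1))
    {F η : (Fin (n + 1) → ℝ) → ℂ} (hF : ContDiff ℝ ∞ F) (hη : ContDiff ℝ ∞ η) :
    (∫ x in openBox a b, pderiv i F x * η x) + ∫ x in openBox a b, F x * pderiv i η x
      = (∫ y in openBox (faceCorner a i) (faceCorner b i),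
          F (i.insertNth (b i) y) * η (i.insertNth (b i) y))
        - ∫ y in openBox (faceCorner a i) (faceCorner b i),
          F (i.insertNth (a i) y) * η (i.insertNth (a i) y) := by
  rw [← integral_pderiv_openBox hab i (hF.mul hη), ← integral_add]
  · exact integral_congr_ae (Eventually.of_forall fun x => (pderiv_mul hF hη i x).symm)
  · exact memLp_one_iff_integrable.1
      (((continuous_pderiv hF i).mul hη.continuous).memLp_openBox a b 1)
  · exact memLp_one_iff_integrable.1
      ((hF.continuous.mul (continuous_pderiv hη i)).memLp_openBox a b 1)

lemma IsTestFunction.insertNth_eq_zero {φ : (Fin (n + 1) → ℝ) → ℂ}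
    (hφ : IsTestFunction (openBox a b) φ) {i : Fin (n + 1)} {c : ℝ} (hc : c = a i ∨ c = b i)
    (y : Fin n → ℝ) : φ (i.insertNth c y) = 0 := by
  by_contra h
  have h1 : (i.insertNth c y : Fin (n + 1) → ℝ) ∈ openBox a b := hφ.2.2 (subset_tsupport _ h)
  have h2 := h1 i trivial
  rw [Fin.insertNth_apply_same] at h2
  rcases hc with rfl | rfl
  · exact lt_irrefl _ h2.1
  · exact lt_irrefl _ h2.2

lemma hasWeakDeriv_boxLp (hab : ∀ i, a i < b i) (i : Fin (n + 1)) {F : (Fin (n + 1) → ℝ) → ℂ}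
    (hF : ContDiff ℝ ∞ F) :
    HasWeakDeriv i (boxLp a b hF.continuous) (boxLp a b (continuous_pderiv hF i)) := by
  intro φ hφ
  have h := integral_mul_add_integral_mul hab i hF hφ.1
  simp only [hφ.insertNth_eq_zero (Or.inl rfl), hφ.insertNth_eq_zero (Or.inr rfl), mul_zero,
    integral_zero, sub_zero] at h
  rw [integral_boxLp_mul, integral_boxLp_mul, eq_neg_iff_add_eq_zero, add_comm, h]

lemma HasWeakDeriv.of_tendsto {d : ℕ} {a b : Fin d → ℝ} {ι : Type*} {l : Filter ι} [l.NeBot]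
    {i : Fin d} {f g : ι → L2Box a b} {f₀ g₀ : L2Box a b} (h : ∀ k, HasWeakDeriv i (f k) (g k))
    (hf : Tendsto f l (𝓝 f₀)) (hg : Tendsto g l (𝓝 g₀)) : HasWeakDeriv i f₀ g₀ := by
  intro φ hφ
  have h1 := tendsto_integral_mul hf (continuous_pderiv hφ.1 i)
  have h2 := (tendsto_integral_mul hg hφ.1.continuous).neg
  refine tendsto_nhds_unique h1 (h2.congr fun k => (h k φ hφ).symm)

/-- The trace inequality for smooth functions. -/
lemma exists_norm_sq_face_le (hab : ∀ i, a i < b i) (i : Fin (n + 1)) {c : ℝ}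
    (hc : c = a i ∨ c = b i) :
    ∃ C : ℝ, 0 ≤ C ∧ ∀ (F : (Fin (n + 1) → ℝ) → ℂ) (hF : ContDiff ℝ ∞ F),
      ‖boxLp (faceCorner a i) (faceCorner b i) (hF.continuous.comp (continuous_insertNth i c))‖ ^ 2
        ≤ C * (‖boxLp a b hF.continuous‖ ^ 2 + ‖boxLp a b (continuous_pderiv hF i)‖ ^ 2) := by
  set r : ℝ := b i - a i with hr
  have hr0 : 0 < r := sub_pos.2 (hab i)
  -- an affine weight equal to one on the face `{xᵢ = c}` and to zero on the opposite face
  obtain ⟨c', hc', hcc⟩ : ∃ c', |c - c'| = r ∧ ((c = b i ∧ c' = a i) ∨ (c = a i ∧ c' = b i)) := by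
    rcases hc with rfl | rfl
    · exact ⟨b i, by rw [abs_sub_comm, abs_of_pos hr0], Or.inr ⟨rfl, rfl⟩⟩
    · exact ⟨a i, by rw [abs_of_pos hr0], Or.inl ⟨rfl, rfl⟩⟩
  have hne : c - c' ≠ 0 := fun h => by rw [h, abs_zero] at hc'; exact hr0.ne hc'
  refine ⟨1 + 1 / r, by positivity, fun F hF => ?_⟩
  let w : (Fin (n + 1) → ℝ) → ℂ := fun x => (((x i - c') / (c - c') : ℝ) : ℂ)
  have hw : ContDiff ℝ ∞ w :=
    Complex.ofRealCLM.contDiff.comp (((contDiff_apply ℝ ℝ i).sub contDiff_const).div_const _)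
  have hwd : ∀ x, pderiv i w x = ((1 / (c - c') : ℝ) : ℂ) := by
    intro x
    have h1 : HasFDerivAt (fun x : Fin (n + 1) → ℝ => (x i - c') / (c - c'))
        ((c - c')⁻¹ • ContinuousLinearMap.proj (R := ℝ) (φ := fun _ => ℝ) i) x := by
      have := ((ContinuousLinearMap.proj (R := ℝ) (φ := fun _ : Fin (n + 1) => ℝ) i).hasFDerivAt
        (x := x)).sub_const c' |>.const_mul (c - c')⁻¹
      refine this.congr_of_eventuallyEq (Eventually.of_forall fun y => ?_)
      simp [div_eq_inv_mul]
    have h2 : HasFDerivAt w (Complex.ofRealCLM.comp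
        ((c - c')⁻¹ • ContinuousLinearMap.proj (R := ℝ) (φ := fun _ => ℝ) i)) x :=
      (Complex.ofRealCLM.hasFDerivAt (x := (x i - c') / (c - c'))).comp x h1
    simp [pderiv, h2.fderiv]
  have hw1 : ∀ y : Fin n → ℝ, w (i.insertNth c y) = 1 := fun y => by
    simp only [w, Fin.insertNth_apply_same, div_self hne, Complex.ofReal_one]
  have hw0 : ∀ y : Fin n → ℝ, w (i.insertNth c' y) = 0 := fun y => by simp [w]
  have hwb : ∀ x ∈ openBox a b, ‖w x‖ ≤ 1 := by
    intro x hx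
    have h1 := hx i trivial
    simp only [w, Complex.norm_real, Real.norm_eq_abs, abs_div, hc']
    rw [div_le_one hr0, abs_le, hr]
    rcases hcc with ⟨-, rfl⟩ | ⟨-, rfl⟩ <;> constructor <;> linarith [h1.1, h1.2]
  have hη : ContDiff ℝ ∞ fun x => conj (F x) * w x := (contDiff_conj hF).mul hw
  have hG := integral_mul_add_integral_mul hab i hF hη
  have hface : ‖(∫ x in openBox a b, pderiv i F x * (conj (F x) * w x))
      + ∫ x in openBox a b, F x * pderiv i (fun x => conj (F x) * w x) x‖
      = ∫ y in openBox (faceCorner a i) (faceCorner b i), ‖F (i.insertNth c y)‖ ^ 2 := by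
    rw [hG]
    have e : ∀ y : Fin n → ℝ, F (i.insertNth c y) * (conj (F (i.insertNth c y)) * 1)
        = ((‖F (i.insertNth c y)‖ ^ 2 : ℝ) : ℂ) := fun y => by
      rw [mul_one, Complex.mul_conj']; push_cast; rfl
    have e0 : 0 ≤ ∫ y in openBox (faceCorner a i) (faceCorner b i), ‖F (i.insertNth c y)‖ ^ 2 :=
      integral_nonneg fun y => sq_nonneg _
    rcases hcc with ⟨h1, h2⟩ | ⟨h1, h2⟩ <;> subst h1 <;> subst h2 <;>
      simp only [hw1, hw0, e, mul_zero, integral_zero, sub_zero, zero_sub, norm_neg] <;>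
      rw [integral_complex_ofReal, Complex.norm_real, Real.norm_of_nonneg e0]
  have hFi : Integrable (fun x => ‖F x‖ ^ 2) (volume.restrict (openBox a b)) :=
    (hF.continuous.memLp_openBox a b 2).integrable_norm_pow (by norm_num)
  have hdi : Integrable (fun x => ‖pderiv i F x‖ ^ 2) (volume.restrict (openBox a b)) :=
    ((continuous_pderiv hF i).memLp_openBox a b 2).integrable_norm_pow (by norm_num)
  rw [norm_sq_boxLp, norm_sq_boxLp, norm_sq_boxLp]
  simp only [Function.comp_apply]
  rw [← hface, ← integral_add, ← integral_add hFi hdi, ← integral_const_mul]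
  rotate_left
  · exact memLp_one_iff_integrable.1
      (((continuous_pderiv hF i).mul hη.continuous).memLp_openBox a b 1)
  · exact memLp_one_iff_integrable.1
      ((hF.continuous.mul (continuous_pderiv hη i)).memLp_openBox a b 1)
  refine (norm_integral_le_integral_norm _).trans (integral_mono_of_nonneg
    (Eventually.of_forall fun _ => norm_nonneg _) ((hFi.add hdi).const_mul _) ?_)
  filter_upwards [ae_restrict_mem (measurableSet_openBox a b)] with x hx
  rw [pderiv_mul (contDiff_conj hF) hw, pderiv_conj hF, hwd]
  have b1 : ‖pderiv i F x * (conj (F x) * w x)‖ ≤ ‖pderiv i F x‖ * ‖F x‖ := by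
    rw [norm_mul, norm_mul, RCLike.norm_conj]
    exact mul_le_mul_of_nonneg_left (mul_le_of_le_one_right (norm_nonneg _) (hwb x hx))
      (norm_nonneg _)
  have b2 : ‖F x * (conj (pderiv i F x) * w x)‖ ≤ ‖F x‖ * ‖pderiv i F x‖ := by
    rw [norm_mul, norm_mul, RCLike.norm_conj]
    exact mul_le_mul_of_nonneg_left (mul_le_of_le_one_right (norm_nonneg _) (hwb x hx))
      (norm_nonneg _)
  have b3 : ‖F x * (conj (F x) * ((1 / (c - c') : ℝ) : ℂ))‖ = 1 / r * ‖F x‖ ^ 2 := by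
    rw [norm_mul, norm_mul, RCLike.norm_conj, Complex.norm_real, Real.norm_eq_abs, abs_div, hc',
      abs_one]
    ring
  have b4 := norm_add₃_le (a := pderiv i F x * (conj (F x) * w x))
    (b := F x * (conj (pderiv i F x) * w x)) (c := F x * (conj (F x) * ((1 / (c - c') : ℝ) : ℂ)))
  rw [b3] at b4
  rw [mul_add, ← add_assoc]
  have b5 := two_mul_le_add_sq ‖pderiv i F x‖ ‖F x‖
  have b6 : 0 ≤ 1 / r * ‖pderiv i F x‖ ^ 2 := by positivity
  nlinarith

variable {F : ℕ → (Fin (n + 1) → ℝ) → ℂ} {f : L2Box a b} {g : Fin (n + 1) → L2Box a b}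

lemma hasWeakDeriv_of_tendsto_boxLp (hab : ∀ i, a i < b i) (hF : ∀ k, ContDiff ℝ ∞ (F k))
    (hf : Tendsto (fun k => boxLp a b (hF k).continuous) atTop (𝓝 f)) {i : Fin (n + 1)}
    {g : L2Box a b} (hg : Tendsto (fun k => boxLp a b (continuous_pderiv (hF k) i)) atTop (𝓝 g)) :
    HasWeakDeriv i f g :=
  HasWeakDeriv.of_tendsto (fun k => hasWeakDeriv_boxLp hab i (hF k)) hf hg

lemma hasTrace_of_tendsto_boxLp (hab : ∀ i, a i < b i) (hF : ∀ k, ContDiff ℝ ∞ (F k))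
    (hf : Tendsto (fun k => boxLp a b (hF k).continuous) atTop (𝓝 f))
    (hg : ∀ j, Tendsto (fun k => boxLp a b (continuous_pderiv (hF k) j)) atTop (𝓝 (g j)))
    {i : Fin (n + 1)} {c : ℝ} {u : L2Box (faceCorner a i) (faceCorner b i)}
    (hu : Tendsto (fun k => boxLp (faceCorner a i) (faceCorner b i)
      ((hF k).continuous.comp (continuous_insertNth i c))) atTop (𝓝 u)) :
    HasTrace i c f u := by
  refine ⟨F, hF, (tendsto_boxLp_iff _).1 hf, fun j => ?_, (tendsto_boxLp_iff _).1 hu⟩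
  rw [(hasWeakDeriv_of_tendsto_boxLp hab hF hf (hg j)).eq]
  exact (tendsto_boxLp_iff _).1 (hg j)

lemma hasTrace_zero_of_tendsto_boxLp (hab : ∀ i, a i < b i) (hF : ∀ k, ContDiff ℝ ∞ (F k))
    (hf : Tendsto (fun k => boxLp a b (hF k).continuous) atTop (𝓝 f))
    (hg : ∀ j, Tendsto (fun k => boxLp a b (continuous_pderiv (hF k) j)) atTop (𝓝 (g j)))
    {i : Fin (n + 1)} {c : ℝ} (h0 : ∀ k y, F k (i.insertNth c y) = 0) : HasTrace i c f 0 := by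
  refine hasTrace_of_tendsto_boxLp hab hF hf hg ?_
  have : ∀ k, boxLp (faceCorner a i) (faceCorner b i)
      ((hF k).continuous.comp (continuous_insertNth i c)) = 0 := by
    intro k
    rw [Lp.eq_zero_iff_ae_eq_zero]
    filter_upwards [coeFn_boxLp (a := faceCorner a i) (b := faceCorner b i)
      ((hF k).continuous.comp (continuous_insertNth i c))] with y hy
    rw [hy]
    exact h0 k y
  simp only [this]
  exact tendsto_const_nhds

lemma boxLp_sub {d : ℕ} {a b : Fin d → ℝ} {F G : (Fin d → ℝ) → ℂ} (hF : Continuous F)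
    (hG : Continuous G) : boxLp a b (hF.sub hG) = boxLp a b hF - boxLp a b hG :=
  MemLp.toLp_sub _ _

lemma pderiv_sub {d : ℕ} {F G : (Fin d → ℝ) → ℂ} (hF : ContDiff ℝ ∞ F) (hG : ContDiff ℝ ∞ G)
    (i : Fin d) : pderiv i (fun x => F x - G x) = fun x => pderiv i F x - pderiv i G x := by
  funext x
  have h := fderiv_fun_sub (hF.differentiable (by simp) x) (hG.differentiable (by simp) x)
  simp only [pderiv, h, sub_apply]

lemma boxLp_congr {d : ℕ} {a b : Fin d → ℝ} {F G : (Fin d → ℝ) → ℂ} (hF : Continuous F)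
    (hG : Continuous G) (h : ∀ x, F x = G x) : boxLp a b hF = boxLp a b hG := by
  obtain rfl : F = G := funext h
  rfl

/-- Limits in `H¹` of smooth functions with equal values on opposite faces have equal traces. -/
lemma periodicTrace_of_tendsto_boxLp (hab : ∀ i, a i < b i) (hF : ∀ k, ContDiff ℝ ∞ (F k))
    (hf : Tendsto (fun k => boxLp a b (hF k).continuous) atTop (𝓝 f))
    (hg : ∀ j, Tendsto (fun k => boxLp a b (continuous_pderiv (hF k) j)) atTop (𝓝 (g j)))
    {i : Fin (n + 1)} (hper : ∀ k y, F k (i.insertNth (a i) y) = F k (i.insertNth (b i) y)) :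
    PeriodicTrace i f := by
  obtain ⟨C, hC, H⟩ := exists_norm_sq_face_le hab i (c := a i) (Or.inl rfl)
  set u : ℕ → L2Box (faceCorner a i) (faceCorner b i) := fun k =>
    boxLp (faceCorner a i) (faceCorner b i) ((hF k).continuous.comp (continuous_insertNth i (a i)))
    with hu
  have hcauchy : CauchySeq u := by
    have c1 := hf.cauchySeq
    have c2 := (hg i).cauchySeq
    rw [cauchySeq_iff_tendsto_dist_atTop_0] at c1 c2 ⊢
    have c3 : Tendsto (fun p : ℕ × ℕ => Real.sqrt (C *
        (dist (boxLp a b (hF p.1).continuous) (boxLp a b (hF p.2).continuous) ^ 2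
        + dist (boxLp a b (continuous_pderiv (hF p.1) i))
          (boxLp a b (continuous_pderiv (hF p.2) i)) ^ 2))) atTop (𝓝 0) := by
      rw [← Real.sqrt_zero]
      refine (Real.continuous_sqrt.tendsto _).comp ?_
      have := ((c1.pow 2).add (c2.pow 2)).const_mul C
      simpa using this
    refine squeeze_zero (fun _ => dist_nonneg) (fun p => ?_) c3
    refine Real.le_sqrt_of_sq_le ?_
    have h1 := H _ ((hF p.1).sub (hF p.2))
    have e1 : boxLp a b ((hF p.1).sub (hF p.2)).continuous
        = boxLp a b (hF p.1).continuous - boxLp a b (hF p.2).continuous := boxLp_sub _ _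
    have e2 : boxLp a b (continuous_pderiv ((hF p.1).sub (hF p.2)) i)
        = boxLp a b (continuous_pderiv (hF p.1) i) - boxLp a b (continuous_pderiv (hF p.2) i) := by
      rw [← boxLp_sub]
      exact boxLp_congr _ _ fun x => congrFun (pderiv_sub (hF p.1) (hF p.2) i) x
    rw [e1, e2] at h1
    rw [dist_eq_norm, dist_eq_norm, dist_eq_norm, hu]
    simp only
    rw [← boxLp_sub]
    exact h1
  obtain ⟨u₀, hu₀⟩ := cauchySeq_tendsto_of_complete hcauchy
  refine ⟨u₀, hasTrace_of_tendsto_boxLp hab hF hf hg hu₀, hasTrace_of_tendsto_boxLp hab hF hf hg ?_⟩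
  refine hu₀.congr fun k => boxLp_congr _ _ fun y => hper k y

/-- Integration by parts with a boundary term on the face `{xᵢ = bᵢ}` only. -/
lemma HasTrace.integral_upper (hab : ∀ i, a i < b i) {i : Fin (n + 1)}
    {u : L2Box (faceCorner a i) (faceCorner b i)} (h : HasTrace i (b i) f u)
    {η : (Fin (n + 1) → ℝ) → ℂ} (hη : ContDiff ℝ ∞ η) (h0 : ∀ y, η (i.insertNth (a i) y) = 0) :
    (∫ x in openBox a b, weakDeriv i f x * η x) + ∫ x in openBox a b, f x * pderiv i η x
      = ∫ y in openBox (faceCorner a i) (faceCorner b i), u y * η (i.insertNth (b i) y) := by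
  obtain ⟨F, hF, h1, h2, h3⟩ := h
  have l1 := tendsto_integral_mul ((tendsto_boxLp_iff fun k => (hF k).continuous).2 h1)
    (continuous_pderiv hη i)
  have l2 := tendsto_integral_mul ((tendsto_boxLp_iff fun k => continuous_pderiv (hF k) i).2 (h2 i))
    hη.continuous
  have l3 := tendsto_integral_mul ((tendsto_boxLp_iff (a := faceCorner a i) (b := faceCorner b i)
    fun k => (hF k).continuous.comp (continuous_insertNth i (b i))).2 h3)
    (hη.continuous.comp (continuous_insertNth i (b i)))
  refine tendsto_nhds_unique (l2.add l1) (l3.congr fun k => ?_)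
  rw [integral_boxLp_mul, integral_boxLp_mul, integral_boxLp_mul,
    integral_mul_add_integral_mul hab i (hF k) hη]
  simp [h0]

/-- Integration by parts with a boundary term on the face `{xᵢ = aᵢ}` only. -/
lemma HasTrace.integral_lower (hab : ∀ i, a i < b i) {i : Fin (n + 1)}
    {u : L2Box (faceCorner a i) (faceCorner b i)} (h : HasTrace i (a i) f u)
    {η : (Fin (n + 1) → ℝ) → ℂ} (hη : ContDiff ℝ ∞ η) (h0 : ∀ y, η (i.insertNth (b i) y) = 0) :
    (∫ x in openBox a b, weakDeriv i f x * η x) + ∫ x in openBox a b, f x * pderiv i η x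
      = -∫ y in openBox (faceCorner a i) (faceCorner b i), u y * η (i.insertNth (a i) y) := by
  obtain ⟨F, hF, h1, h2, h3⟩ := h
  have l1 := tendsto_integral_mul ((tendsto_boxLp_iff fun k => (hF k).continuous).2 h1)
    (continuous_pderiv hη i)
  have l2 := tendsto_integral_mul ((tendsto_boxLp_iff fun k => continuous_pderiv (hF k) i).2 (h2 i))
    hη.continuous
  have l3 := (tendsto_integral_mul ((tendsto_boxLp_iff (a := faceCorner a i) (b := faceCorner b i)
    fun k => (hF k).continuous.comp (continuous_insertNth i (a i))).2 h3)
    (hη.continuous.comp (continuous_insertNth i (a i)))).neg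
  refine tendsto_nhds_unique (l2.add l1) (l3.congr fun k => ?_)
  rw [integral_boxLp_mul, integral_boxLp_mul, integral_boxLp_mul,
    integral_mul_add_integral_mul hab i (hF k) hη]
  simp [h0]

/-- Integration by parts of a function with periodic traces against a periodic smooth function: the
two traces are produced by different approximating sequences, and `η` is split accordingly. -/
lemma PeriodicTrace.integral_weakDeriv_mul (hab : ∀ i, a i < b i) {i : Fin (n + 1)}
    (h : PeriodicTrace i f) {η : (Fin (n + 1) → ℝ) → ℂ} (hη : ContDiff ℝ ∞ η)
    (hper : ∀ y, η (i.insertNth (a i) y) = η (i.insertNth (b i) y)) :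
    ∫ x in openBox a b, weakDeriv i f x * η x = -∫ x in openBox a b, f x * pderiv i η x := by
  obtain ⟨u, hlo, hup⟩ := h
  have hr : b i - a i ≠ 0 := (sub_pos.2 (hab i)).ne'
  let w : (Fin (n + 1) → ℝ) → ℂ := fun x => (((x i - a i) / (b i - a i) : ℝ) : ℂ)
  have hw : ContDiff ℝ ∞ w :=
    Complex.ofRealCLM.contDiff.comp (((contDiff_apply ℝ ℝ i).sub contDiff_const).div_const _)
  have hη1 : ContDiff ℝ ∞ fun x => w x * η x := hw.mul hη
  have hη2 : ContDiff ℝ ∞ fun x => η x - w x * η x := hη.sub hη1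
  have w0 : ∀ y : Fin n → ℝ, w (i.insertNth (a i) y) = 0 := fun y => by simp [w]
  have w1 : ∀ y : Fin n → ℝ, w (i.insertNth (b i) y) = 1 := fun y => by
    simp only [w, Fin.insertNth_apply_same, div_self hr, Complex.ofReal_one]
  have e1 := hup.integral_upper hab hη1 fun y => by simp [w0]
  have e2 := hlo.integral_lower hab hη2 fun y => by simp [w1]
  simp only [w0, w1, one_mul, zero_mul, sub_zero] at e1 e2
  simp only [hper] at e2
  have s1 : ∫ x in openBox a b, weakDeriv i f x * (η x - w x * η x)
      = (∫ x in openBox a b, weakDeriv i f x * η x)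
        - ∫ x in openBox a b, weakDeriv i f x * (w x * η x) := by
    simp only [mul_sub]
    exact integral_sub (integrable_L2_mul _ (hη.continuous.memLp_openBox a b 2))
      (integrable_L2_mul _ (hη1.continuous.memLp_openBox a b 2))
  have s2 : ∫ x in openBox a b, f x * pderiv i (fun x => η x - w x * η x) x
      = (∫ x in openBox a b, f x * pderiv i η x)
        - ∫ x in openBox a b, f x * pderiv i (fun x => w x * η x) x := by
    rw [pderiv_sub hη hη1]
    simp only [mul_sub]
    exact integral_sub (integrable_L2_mul _ ((continuous_pderiv hη i).memLp_openBox a b 2))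
      (integrable_L2_mul _ ((continuous_pderiv hη1 i).memLp_openBox a b 2))
  rw [s1, s2] at e2
  rw [eq_neg_iff_add_eq_zero]
  linear_combination e1 + e2

/-- Integration by parts of a function with vanishing trace on one face against a smooth function
vanishing on the opposite face. -/
lemma HasTrace.integral_weakDeriv_mul (hab : ∀ i, a i < b i) {i : Fin (n + 1)} {c c' : ℝ}
    (hcc : (c = a i ∧ c' = b i) ∨ (c = b i ∧ c' = a i)) (h : HasTrace i c f 0)
    {η : (Fin (n + 1) → ℝ) → ℂ} (hη : ContDiff ℝ ∞ η) (h0 : ∀ y, η (i.insertNth c' y) = 0) :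
    ∫ x in openBox a b, weakDeriv i f x * η x = -∫ x in openBox a b, f x * pderiv i η x := by
  have hz : ∀ c, ∫ y in openBox (faceCorner a i) (faceCorner b i),
      (0 : L2Box (faceCorner a i) (faceCorner b i)) y * η (i.insertNth c y) = 0 := by
    intro c
    rw [← integral_zero (Fin n → ℝ) ℂ]
    refine integral_congr_ae ?_
    filter_upwards [Lp.coeFn_zero ℂ 2
      (volume.restrict (openBox (faceCorner a i) (faceCorner b i)))] with y hy
    rw [hy, Pi.zero_apply, zero_mul]
  rw [eq_neg_iff_add_eq_zero]
  rcases hcc with ⟨rfl, rfl⟩ | ⟨rfl, rfl⟩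
  · rw [h.integral_lower hab hη h0, hz, neg_zero]
  · rw [h.integral_upper hab hη h0, hz]

end Green

/-! ### A criterion for the completeness of trigonometric systems -/

section Separating

open scoped BoundedContinuousFunction

/-- On a Polish space with a finite measure, an integrable real function which annihilates a
separating star algebra of bounded continuous functions vanishes almost everywhere. -/
lemma ae_eq_zero_of_forall_mem_subalgebra {Y : Type*} [TopologicalSpace Y] [PolishSpace Y]
    [MeasurableSpace Y] [BorelSpace Y] {ν : Measure Y} {A : StarSubalgebra ℂ (Y →ᵇ ℂ)}
    (hA : (A.map (BoundedContinuousFunction.toContinuousMapStarₐ ℂ)).SeparatesPoints)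
    {φ : Y → ℝ} (hφ : Integrable φ ν) (h : ∀ g ∈ A, ∫ y, (φ y : ℂ) * g y ∂ν = 0) :
    φ =ᵐ[ν] 0 := by
  have hfin : ∀ {ψ : Y → ℝ}, Integrable ψ ν → ∫⁻ y, ENNReal.ofReal (ψ y) ∂ν ≠ ⊤ := fun hψ =>
    hψ.lintegral_lt_top.ne
  have hfm : ∀ {ψ : Y → ℝ}, Integrable ψ ν →
      IsFiniteMeasure (ν.withDensity fun y => ENNReal.ofReal (ψ y)) := fun hψ =>
    isFiniteMeasure_withDensity (hfin hψ)
  have hm : ∀ {ψ : Y → ℝ}, Integrable ψ ν → AEMeasurable (fun y => ENNReal.ofReal (ψ y)) ν :=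
    fun hψ => hψ.aemeasurable.ennreal_ofReal
  have hgi : ∀ (g : Y →ᵇ ℂ) {ψ : Y → ℝ}, Integrable ψ ν →
      Integrable (fun y => (ENNReal.ofReal (ψ y)).toReal • g y) ν := fun g ψ hψ =>
    Integrable.smul_bdd (φ := fun y => (ENNReal.ofReal (ψ y)).toReal) (f := g)
      (integrable_toReal_of_lintegral_ne_top (hm hψ) (hfin hψ)) ‖g‖
      g.continuous.aestronglyMeasurable (Eventually.of_forall g.norm_coe_le_norm)
  have := hfm hφ
  have := hfm hφ.neg
  have key : (ν.withDensity fun y => ENNReal.ofReal (φ y))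
      = ν.withDensity fun y => ENNReal.ofReal ((-φ) y) := by
    refine ext_of_forall_mem_subalgebra_integral_eq_of_polish hA fun g hg => ?_
    rw [integral_withDensity_eq_integral_toReal_smul₀ (hm hφ) (by simp),
      integral_withDensity_eq_integral_toReal_smul₀ (hm hφ.neg) (by simp), ← sub_eq_zero,
      ← integral_sub, ← h g hg]
    · refine integral_congr_ae (Eventually.of_forall fun y => ?_)
      simp only [Pi.neg_apply, ENNReal.toReal_ofReal', Complex.real_smul]
      rw [← sub_mul, ← Complex.ofReal_sub]
      congr 2
      rcases le_total 0 (φ y) with hy | hy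
      · rw [max_eq_left hy, max_eq_right (by linarith), sub_zero]
      · rw [max_eq_right hy, max_eq_left (by linarith)]; ring
    · exact hgi g hφ
    · exact hgi g hφ.neg
  rw [withDensity_eq_iff (hm hφ) (hm hφ.neg) (hfin hφ)] at key
  filter_upwards [key] with y hy
  simp only [Pi.neg_apply] at hy
  have h1 := congrArg ENNReal.toReal hy
  rw [ENNReal.toReal_ofReal', ENNReal.toReal_ofReal'] at h1
  rcases le_total 0 (φ y) with h0 | h0
  · rw [max_eq_left h0, max_eq_right (by linarith)] at h1; exact h1
  · rw [max_eq_right h0, max_eq_left (by linarith)] at h1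
    simp only [Pi.zero_apply]; linarith

/-- An integrable function on a box is zero if it annihilates a set of continuous functions that is
stable under products and conjugation, contains `1` and separates the points of the open box. -/
lemma ae_eq_zero_of_forall_integral_mul_eq_zero {d : ℕ} {a b : Fin d → ℝ}
    (S : Submonoid ((Fin d → ℝ) → ℂ)) (hcont : ∀ G ∈ S, Continuous G)
    (hstar : ∀ G ∈ S, (fun x => conj (G x)) ∈ S)
    (hsep : ∀ x ∈ openBox a b, ∀ y ∈ openBox a b, x ≠ y → ∃ G ∈ S, G x ≠ G y)
    {f : (Fin d → ℝ) → ℂ} (hf : Integrable f (volume.restrict (openBox a b)))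
    (h : ∀ G ∈ S, ∫ x in openBox a b, f x * G x = 0) :
    f =ᵐ[volume.restrict (openBox a b)] 0 := by
  have : PolishSpace (openBox a b) := (isOpen_openBox a b).polishSpace
  have hms := measurableSet_openBox a b
  let T : Submonoid (openBox a b →ᵇ ℂ) :=
    { carrier := {g | ∃ G ∈ S, ∀ y, g y = G y}
      one_mem' := ⟨1, S.one_mem, fun _ => rfl⟩
      mul_mem' := by
        rintro g g' ⟨G, hG, e⟩ ⟨G', hG', e'⟩
        exact ⟨G * G', S.mul_mem hG hG', fun y => by simp [e, e']⟩ }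
  have hspan : Subalgebra.toSubmodule (Algebra.adjoin ℂ (T : Set (openBox a b →ᵇ ℂ)))
      = Submodule.span ℂ T := by
    rw [Algebra.adjoin_eq_span, Submonoid.closure_eq]
  have hmem : ∀ g, g ∈ Algebra.adjoin ℂ (T : Set (openBox a b →ᵇ ℂ)) ↔ g ∈ Submodule.span ℂ
      (T : Set (openBox a b →ᵇ ℂ)) := fun g => by rw [← hspan]; rfl
  have hTstar : ∀ g ∈ T, star g ∈ T := by
    rintro g ⟨G, hG, e⟩
    exact ⟨_, hstar G hG, fun y => by simp [e]⟩
  let A : StarSubalgebra ℂ (openBox a b →ᵇ ℂ) :=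
    { Algebra.adjoin ℂ (T : Set (openBox a b →ᵇ ℂ)) with
      star_mem' := by
        intro g hg
        change g ∈ Algebra.adjoin ℂ (T : Set (openBox a b →ᵇ ℂ)) at hg
        change star g ∈ Algebra.adjoin ℂ (T : Set (openBox a b →ᵇ ℂ))
        rw [hmem] at hg ⊢
        induction hg using Submodule.span_induction with
        | mem x hx => exact Submodule.subset_span (hTstar x hx)
        | zero => rw [star_zero]; exact Submodule.zero_mem _
        | add x y _ _ hx hy => rw [star_add]; exact Submodule.add_mem _ hx hy
        | smul r x _ hx => rw [star_smul]; exact Submodule.smul_mem _ _ hx }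
  have hAmem : ∀ g, g ∈ A ↔ g ∈ Submodule.span ℂ (T : Set (openBox a b →ᵇ ℂ)) := hmem
  have hAsep : (A.map (BoundedContinuousFunction.toContinuousMapStarₐ ℂ)).SeparatesPoints := by
    intro x y hxy
    obtain ⟨G, hG, hne⟩ := hsep x x.2 y y.2 fun e => hxy (Subtype.ext e)
    obtain ⟨C, hC⟩ := (isCompact_Icc (a := a) (b := b)).exists_bound_of_continuousOn
      (hcont G hG).continuousOn
    let g : openBox a b →ᵇ ℂ := BoundedContinuousFunction.ofNormedAddCommGroup (fun y => G y)
      ((hcont G hG).comp continuous_subtype_val) C fun y => hC y (openBox_subset_Icc a b y.2)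
    refine ⟨g, ⟨g.toContinuousMap, ⟨g, ?_, rfl⟩, rfl⟩, hne⟩
    exact (hAmem g).2 (Submodule.subset_span ⟨G, hG, fun _ => rfl⟩)
  have hbdd : ∀ G ∈ S, ∀ {u : (Fin d → ℝ) → ℂ}, Integrable u (volume.restrict (openBox a b)) →
      Integrable (fun x => u x * G x) (volume.restrict (openBox a b)) := by
    intro G hG u hu
    obtain ⟨C, hC⟩ := (isCompact_Icc (a := a) (b := b)).exists_bound_of_continuousOn
      (hcont G hG).continuousOn
    refine hu.mul_bdd (c := C) (hcont G hG).aestronglyMeasurable ?_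
    filter_upwards [ae_restrict_mem hms] with x hx
    exact hC x (openBox_subset_Icc a b hx)
  have hfc : Integrable (fun x => conj (f x)) (volume.restrict (openBox a b)) :=
    Complex.conjCLE.toContinuousLinearMap.integrable_comp hf
  have hconj : ∀ G ∈ S, ∫ x in openBox a b, conj (f x) * G x = 0 := by
    intro G hG
    have h1 := congrArg conj (h _ (hstar G hG))
    rw [← integral_conj] at h1
    simpa using h1
  have real : ∀ {φ : (Fin d → ℝ) → ℝ}, Integrable φ (volume.restrict (openBox a b)) →
      (∀ G ∈ S, ∫ x in openBox a b, (φ x : ℂ) * G x = 0) →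
      φ =ᵐ[volume.restrict (openBox a b)] 0 := by
    intro φ hφ h0
    have hφ' : Integrable (fun y : openBox a b => φ y) (Measure.comap Subtype.val volume) := by
      refine ((MeasurableEmbedding.subtype_coe hms).integrable_map_iff (g := φ)).1 ?_
      rwa [map_comap_subtype_coe hms]
    have hcomap : ∀ u : (Fin d → ℝ) → ℂ,
        ∫ y : openBox a b, u y ∂(Measure.comap Subtype.val volume) = ∫ x in openBox a b, u x :=
      fun u => integral_subtype_comap hms u
    have h1 := ae_eq_zero_of_forall_mem_subalgebra (A := A)
      (ν := Measure.comap (Subtype.val : openBox a b → _) volume) hAsep hφ' (by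
        intro g hg
        have hgint : ∀ g : openBox a b →ᵇ ℂ, Integrable (fun y : openBox a b => (φ y : ℂ) * g y)
            (Measure.comap Subtype.val volume) := fun g =>
          (hφ'.ofReal (𝕜 := ℂ)).mul_bdd (c := ‖g‖) g.continuous.aestronglyMeasurable
            (Eventually.of_forall g.norm_coe_le_norm)
        rw [hAmem] at hg
        induction hg using Submodule.span_induction with
        | mem g hg =>
          obtain ⟨G, hG, e⟩ := hg
          simp only [e]
          rw [hcomap fun x => (φ x : ℂ) * G x, h0 G hG]
        | zero => simp
        | add g g' _ _ hg hg' =>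
          simp only [BoundedContinuousFunction.add_apply, mul_add]
          rw [integral_add (hgint g) (hgint g'), hg, hg', add_zero]
        | smul r g _ hg =>
          simp only [BoundedContinuousFunction.smul_apply, smul_eq_mul, mul_left_comm _ r]
          rw [integral_const_mul, hg, mul_zero])
    rw [← map_comap_subtype_coe hms]
    exact (MeasurableEmbedding.subtype_coe hms).ae_map_iff.2 h1
  have hre := real hf.re fun G hG => by
    have h1 := hbdd G hG hf
    have h2 := hbdd G hG hfc
    have e : ∀ x, ((RCLike.re (f x) : ℝ) : ℂ) * G x
        = (1 / 2 : ℂ) * (f x * G x + conj (f x) * G x) := fun x => by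
      rw [← add_mul, Complex.add_conj]
      simp only [RCLike.re_to_complex]
      push_cast
      ring
    simp only [e]
    rw [integral_const_mul, integral_add h1 h2, h G hG, hconj G hG, add_zero, mul_zero]
  have him := real hf.im fun G hG => by
    have h1 := hbdd G hG hf
    have h2 := hbdd G hG hfc
    have e : ∀ x, ((RCLike.im (f x) : ℝ) : ℂ) * G x
        = (-Complex.I / 2 : ℂ) * (f x * G x - conj (f x) * G x) := fun x => by
      rw [← sub_mul, Complex.sub_conj]
      have := Complex.I_mul_I
      simp only [RCLike.im_to_complex]
      push_cast
      linear_combination ((f x).im * G x) * this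
    simp only [e]
    rw [integral_const_mul, integral_sub h1 h2, h G hG, hconj G hG, sub_zero, mul_zero]
  filter_upwards [hre, him] with x h1 h2
  exact Complex.ext h1 h2

end Separating

/-! ### Fourier modes -/

/-- The function `x ↦ F(x₀, x₁) s(x₂)` on `ℝ³`. -/
def tens (F : (Fin 2 → ℝ) → ℂ) (s : ℝ → ℂ) (x : Fin 3 → ℝ) : ℂ := F (horiz x) * s (x 2)

lemma horiz_apply (x : Fin 3 → ℝ) (j : Fin 2) : horiz x j = x j.castSucc := by
  fin_cases j <;> rfl

/-- `horiz` as a continuous linear map. -/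
def horizL : (Fin 3 → ℝ) →L[ℝ] (Fin 2 → ℝ) :=
  ContinuousLinearMap.pi fun j => ContinuousLinearMap.proj (R := ℝ) (φ := fun _ => ℝ) j.castSucc

lemma horizL_apply (x : Fin 3 → ℝ) : horizL x = horiz x := by
  ext j; rw [horiz_apply]; rfl

lemma contDiff_tens {F : (Fin 2 → ℝ) → ℂ} {s : ℝ → ℂ} (hF : ContDiff ℝ ∞ F)
    (hs : ContDiff ℝ ∞ s) : ContDiff ℝ ∞ (tens F s) := by
  have h1 : ContDiff ℝ ∞ fun x => F (horizL x) := hF.comp horizL.contDiff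
  simp only [horizL_apply] at h1
  exact h1.mul (hs.comp (contDiff_apply ℝ ℝ 2))

lemma hasFDerivAt_tens {F : (Fin 2 → ℝ) → ℂ} {s : ℝ → ℂ} (hF : ContDiff ℝ ∞ F)
    (hs : ContDiff ℝ ∞ s) (x : Fin 3 → ℝ) :
    HasFDerivAt (tens F s) (F (horiz x) • (fderiv ℝ s (x 2)).comp (ContinuousLinearMap.proj
      (R := ℝ) (φ := fun _ : Fin 3 => ℝ) 2)
        + s (x 2) • (fderiv ℝ F (horiz x)).comp horizL) x := by
  have h1 : HasFDerivAt (fun x => F (horiz x)) ((fderiv ℝ F (horiz x)).comp horizL) x := by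
    have := ((hF.differentiable (by simp) (horizL x)).hasFDerivAt).comp x
      (horizL.hasFDerivAt (x := x))
    rw [horizL_apply] at this
    exact this.congr_of_eventuallyEq (Eventually.of_forall fun y => by
      rw [Function.comp_apply, horizL_apply])
  have h2 : HasFDerivAt (fun x : Fin 3 → ℝ => s (x 2)) ((fderiv ℝ s (x 2)).comp
      (ContinuousLinearMap.proj (R := ℝ) (φ := fun _ : Fin 3 => ℝ) 2)) x :=
    HasFDerivAt.comp (g := s) x (hs.differentiable (by simp) (x 2)).hasFDerivAt
      (ContinuousLinearMap.proj (R := ℝ) (φ := fun _ : Fin 3 => ℝ) 2).hasFDerivAt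
  exact h1.mul h2

lemma pderiv_castSucc_tens {F : (Fin 2 → ℝ) → ℂ} {s : ℝ → ℂ} (hF : ContDiff ℝ ∞ F)
    (hs : ContDiff ℝ ∞ s) (j : Fin 2) : pderiv j.castSucc (tens F s) = tens (pderiv j F) s := by
  funext x
  have e : horizL (Pi.single j.castSucc 1) = Pi.single j 1 := by
    ext i
    change (Pi.single j.castSucc 1 : Fin 3 → ℝ) i.castSucc = _
    rw [Pi.single_apply, Pi.single_apply]
    simp
  have e2 : (2 : Fin 3) ≠ j.castSucc := by fin_cases j <;> decide
  simp [pderiv, tens, (hasFDerivAt_tens hF hs x).fderiv, e, e2, mul_comm]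

lemma pderiv_two_tens {F : (Fin 2 → ℝ) → ℂ} {s : ℝ → ℂ} (hF : ContDiff ℝ ∞ F)
    (hs : ContDiff ℝ ∞ s) : pderiv 2 (tens F s) = tens F (deriv s) := by
  funext x
  have e : horizL (Pi.single 2 1) = 0 := by
    ext i
    change (Pi.single 2 1 : Fin 3 → ℝ) i.castSucc = 0
    fin_cases i <;> simp
  simp [pderiv, tens, (hasFDerivAt_tens hF hs x).fderiv, e]

lemma integral_tens (h : ℝ) (F : (Fin 2 → ℝ) → ℂ) (s : ℝ → ℂ) :
    ∫ x in openBox (loΩ h) hiΩ, tens F s x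
      = (∫ z in Ioo (-h) 0, s z) * ∫ y in openBox loG hiG, F y := by
  have hmp' := (measurePreserving_split h).symm
    (MeasurableEquiv.piFinSuccAbove (fun _ : Fin 3 => ℝ) 2)
  rw [← hmp'.integral_comp (MeasurableEquiv.measurableEmbedding _), ← integral_prod_mul]
  refine integral_congr_ae (Eventually.of_forall fun p => ?_)
  have e1 : (MeasurableEquiv.piFinSuccAbove (fun _ : Fin 3 => ℝ) 2).symm p
      = (2 : Fin 3).insertNth p.1 p.2 := rfl
  simp only [e1, tens, horiz, Fin.removeNth_insertNth, Fin.insertNth_apply_same]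
  ring

/-- The Fourier mode `e^{2πi k·y}` on `G`. -/
def expG (k : Fin 2 → ℤ) (y : Fin 2 → ℝ) : ℂ :=
  Complex.exp (2 * Real.pi * Complex.I * ∑ j, (k j : ℂ) * (y j : ℂ))

lemma contDiff_expG (k : Fin 2 → ℤ) : ContDiff ℝ ∞ (expG k) := by
  refine Complex.contDiff_exp.comp (contDiff_const.mul (ContDiff.sum fun j _ => ?_))
  exact contDiff_const.mul (Complex.ofRealCLM.contDiff.comp (contDiff_apply ℝ ℝ j))

lemma pderiv_expG (k : Fin 2 → ℤ) (j : Fin 2) :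
    pderiv j (expG k) = fun y => 2 * Real.pi * Complex.I * k j * expG k y := by
  funext y
  have h1 : HasFDerivAt (fun y : Fin 2 → ℝ => 2 * Real.pi * Complex.I * ∑ j, (k j : ℂ) * (y j : ℂ))
      ((2 * Real.pi * Complex.I : ℂ) • ∑ j, (k j : ℂ) • Complex.ofRealCLM.comp
        (ContinuousLinearMap.proj (R := ℝ) (φ := fun _ : Fin 2 => ℝ) j)) y := by
    refine HasFDerivAt.const_mul (HasFDerivAt.fun_sum fun j _ => HasFDerivAt.const_mul ?_ _) _
    exact (Complex.ofRealCLM.comp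
        (ContinuousLinearMap.proj (R := ℝ) (φ := fun _ : Fin 2 => ℝ) j)).hasFDerivAt
  have h2 : HasFDerivAt (expG k) _ y := h1.cexp
  rw [pderiv, h2.fderiv]
  have e : (∑ i, (k i : ℂ) • Complex.ofRealCLM.comp (ContinuousLinearMap.proj (R := ℝ)
      (φ := fun _ : Fin 2 => ℝ) i)) (Pi.single j 1) = k j := by
    rw [sum_apply, Finset.sum_eq_single j]
    · simp
    · intro i _ hi
      simp [hi]
    · simp
  rw [smul_apply, smul_apply, e]
  simp only [expG, smul_eq_mul]
  ring

lemma expG_mul (k l : Fin 2 → ℤ) (y : Fin 2 → ℝ) : expG k y * expG l y = expG (k + l) y := by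
  rw [expG, expG, expG, ← Complex.exp_add, ← mul_add, ← Finset.sum_add_distrib]
  congr 2
  refine Finset.sum_congr rfl fun j _ => ?_
  simp only [Pi.add_apply]
  push_cast
  ring

lemma conj_expG (k : Fin 2 → ℤ) (y : Fin 2 → ℝ) : conj (expG k y) = expG (-k) y := by
  rw [expG, expG, ← Complex.exp_conj]
  congr 1
  simp only [Fin.sum_univ_two, map_mul, map_add, Complex.conj_ofReal, Complex.conj_I,
    Complex.conj_ofNat, Pi.neg_apply, map_intCast]
  push_cast
  ring

lemma expG_zero (y : Fin 2 → ℝ) : expG 0 y = 1 := by simp [expG]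

/-- `expG k` is periodic with period one in each direction. -/
lemma expG_insertNth (k : Fin 2 → ℤ) (j : Fin 2) (y : Fin 1 → ℝ) :
    expG k (j.insertNth (loG j) y) = expG k (j.insertNth (hiG j) y) := by
  rw [expG, expG, Complex.exp_eq_exp_iff_exists_int]
  refine ⟨-k j, ?_⟩
  have e1 : ∀ c : ℝ, ∑ i, (k i : ℂ) * ((j.insertNth c y : Fin 2 → ℝ) i : ℂ)
      = k j * c + ∑ i, (k (j.succAbove i) : ℂ) * (y i : ℂ) := by
    intro c
    rw [Fin.sum_univ_succAbove _ j]
    simp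
  have e2 : loG j = 0 := by fin_cases j <;> rfl
  have e3 : hiG j = 1 := by fin_cases j <;> rfl
  rw [e1, e1, e2, e3]
  push_cast
  ring

lemma loG_lt_hiG (i : Fin 2) : loG i < hiG i := by
  fin_cases i <;> simp [loG, hiG]

lemma loΩ_lt_hiΩ {h : ℝ} (hh : 0 < h) (i : Fin 3) : loΩ h i < hiΩ i := by
  fin_cases i <;> simp [loΩ, hiΩ, hh]

lemma integral_expG (k : Fin 2 → ℤ) :
    ∫ y in openBox loG hiG, expG k y = if k = 0 then 1 else 0 := by
  split_ifs with hk
  · subst hk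
    simp only [expG_zero]
    simp [openBox, Real.volume_pi_Ioo, loG, hiG, Measure.real]
  · obtain ⟨j, hj⟩ : ∃ j, k j ≠ 0 := Function.ne_iff.1 hk
    have h1 := integral_pderiv_openBox loG_lt_hiG j (contDiff_expG k)
    simp only [expG_insertNth, sub_self, pderiv_expG] at h1
    rw [integral_const_mul] at h1
    refine (mul_eq_zero.1 h1).resolve_left ?_
    have : (k j : ℂ) ≠ 0 := by exact_mod_cast hj
    simp [Real.pi_ne_zero, this]

/-- The orthonormal basis element `e^{2πi k·y}` of `L²(G)`. -/
def eG (k : Fin 2 → ℤ) : L2G := boxLp loG hiG (contDiff_expG k).continuous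

lemma orthonormal_eG : Orthonormal ℂ eG := by
  rw [orthonormal_iff_ite]
  intro k l
  rw [eG, inner_boxLp, eG, integral_boxLp_mul]
  simp only [conj_expG, expG_mul]
  rw [integral_expG]
  congr 1
  rw [← sub_eq_add_neg, sub_eq_zero]
  exact propext eq_comm

lemma eq_of_expG_eq {s t : ℝ} (hs : s ∈ Ioo (0 : ℝ) 1) (ht : t ∈ Ioo (0 : ℝ) 1)
    (h : Complex.exp (2 * Real.pi * Complex.I * s) = Complex.exp (2 * Real.pi * Complex.I * t)) :
    s = t := by
  rw [Complex.exp_eq_exp_iff_exists_int] at h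
  obtain ⟨n, hn⟩ := h
  have h0 : (2 * Real.pi * Complex.I : ℂ) ≠ 0 := by simp [Real.pi_ne_zero]
  have h1 : (s : ℂ) = t + n := by
    have : (2 * Real.pi * Complex.I : ℂ) * s = 2 * Real.pi * Complex.I * (t + n) := by
      rw [hn]; ring
    exact mul_left_cancel₀ h0 this
  have h2 : s = t + n := by exact_mod_cast h1
  have h3 : (n : ℝ) < 1 := by linarith [hs.2, ht.1]
  have h4 : (-1 : ℝ) < n := by linarith [hs.1, ht.2]
  have h5 : n = 0 := by
    have : n < 1 := by exact_mod_cast h3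
    have : -1 < n := by exact_mod_cast h4
    omega
  rw [h2, h5]; simp

lemma exists_expG_ne {x y : Fin 2 → ℝ} (hx : ∀ j, x j ∈ Ioo (0 : ℝ) 1)
    (hy : ∀ j, y j ∈ Ioo (0 : ℝ) 1) (hxy : x ≠ y) : ∃ k, expG k x ≠ expG k y := by
  obtain ⟨j, hj⟩ := Function.ne_iff.1 hxy
  refine ⟨Pi.single j 1, fun he => hj (eq_of_expG_eq (hx j) (hy j) ?_)⟩
  have e : ∀ y : Fin 2 → ℝ,
      expG (Pi.single j 1) y = Complex.exp (2 * Real.pi * Complex.I * y j) := by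
    intro y
    rw [expG, Finset.sum_eq_single j (by intro i _ hi; simp [hi]) (by simp)]
    simp
  rw [← e, ← e, he]

lemma mem_openBox_G {y : Fin 2 → ℝ} (hy : y ∈ openBox loG hiG) (j : Fin 2) :
    y j ∈ Ioo (0 : ℝ) 1 := by
  have := hy j trivial
  fin_cases j <;> exact this

/-- Completeness of the exponentials in `L²(G)`. -/
lemma eq_zero_of_inner_eG {f : L2G} (h : ∀ k, inner ℂ (eG k) f = 0) : f = 0 := by
  rw [Lp.eq_zero_iff_ae_eq_zero]
  let S : Submonoid ((Fin 2 → ℝ) → ℂ) :=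
    { carrier := Set.range expG
      one_mem' := ⟨0, funext expG_zero⟩
      mul_mem' := by
        rintro _ _ ⟨k, rfl⟩ ⟨l, rfl⟩
        exact ⟨k + l, funext fun y => (expG_mul k l y).symm⟩ }
  refine ae_eq_zero_of_forall_integral_mul_eq_zero S ?_ ?_ ?_
    ((Lp.memLp f).integrable (by norm_num)) ?_
  · rintro _ ⟨k, rfl⟩; exact (contDiff_expG k).continuous
  · rintro _ ⟨k, rfl⟩; exact ⟨-k, funext fun y => (conj_expG k y).symm⟩
  · intro x hx y hy hxy
    obtain ⟨k, hk⟩ := exists_expG_ne (mem_openBox_G hx) (mem_openBox_G hy) hxy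
    exact ⟨_, ⟨k, rfl⟩, hk⟩
  · rintro _ ⟨k, rfl⟩
    have := h (-k)
    rw [eG, inner_boxLp] at this
    simpa [conj_expG] using this

/-- The Fourier basis of `L²(G)`. -/
def basisG : HilbertBasis (Fin 2 → ℤ) ℂ L2G :=
  HilbertBasis.mkOfOrthogonalEqBot orthonormal_eG (by
    rw [Submodule.eq_bot_iff]
    intro f hf
    refine eq_zero_of_inner_eG fun k => ?_
    exact (Submodule.mem_orthogonal _ _).1 hf _ (Submodule.subset_span ⟨k, rfl⟩))

lemma coe_basisG (k : Fin 2 → ℤ) : basisG k = eG k := by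
  simp [basisG]

/-! ### Eigenfunctions of the Laplacian on the domain -/

/-- The vertical frequency `μₙ = (n + 1/2) π / h`. -/
def freqZ (h : ℝ) (n : ℕ) : ℝ := (n + 1 / 2) * Real.pi / h

lemma freqZ_pos {h : ℝ} (hh : 0 < h) (n : ℕ) : 0 < freqZ h n := by
  have := Real.pi_pos
  unfold freqZ
  positivity

lemma freqZ_mul {h : ℝ} (hh : 0 < h) (n : ℕ) : freqZ h n * h = n * Real.pi + Real.pi / 2 := by
  unfold freqZ
  field_simp

/-- The vertical modes: `√(2/h) sin (μₙ (z + h))` (for `T = true`), which vanish at `z = -h` and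
have zero derivative at `z = 0`, and `√(2/h) cos (μₙ (z + h))` (for `T = false`). -/
def trigZ (T : Bool) (h : ℝ) (n : ℕ) (z : ℝ) : ℂ :=
  ((Real.sqrt (2 / h) * (if T then Real.sin (freqZ h n * (z + h))
    else Real.cos (freqZ h n * (z + h))) : ℝ) : ℂ)

lemma contDiff_trigZ (T : Bool) (h : ℝ) (n : ℕ) : ContDiff ℝ ∞ (trigZ T h n) := by
  refine Complex.ofRealCLM.contDiff.comp (contDiff_const.mul ?_)
  have h1 : ContDiff ℝ ∞ fun z : ℝ => freqZ h n * (z + h) :=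
    contDiff_const.mul (contDiff_id.add contDiff_const)
  cases T
  · exact Real.contDiff_cos.comp h1
  · exact Real.contDiff_sin.comp h1

lemma deriv_trigZ (T : Bool) (h : ℝ) (n : ℕ) :
    deriv (trigZ T h n) = fun z =>
      (if T then (freqZ h n : ℂ) else -freqZ h n) * trigZ (!T) h n z := by
  funext z
  have h1 : HasDerivAt (fun z : ℝ => freqZ h n * (z + h)) (freqZ h n) z := by
    simpa using ((hasDerivAt_id z).add_const h).const_mul (freqZ h n)
  cases T
  · have h2 := ((h1.cos).const_mul (Real.sqrt (2 / h))).ofReal_comp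
    have h3 : HasDerivAt (trigZ false h n) _ z := h2
    rw [h3.deriv]
    simp [trigZ]
    ring
  · have h2 := ((h1.sin).const_mul (Real.sqrt (2 / h))).ofReal_comp
    have h3 : HasDerivAt (trigZ true h n) _ z := h2
    rw [h3.deriv]
    simp [trigZ]
    ring

lemma conj_trigZ (T : Bool) (h : ℝ) (n : ℕ) (z : ℝ) : conj (trigZ T h n z) = trigZ T h n z :=
  Complex.conj_ofReal _

lemma trigZ_true_bot (h : ℝ) (n : ℕ) : trigZ true h n (-h) = 0 := by simp [trigZ]

lemma cos_freqZ_mul {h : ℝ} (hh : 0 < h) (n : ℕ) : Real.cos (freqZ h n * h) = 0 := by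
  rw [freqZ_mul hh, Real.cos_add_pi_div_two, Real.sin_nat_mul_pi, neg_zero]

lemma trigZ_false_top {h : ℝ} (hh : 0 < h) (n : ℕ) : trigZ false h n 0 = 0 := by
  simp [trigZ, cos_freqZ_mul hh]

lemma integral_cos_vertical {h : ℝ} (hh : 0 < h) {m : ℤ} (hm : m ≠ 0) :
    ∫ z in Ioo (-h) 0, Real.cos (m * Real.pi / h * (z + h)) = 0 := by
  have hc : (m * Real.pi / h : ℝ) ≠ 0 := by
    have : (m : ℝ) ≠ 0 := by exact_mod_cast hm
    have := Real.pi_ne_zero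
    positivity
  rw [← integral_Ioc_eq_integral_Ioo, ← intervalIntegral.integral_of_le (by linarith)]
  have e : ∀ z : ℝ, m * Real.pi / h * (z + h) = m * Real.pi / h * z + m * Real.pi := fun z => by
    field_simp
  simp only [e]
  rw [intervalIntegral.integral_comp_mul_add (fun t => Real.cos t) hc, integral_cos]
  have e2 : m * Real.pi / h * -h + m * Real.pi = 0 := by field_simp; ring
  rw [e2]
  simp [Real.sin_int_mul_pi]

lemma integral_trigZ_mul (T : Bool) {h : ℝ} (hh : 0 < h) (n m : ℕ) :
    ∫ z in Ioo (-h) 0, trigZ T h n z * trigZ T h m z = if n = m then 1 else 0 := by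
  have hs : Real.sqrt (2 / h) * Real.sqrt (2 / h) = 2 / h := Real.mul_self_sqrt (by positivity)
  have h1 : ∀ z, freqZ h n * (z + h) - freqZ h m * (z + h)
      = ((n : ℤ) - m : ℤ) * Real.pi / h * (z + h) := fun z => by
    unfold freqZ; push_cast; field_simp; ring
  have h2 : ∀ z, freqZ h n * (z + h) + freqZ h m * (z + h)
      = ((n : ℤ) + m + 1 : ℤ) * Real.pi / h * (z + h) := fun z => by
    unfold freqZ; push_cast; field_simp; ring
  set σ : ℝ := if T then -1 else 1 with hσ
  have e : ∀ z, trigZ T h n z * trigZ T h m z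
      = ((1 / h * (Real.cos (((n : ℤ) - m : ℤ) * Real.pi / h * (z + h))
        + σ * Real.cos (((n : ℤ) + m + 1 : ℤ) * Real.pi / h * (z + h))) : ℝ) : ℂ) := by
    intro z
    rw [← h1, ← h2, Real.cos_sub, Real.cos_add, trigZ, trigZ, ← Complex.ofReal_mul]
    congr 1
    cases T <;> simp only [hσ, if_true, if_false, Bool.false_eq_true]
    · linear_combination (Real.cos (freqZ h n * (z + h)) * Real.cos (freqZ h m * (z + h))) * hs
    · linear_combination (Real.sin (freqZ h n * (z + h)) * Real.sin (freqZ h m * (z + h))) * hs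
  simp only [e]
  rw [integral_complex_ofReal, integral_const_mul, integral_add, integral_const_mul,
    integral_cos_vertical hh (m := (n : ℤ) + m + 1) (by omega), mul_zero, add_zero]
  · split_ifs with hnm
    · subst hnm
      simp [hh.ne', hh.le]
    · rw [integral_cos_vertical hh (m := (n : ℤ) - m) (by omega)]
      simp
  · exact (Continuous.integrableOn_Icc (by fun_prop)).mono_set Ioo_subset_Icc_self
  · exact (Continuous.integrableOn_Icc (by fun_prop)).mono_set Ioo_subset_Icc_self

/-- Index set of the modes on `Ω`: a horizontal frequency `k ∈ ℤ²` and a vertical index `n`. -/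
abbrev ModeIdx : Type := (Fin 2 → ℤ) × ℕ

/-- The mode `e^{2πi k·(x,y)} trigZ(z)` on `Ω`. -/
def modeΩ (T : Bool) (h : ℝ) (ξ : ModeIdx) : (Fin 3 → ℝ) → ℂ := tens (expG ξ.1) (trigZ T h ξ.2)

lemma contDiff_modeΩ (T : Bool) (h : ℝ) (ξ : ModeIdx) : ContDiff ℝ ∞ (modeΩ T h ξ) :=
  contDiff_tens (contDiff_expG _) (contDiff_trigZ _ _ _)

/-- The factor produced by `∂ᵢ` acting on a mode. -/
def symb (T : Bool) (h : ℝ) (i : Fin 3) (ξ : ModeIdx) : ℂ :=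
  Fin.lastCases (motive := fun _ => ℂ) (if T then (freqZ h ξ.2 : ℂ) else -freqZ h ξ.2)
    (fun j => 2 * Real.pi * Complex.I * ξ.1 j) i

/-- `∂ᵢ` exchanges sines and cosines in the vertical direction only. -/
def flipZ (T : Bool) (i : Fin 3) : Bool := if i = 2 then !T else T

lemma symb_two (T : Bool) (h : ℝ) (ξ : ModeIdx) :
    symb T h 2 ξ = if T then (freqZ h ξ.2 : ℂ) else -freqZ h ξ.2 := rfl

lemma symb_castSucc (T : Bool) (h : ℝ) (j : Fin 2) (ξ : ModeIdx) :
    symb T h j.castSucc ξ = 2 * Real.pi * Complex.I * ξ.1 j := by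
  simp [symb]

lemma flipZ_castSucc (T : Bool) (j : Fin 2) : flipZ T j.castSucc = T := by
  fin_cases j <;> rfl

lemma pderiv_modeΩ (T : Bool) (h : ℝ) (i : Fin 3) (ξ : ModeIdx) :
    pderiv i (modeΩ T h ξ) = fun x => symb T h i ξ * modeΩ (flipZ T i) h ξ x := by
  refine Fin.lastCases ?_ (fun j => ?_) i
  · change pderiv 2 _ = fun x => symb T h 2 ξ * modeΩ (!T) h ξ x
    rw [modeΩ, pderiv_two_tens (contDiff_expG _) (contDiff_trigZ _ _ _), deriv_trigZ, symb_two]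
    funext x
    simp only [tens, modeΩ]
    ring
  · rw [modeΩ, pderiv_castSucc_tens (contDiff_expG _) (contDiff_trigZ _ _ _), pderiv_expG,
      symb_castSucc, flipZ_castSucc]
    funext x
    simp only [tens, modeΩ]
    ring

/-- `λ = |2πk|² + μₙ²`, the eigenvalue of `-Δ` at a mode. -/
def eigΩ (h : ℝ) (ξ : ModeIdx) : ℝ := ∑ i, ‖symb true h i ξ‖ ^ 2

lemma eigΩ_eq (h : ℝ) (ξ : ModeIdx) :
    eigΩ h ξ = (2 * Real.pi) ^ 2 * ((ξ.1 0 : ℝ) ^ 2 + (ξ.1 1 : ℝ) ^ 2) + freqZ h ξ.2 ^ 2 := by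
  rw [eigΩ, Fin.sum_univ_castSucc, Fin.sum_univ_two]
  simp only [symb_castSucc]
  change _ + _ + ‖symb true h 2 ξ‖ ^ 2 = _
  rw [symb_two]
  simp [mul_pow]
  ring

lemma norm_symb (T : Bool) (h : ℝ) (i : Fin 3) (ξ : ModeIdx) :
    ‖symb T h i ξ‖ = ‖symb true h i ξ‖ := by
  refine Fin.lastCases ?_ (fun j => ?_) i
  · change ‖symb T h 2 ξ‖ = ‖symb true h 2 ξ‖
    cases T <;> simp [symb_two]
  · rw [symb_castSucc, symb_castSucc]

lemma norm_symb_sq_le (T : Bool) (h : ℝ) (i : Fin 3) (ξ : ModeIdx) :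
    ‖symb T h i ξ‖ ^ 2 ≤ eigΩ h ξ := by
  rw [norm_symb]
  exact Finset.single_le_sum (f := fun i => ‖symb true h i ξ‖ ^ 2)
    (fun _ _ => sq_nonneg _) (Finset.mem_univ i)

lemma eigΩ_nonneg (h : ℝ) (ξ : ModeIdx) : 0 ≤ eigΩ h ξ :=
  Finset.sum_nonneg fun _ _ => sq_nonneg _

/-- `∂ᵢ∂ᵢ` acts on a sine mode as multiplication by `-|symb|²`. -/
lemma symb_mul_symb (h : ℝ) (i : Fin 3) (ξ : ModeIdx) :
    symb (flipZ true i) h i ξ * symb true h i ξ = -((‖symb true h i ξ‖ ^ 2 : ℝ) : ℂ) := by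
  refine Fin.lastCases ?_ (fun j => ?_) i
  · change symb false h 2 ξ * symb true h 2 ξ = -((‖symb true h 2 ξ‖ ^ 2 : ℝ) : ℂ)
    simp [symb_two]
    ring
  · rw [flipZ_castSucc, symb_castSucc]
    simp only [norm_mul, Complex.norm_ofNat, Complex.norm_real, Complex.norm_I, Real.norm_eq_abs,
      abs_of_pos Real.pi_pos, Complex.norm_intCast, mul_pow, sq_abs, one_pow]
    push_cast
    linear_combination (2 * Real.pi * ξ.1 j) ^ 2 * Complex.I_sq

lemma flipZ_flipZ (T : Bool) (i : Fin 3) : flipZ (flipZ T i) i = T := by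
  unfold flipZ; split_ifs <;> simp

/-- `-conj (symb (flip T))` is `symb T`: the symbol of `∂ᵢ` is skew. -/
lemma neg_conj_symb (T : Bool) (h : ℝ) (i : Fin 3) (ξ : ModeIdx) :
    -conj (symb T h i ξ) = symb (flipZ T i) h i ξ := by
  refine Fin.lastCases ?_ (fun j => ?_) i
  · change -conj (symb T h 2 ξ) = symb (!T) h 2 ξ
    cases T <;> simp [symb_two]
  · rw [flipZ_castSucc, symb_castSucc]
    simp only [map_mul, Complex.conj_ofReal, Complex.conj_I, Complex.conj_ofNat, map_intCast]
    ring

/-- The normalised mode in `L²(Ω)`. -/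
def eΩ (T : Bool) (h : ℝ) (ξ : ModeIdx) : L2Ω h :=
  boxLp (loΩ h) hiΩ (contDiff_modeΩ T h ξ).continuous

lemma inner_eΩ (T : Bool) (h : ℝ) (ξ : ModeIdx) (f : L2Ω h) :
    inner ℂ (eΩ T h ξ) f = ∫ x in openBox (loΩ h) hiΩ, f x * conj (modeΩ T h ξ x) :=
  inner_boxLp _ f

lemma orthonormal_eΩ (T : Bool) {h : ℝ} (hh : 0 < h) : Orthonormal ℂ (eΩ T h) := by
  rw [orthonormal_iff_ite]
  rintro ⟨k, n⟩ ⟨l, m⟩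
  rw [inner_eΩ, eΩ, integral_boxLp_mul]
  have e : ∀ x, modeΩ T h (l, m) x * conj (modeΩ T h (k, n) x)
      = tens (expG (l - k)) (fun z => trigZ T h m z * trigZ T h n z) x := by
    intro x
    simp only [modeΩ, tens, map_mul, conj_trigZ, conj_expG, sub_eq_add_neg, ← expG_mul]
    ring
  simp only [e]
  rw [integral_tens, integral_expG, integral_trigZ_mul T hh]
  simp only [sub_eq_zero, Prod.mk.injEq, eq_comm (a := k), eq_comm (a := n)]
  split_ifs <;> simp_all

lemma mem_openBox_Ω {h : ℝ} {x : Fin 3 → ℝ} (hx : x ∈ openBox (loΩ h) hiΩ) :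
    (∀ j, horiz x j ∈ Ioo (0 : ℝ) 1) ∧ x 2 ∈ Ioo (-h) 0 := by
  refine ⟨fun j => ?_, hx 2 trivial⟩
  rw [horiz_apply]
  have := hx j.castSucc trivial
  fin_cases j <;> exact this

/-- Completeness of the sine modes: multiplied by `sin (θ / 2)`, `θ = π (z + h) / h`, a function
orthogonal to all of them annihilates `e^{2πi k·(x,y)} cosᵐ θ`. -/
lemma eq_zero_of_inner_eΩ {h : ℝ} (hh : 0 < h) {f : L2Ω h}
    (H : ∀ ξ, inner ℂ (eΩ true h ξ) f = 0) : f = 0 := by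
  rw [Lp.eq_zero_iff_ae_eq_zero]
  let cz : ℝ → ℂ := fun z => ((Real.cos (Real.pi / h * (z + h)) : ℝ) : ℂ)
  have hcz : ContDiff ℝ ∞ cz := Complex.ofRealCLM.contDiff.comp
    (Real.contDiff_cos.comp (contDiff_const.mul (contDiff_id.add contDiff_const)))
  let Gm : (Fin 2 → ℤ) → ℕ → (Fin 3 → ℝ) → ℂ := fun k m => tens (expG k) fun z => cz z ^ m
  have hGm : ∀ k m, ContDiff ℝ ∞ (Gm k m) := fun k m => contDiff_tens (contDiff_expG k) (hcz.pow m)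
  let S : Submonoid ((Fin 3 → ℝ) → ℂ) :=
    { carrier := {G | ∃ k m, G = Gm k m}
      one_mem' := ⟨0, 0, by funext x; simp [Gm, tens, expG_zero]⟩
      mul_mem' := by
        rintro _ _ ⟨k, m, rfl⟩ ⟨k', m', rfl⟩
        refine ⟨k + k', m + m', funext fun x => ?_⟩
        simp only [Gm, tens, Pi.mul_apply, ← expG_mul, pow_add]
        ring }
  -- `2 cos θ sin ((n + 1/2) θ) = sin ((n + 3/2) θ) + sin ((n - 1/2) θ)`
  have rec0 : ∀ z,
      cz z * trigZ true h 0 z = (1 / 2 : ℂ) * (trigZ true h 1 z - trigZ true h 0 z) := by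
    intro z
    have e1 : freqZ h 1 * (z + h) = freqZ h 0 * (z + h) + Real.pi / h * (z + h) := by
      simp only [freqZ]; push_cast; ring
    have e2 : freqZ h 0 * (z + h) = Real.pi / h * (z + h) - freqZ h 0 * (z + h) := by
      simp only [freqZ]; push_cast; ring
    have e3 : Real.sin (freqZ h 0 * (z + h)) = Real.sin (Real.pi / h * (z + h))
        * Real.cos (freqZ h 0 * (z + h)) - Real.cos (Real.pi / h * (z + h))
        * Real.sin (freqZ h 0 * (z + h)) := by
      rw [← Real.sin_sub, ← e2]
    simp only [cz, trigZ, if_true]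
    rw [e1, Real.sin_add]
    norm_cast
    push_cast
    have e4 : (Real.sin (freqZ h 0 * (z + h)) : ℂ) = Real.sin (Real.pi / h * (z + h))
        * Real.cos (freqZ h 0 * (z + h)) - Real.cos (Real.pi / h * (z + h))
        * Real.sin (freqZ h 0 * (z + h)) := by exact_mod_cast e3
    push_cast at e4
    linear_combination (1 / 2 * Real.sqrt (2 / h) : ℂ) * e4
  have rec1 : ∀ n z, cz z * trigZ true h (n + 1) z
      = (1 / 2 : ℂ) * (trigZ true h (n + 2) z + trigZ true h n z) := by
    intro n z
    have e1 : freqZ h (n + 2) * (z + h) = freqZ h (n + 1) * (z + h) + Real.pi / h * (z + h) := by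
      simp only [freqZ]; push_cast; ring
    have e2 : freqZ h n * (z + h) = freqZ h (n + 1) * (z + h) - Real.pi / h * (z + h) := by
      simp only [freqZ]; push_cast; ring
    simp only [cz, trigZ, if_true]
    rw [e1, e2, Real.sin_add, Real.sin_sub]
    push_cast
    ring
  have hint : ∀ {η : (Fin 3 → ℝ) → ℂ}, Continuous η →
      Integrable (fun x => f x * η x) (volume.restrict (openBox (loΩ h) hiΩ)) := fun hη =>
    integrable_L2_mul f (hη.memLp_openBox _ _ 2)
  have hW : ∀ k m n, Continuous (tens (expG k) fun z => cz z ^ m * trigZ true h n z) := fun k m n =>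
    (contDiff_tens (contDiff_expG k) ((hcz.pow m).mul (contDiff_trigZ true h n))).continuous
  have key : ∀ (k : Fin 2 → ℤ) (m n : ℕ), ∫ x in openBox (loΩ h) hiΩ,
      f x * tens (expG k) (fun z => cz z ^ m * trigZ true h n z) x = 0 := by
    intro k m
    induction m with
    | zero =>
      intro n
      have := H (-k, n)
      rw [inner_eΩ] at this
      simpa [modeΩ, tens, conj_trigZ, conj_expG] using this
    | succ m ih =>
      intro n
      have hz : ∀ (g : ℝ → ℂ) x, f x * tens (expG k) g x = f x * (expG k (horiz x) * g (x 2)) :=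
        fun g x => rfl
      cases n with
      | zero =>
        have e : ∀ x, f x * tens (expG k) (fun z => cz z ^ (m + 1) * trigZ true h 0 z) x
            = (1 / 2 : ℂ) * (f x * tens (expG k) (fun z => cz z ^ m * trigZ true h 1 z) x
              - f x * tens (expG k) (fun z => cz z ^ m * trigZ true h 0 z) x) := by
          intro x
          simp only [hz, pow_succ]
          linear_combination (f x * expG k (horiz x) * cz (x 2) ^ m) * rec0 (x 2)
        simp only [e]
        rw [integral_const_mul, integral_sub (hint (hW _ _ _)) (hint (hW _ _ _)), ih, ih, sub_zero,
          mul_zero]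
      | succ n =>
        have e : ∀ x, f x * tens (expG k) (fun z => cz z ^ (m + 1) * trigZ true h (n + 1) z) x
            = (1 / 2 : ℂ) * (f x * tens (expG k) (fun z => cz z ^ m * trigZ true h (n + 2) z) x
              + f x * tens (expG k) (fun z => cz z ^ m * trigZ true h n z) x) := by
          intro x
          simp only [hz, pow_succ]
          linear_combination (f x * expG k (horiz x) * cz (x 2) ^ m) * rec1 n (x 2)
        simp only [e]
        rw [integral_const_mul, integral_add (hint (hW _ _ _)) (hint (hW _ _ _)), ih, ih, add_zero,
          mul_zero]
  have hs0 : Continuous fun x : Fin 3 → ℝ => trigZ true h 0 (x 2) :=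
    (contDiff_trigZ true h 0).continuous.comp (continuous_apply 2)
  have hzero := ae_eq_zero_of_forall_integral_mul_eq_zero (a := loΩ h) (b := hiΩ)
    (f := fun x => f x * trigZ true h 0 (x 2)) S ?_ ?_ ?_ (hint hs0) ?_
  · filter_upwards [hzero, ae_restrict_mem (measurableSet_openBox _ _)] with x hx hmem
    refine (mul_eq_zero.1 hx).resolve_right ?_
    obtain ⟨-, hz1, hz2⟩ := mem_openBox_Ω hmem
    have hpos : 0 < Real.sin (freqZ h 0 * (x 2 + h)) := by
      have h1 : 0 < x 2 + h := by linarith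
      have h2 := freqZ_pos hh 0
      refine Real.sin_pos_of_pos_of_lt_pi (mul_pos h2 h1) ?_
      have h3 : freqZ h 0 * (x 2 + h) < freqZ h 0 * h := by
        refine mul_lt_mul_of_pos_left ?_ h2
        linarith
      have h4 := freqZ_mul hh 0
      have := Real.pi_pos
      simp only [Nat.cast_zero, zero_mul, zero_add] at h4
      linarith
    have hsq : 0 < Real.sqrt (2 / h) := Real.sqrt_pos.2 (by positivity)
    simp only [trigZ, if_true]
    exact_mod_cast (mul_pos hsq hpos).ne'
  · rintro _ ⟨k, m, rfl⟩; exact (hGm k m).continuous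
  · rintro _ ⟨k, m, rfl⟩
    refine ⟨-k, m, funext fun x => ?_⟩
    simp only [Gm, tens, map_mul, conj_expG, map_pow, cz, Complex.conj_ofReal]
  · intro x hx y hy hxy
    obtain ⟨hx1, hx2⟩ := mem_openBox_Ω hx
    obtain ⟨hy1, hy2⟩ := mem_openBox_Ω hy
    by_cases hH : horiz x = horiz y
    · have h2 : x 2 ≠ y 2 := by
        intro h2
        refine hxy (funext fun i => Fin.lastCases h2 (fun j => ?_) i)
        rw [← horiz_apply x, ← horiz_apply y, hH]
      refine ⟨Gm 0 1, ⟨0, 1, rfl⟩, fun he => h2 ?_⟩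
      simp only [Gm, tens, expG_zero, one_mul, pow_one, cz] at he
      have he' : Real.cos (Real.pi / h * (x 2 + h)) = Real.cos (Real.pi / h * (y 2 + h)) := by
        exact_mod_cast he
      have hp : 0 < Real.pi / h := div_pos Real.pi_pos hh
      have hmem : ∀ t ∈ Ioo (-h) 0, Real.pi / h * (t + h) ∈ Icc 0 Real.pi := by
        intro t ht
        refine ⟨mul_nonneg hp.le (by linarith [ht.1]), ?_⟩
        have h5 : Real.pi / h * (t + h) ≤ Real.pi / h * h :=
          mul_le_mul_of_nonneg_left (by linarith [ht.2]) hp.le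
        rwa [div_mul_cancel₀ _ hh.ne'] at h5
      have h6 := Real.injOn_cos (hmem _ hx2) (hmem _ hy2) he'
      have h7 := mul_left_cancel₀ hp.ne' h6
      linarith
    · obtain ⟨k, hk⟩ := exists_expG_ne hx1 hy1 hH
      exact ⟨Gm k 0, ⟨k, 0, rfl⟩, by simpa [Gm, tens] using hk⟩
  · rintro _ ⟨k, m, rfl⟩
    refine Eq.trans (integral_congr_ae (Eventually.of_forall fun x => ?_)) (key k m 0)
    simp only [Gm, tens]
    ring

/-- The orthonormal basis of `L²(Ω)` formed by the sine modes. -/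
def basisΩ {h : ℝ} (hh : 0 < h) : HilbertBasis ModeIdx ℂ (L2Ω h) :=
  HilbertBasis.mkOfOrthogonalEqBot (orthonormal_eΩ true hh) (by
    rw [Submodule.eq_bot_iff]
    intro f hf
    refine eq_zero_of_inner_eΩ hh fun k => ?_
    exact (Submodule.mem_orthogonal _ _).1 hf _ (Submodule.subset_span ⟨k, rfl⟩))

lemma coe_basisΩ {h : ℝ} (hh : 0 < h) (ξ : ModeIdx) : basisΩ hh ξ = eΩ true h ξ := by
  simp [basisΩ]

/-! ### Orthonormal series of smooth functions -/

section OrthonormalSeries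

open scoped InnerProductSpace

variable {ι H : Type*} [NormedAddCommGroup H] [InnerProductSpace ℂ H] {v : ι → H}
  {c : ι → ℂ} {f : H}

lemma Orthonormal.summable_smul [CompleteSpace H] (hv : Orthonormal ℂ v)
    (hc : Summable fun i => ‖c i‖ ^ 2) : Summable fun i => c i • v i :=
  (hv.orthogonalFamily.summable_iff_norm_sq_summable c).2 hc

lemma Orthonormal.inner_of_hasSum (hv : Orthonormal ℂ v) (hf : HasSum (fun i => c i • v i) f)
    (i : ι) : ⟪v i, f⟫_ℂ = c i := by
  classical
  have h1 := hf.mapL (innerSL ℂ (v i))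
  have h2 : HasSum (fun j => innerSL ℂ (v i) (c j • v j)) (c i) := by
    convert hasSum_ite_eq i (c i) using 2 with j
    rw [innerSL_apply_apply, inner_smul_right, (orthonormal_iff_ite.1 hv) i j]
    by_cases h : j = i
    · subst h; simp
    · simp [h, Ne.symm h]
  exact h1.unique h2

lemma Orthonormal.hasSum_norm_sq (hv : Orthonormal ℂ v) (hf : HasSum (fun i => c i • v i) f) :
    HasSum (fun i => ‖c i‖ ^ 2) (‖f‖ ^ 2) := by
  have h1 := hf.mapL (innerSL ℂ f)
  have h2 : ∀ i, innerSL ℂ f (c i • v i) = ((‖c i‖ ^ 2 : ℝ) : ℂ) := fun i => by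
    rw [innerSL_apply_apply, inner_smul_right, ← inner_conj_symm, hv.inner_of_hasSum hf,
      Complex.mul_conj']
    push_cast
    rfl
  have h3 : innerSL ℂ f f = ((‖f‖ ^ 2 : ℝ) : ℂ) := by
    rw [innerSL_apply_apply, inner_self_eq_norm_sq_to_K]
    norm_cast
  simp only [h2, h3] at h1
  exact_mod_cast h1

end OrthonormalSeries

section SmoothSeries

variable {n : ℕ} {a b : Fin (n + 1) → ℝ} {ι : Type*}
  {e : ι → (Fin (n + 1) → ℝ) → ℂ} {c : ι → ℂ} {f : L2Box a b} {g : Fin (n + 1) → L2Box a b}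

lemma contDiff_sum_mul {d : ℕ} {e : ι → (Fin d → ℝ) → ℂ} (he : ∀ ξ, ContDiff ℝ ∞ (e ξ))
    (s : Finset ι) : ContDiff ℝ ∞ fun x => ∑ ξ ∈ s, c ξ * e ξ x :=
  ContDiff.sum fun ξ _ => contDiff_const.mul (he ξ)

lemma boxLp_sum_mul {d : ℕ} {a b : Fin d → ℝ} {ι : Type*} {e : ι → (Fin d → ℝ) → ℂ} {c : ι → ℂ}
    (he : ∀ ξ, Continuous (e ξ)) (s : Finset ι) :
    boxLp a b (F := fun x => ∑ ξ ∈ s, c ξ * e ξ x)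
      (continuous_finsetSum _ fun ξ _ => continuous_const.mul (he ξ))
      = ∑ ξ ∈ s, c ξ • boxLp a b (he ξ) := by
  classical
  induction s using Finset.induction_on with
  | empty =>
    rw [Finset.sum_empty, Lp.eq_zero_iff_ae_eq_zero]
    refine (coeFn_boxLp _).trans ?_
    exact Eventually.of_forall fun x => by simp
  | insert ξ s hξ ih =>
    rw [Finset.sum_insert hξ, ← ih]
    ext1
    filter_upwards [coeFn_boxLp (a := a) (b := b) (F := fun x => ∑ ξ ∈ insert ξ s, c ξ * e ξ x)
        (continuous_finsetSum _ fun ξ _ => continuous_const.mul (he ξ)),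
      coeFn_boxLp (a := a) (b := b) (F := fun x => ∑ ξ ∈ s, c ξ * e ξ x)
        (continuous_finsetSum _ fun ξ _ => continuous_const.mul (he ξ)),
      coeFn_boxLp (a := a) (b := b) (he ξ),
      Lp.coeFn_add (c ξ • boxLp a b (he ξ)) (boxLp a b (F := fun x => ∑ ξ ∈ s, c ξ * e ξ x)
        (continuous_finsetSum _ fun ξ _ => continuous_const.mul (he ξ))),
      Lp.coeFn_smul (c ξ) (boxLp a b (he ξ))] with x h1 h2 h3 h4 h5
    rw [h1, h4, Pi.add_apply, h2, h5, Pi.smul_apply, h3, Finset.sum_insert hξ, smul_eq_mul]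

lemma pderiv_sum_mul {d : ℕ} {ι : Type*} {e : ι → (Fin d → ℝ) → ℂ} {c : ι → ℂ}
    (he : ∀ ξ, ContDiff ℝ ∞ (e ξ)) (s : Finset ι) (i : Fin d) (x : Fin d → ℝ) :
    pderiv i (fun x => ∑ ξ ∈ s, c ξ * e ξ x) x = ∑ ξ ∈ s, c ξ * pderiv i (e ξ) x := by
  have h1 : HasFDerivAt (fun x => ∑ ξ ∈ s, c ξ * e ξ x) (∑ ξ ∈ s, c ξ • fderiv ℝ (e ξ) x) x :=
    HasFDerivAt.fun_sum fun ξ _ => ((he ξ).differentiable (by simp) x).hasFDerivAt.const_mul (c ξ)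
  simp [pderiv, h1.fderiv, sum_apply]

/-- A series of smooth functions which converges in `L²` together with its first derivatives is the
limit in `H¹` of a sequence of smooth functions, its partial sums. -/
lemma exists_seq_tendsto_of_hasSum [Countable ι] (he : ∀ ξ, ContDiff ℝ ∞ (e ξ))
    (hf : HasSum (fun ξ => c ξ • boxLp a b (he ξ).continuous) f)
    (hg : ∀ i, HasSum (fun ξ => c ξ • boxLp a b (continuous_pderiv (he ξ) i)) (g i)) :
    ∃ s : ℕ → Finset ι,
      Tendsto (fun k => boxLp a b (contDiff_sum_mul (c := c) he (s k)).continuous) atTop (𝓝 f) ∧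
      ∀ i, Tendsto (fun k => boxLp a b (continuous_pderiv (contDiff_sum_mul (c := c) he (s k)) i))
        atTop (𝓝 (g i)) := by
  obtain ⟨s, hs⟩ := (atTop : Filter (Finset ι)).exists_seq_tendsto
  refine ⟨s, ?_, fun i => ?_⟩
  · refine (hf.comp hs).congr fun k => ?_
    exact (boxLp_sum_mul (fun ξ => (he ξ).continuous) (s k)).symm
  · refine ((hg i).comp hs).congr fun k => ?_
    rw [Function.comp_apply, ← boxLp_sum_mul fun ξ => continuous_pderiv (he ξ) i]
    exact boxLp_congr _ _ fun x => (pderiv_sum_mul he (s k) i x).symm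

lemma hasWeakDeriv_of_hasSum [Countable ι] (hab : ∀ i, a i < b i) (he : ∀ ξ, ContDiff ℝ ∞ (e ξ))
    (hf : HasSum (fun ξ => c ξ • boxLp a b (he ξ).continuous) f)
    (hg : ∀ i, HasSum (fun ξ => c ξ • boxLp a b (continuous_pderiv (he ξ) i)) (g i))
    (i : Fin (n + 1)) : HasWeakDeriv i f (g i) := by
  obtain ⟨s, h1, h2⟩ := exists_seq_tendsto_of_hasSum he hf hg
  exact hasWeakDeriv_of_tendsto_boxLp hab (fun k => contDiff_sum_mul (c := c) he (s k)) h1 (h2 i)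

lemma periodicTrace_of_hasSum [Countable ι] (hab : ∀ i, a i < b i) (he : ∀ ξ, ContDiff ℝ ∞ (e ξ))
    (hf : HasSum (fun ξ => c ξ • boxLp a b (he ξ).continuous) f)
    (hg : ∀ i, HasSum (fun ξ => c ξ • boxLp a b (continuous_pderiv (he ξ) i)) (g i))
    {i : Fin (n + 1)} (hper : ∀ ξ y, e ξ (i.insertNth (a i) y) = e ξ (i.insertNth (b i) y)) :
    PeriodicTrace i f := by
  obtain ⟨s, h1, h2⟩ := exists_seq_tendsto_of_hasSum he hf hg
  exact periodicTrace_of_tendsto_boxLp hab (fun k => contDiff_sum_mul (c := c) he (s k)) h1 h2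
    fun k y => by simp only [hper]

lemma hasTrace_zero_of_hasSum [Countable ι] (hab : ∀ i, a i < b i) (he : ∀ ξ, ContDiff ℝ ∞ (e ξ))
    (hf : HasSum (fun ξ => c ξ • boxLp a b (he ξ).continuous) f)
    (hg : ∀ i, HasSum (fun ξ => c ξ • boxLp a b (continuous_pderiv (he ξ) i)) (g i))
    {i : Fin (n + 1)} {t : ℝ} (h0 : ∀ ξ y, e ξ (i.insertNth t y) = 0) : HasTrace i t f 0 := by
  obtain ⟨s, h1, h2⟩ := exists_seq_tendsto_of_hasSum he hf hg
  exact hasTrace_zero_of_tendsto_boxLp hab (fun k => contDiff_sum_mul (c := c) he (s k)) h1 h2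
    fun k y => by simp [h0]

end SmoothSeries

/-! ### Sobolev spaces in terms of Fourier coefficients -/

/-- The boundary conditions satisfied by the sine modes (`T = true`) and the cosine modes
(`T = false`): periodicity in the horizontal directions and a homogeneous Dirichlet condition on
`z = -h`, respectively on `z = 0`. -/
def ModeBC {h : ℝ} (T : Bool) (f : L2Ω h) : Prop :=
  PeriodicTrace 0 f ∧ PeriodicTrace 1 f ∧ HasTrace 2 (if T then -h else 0) f 0

lemma ModeBC.periodicTrace {h : ℝ} {T : Bool} {f : L2Ω h} (hf : ModeBC T f) (j : Fin 2) :
    PeriodicTrace j.castSucc f := by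
  fin_cases j
  · exact hf.1
  · exact hf.2.1

lemma horiz_insertNth_castSucc (j : Fin 2) (c : ℝ) (y : Fin 2 → ℝ) :
    horiz (j.castSucc.insertNth c y) = j.insertNth c (fun _ => y 0) ∧
      (j.castSucc.insertNth c y : Fin 3 → ℝ) 2 = y 1 := by
  fin_cases j
  · refine ⟨funext fun i => ?_, rfl⟩
    fin_cases i <;> rfl
  · refine ⟨funext fun i => ?_, rfl⟩
    fin_cases i <;> rfl

lemma modeΩ_insertNth_castSucc (T : Bool) (h : ℝ) (ξ : ModeIdx) (j : Fin 2) (y : Fin 2 → ℝ) :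
    modeΩ T h ξ (j.castSucc.insertNth (loΩ h j.castSucc) y)
      = modeΩ T h ξ (j.castSucc.insertNth (hiΩ j.castSucc) y) := by
  have e1 : loΩ h j.castSucc = loG j := by fin_cases j <;> rfl
  have e2 : hiΩ j.castSucc = hiG j := by fin_cases j <;> rfl
  rw [e1, e2, modeΩ, tens, tens, (horiz_insertNth_castSucc j _ y).1,
    (horiz_insertNth_castSucc j _ y).1, (horiz_insertNth_castSucc j _ y).2,
    (horiz_insertNth_castSucc j _ y).2, expG_insertNth]

lemma modeΩ_insertNth_two (T : Bool) {h : ℝ} (hh : 0 < h) (ξ : ModeIdx) (y : Fin 2 → ℝ) :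
    modeΩ T h ξ ((2 : Fin 3).insertNth (if T then -h else 0) y) = 0 := by
  rw [modeΩ, tens, Fin.insertNth_apply_same]
  cases T
  · simp [trigZ_false_top hh]
  · simp [trigZ_true_bot]

/-- The Fourier coefficients of a weak derivative. -/
lemma ModeBC.inner_weakDeriv {h : ℝ} (hh : 0 < h) {T : Bool} {f : L2Ω h} (i : Fin 3)
    (hf : (i = 2 → HasTrace 2 (if T then -h else 0) f 0) ∧
      ∀ j : Fin 2, i = j.castSucc → PeriodicTrace i f) (ξ : ModeIdx) :
    inner ℂ (eΩ (flipZ T i) h ξ) (weakDeriv i f) = symb T h i ξ * inner ℂ (eΩ T h ξ) f := by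
  have hη := contDiff_conj (contDiff_modeΩ (flipZ T i) h ξ)
  have hibp : ∫ x in openBox (loΩ h) hiΩ, weakDeriv i f x * conj (modeΩ (flipZ T i) h ξ x)
      = -∫ x in openBox (loΩ h) hiΩ,
        f x * pderiv i (fun x => conj (modeΩ (flipZ T i) h ξ x)) x := by
    revert hf hη
    refine Fin.lastCases ?_ (fun j => ?_) i
    · intro hf hη
      refine (hf.1 rfl).integral_weakDeriv_mul (loΩ_lt_hiΩ hh)
        (c' := if flipZ T 2 then -h else 0) ?_ hη fun y => ?_
      · cases T
        · exact Or.inr ⟨rfl, rfl⟩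
        · exact Or.inl ⟨rfl, rfl⟩
      · change conj (modeΩ (flipZ T 2) h ξ
          ((2 : Fin 3).insertNth (if flipZ T 2 then -h else 0) y)) = 0
        rw [modeΩ_insertNth_two _ hh, map_zero]
    · intro hf hη
      refine (hf.2 j rfl).integral_weakDeriv_mul (loΩ_lt_hiΩ hh) hη fun y => ?_
      rw [modeΩ_insertNth_castSucc]
  rw [inner_eΩ, inner_eΩ, hibp, ← integral_neg, ← integral_const_mul]
  refine integral_congr_ae (Eventually.of_forall fun x => ?_)
  simp only []
  rw [pderiv_conj (contDiff_modeΩ _ _ _), pderiv_modeΩ, flipZ_flipZ, map_mul]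
  have := neg_conj_symb (flipZ T i) h i ξ
  rw [flipZ_flipZ] at this
  rw [← this]
  ring

lemma boxLp_pderiv_modeΩ (T : Bool) (h : ℝ) (i : Fin 3) (ξ : ModeIdx) :
    boxLp (loΩ h) hiΩ (continuous_pderiv (contDiff_modeΩ T h ξ) i)
      = symb T h i ξ • eΩ (flipZ T i) h ξ := by
  ext1
  filter_upwards [coeFn_boxLp (a := loΩ h) (b := hiΩ) (continuous_pderiv (contDiff_modeΩ T h ξ) i),
    coeFn_boxLp (a := loΩ h) (b := hiΩ) (contDiff_modeΩ (flipZ T i) h ξ).continuous,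
    Lp.coeFn_smul (symb T h i ξ) (eΩ (flipZ T i) h ξ)] with x h1 h2 h3
  rw [h1, h3, pderiv_modeΩ, Pi.smul_apply, smul_eq_mul, eΩ, h2]

/-- A series of modes with sufficiently decaying coefficients belongs to `H¹`, may be differentiated
term by term and satisfies the boundary conditions of the modes. -/
lemma modeBC_of_hasSum {h : ℝ} (hh : 0 < h) {T : Bool} {c : ModeIdx → ℂ} {f : L2Ω h}
    (hf : HasSum (fun ξ => c ξ • eΩ T h ξ) f) (hc : Summable fun ξ => eigΩ h ξ * ‖c ξ‖ ^ 2) :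
    MemH1 f ∧ ModeBC T f ∧
      ∀ i, HasSum (fun ξ => (symb T h i ξ * c ξ) • eΩ (flipZ T i) h ξ) (weakDeriv i f) := by
  have hs : ∀ i, Summable fun ξ => (symb T h i ξ * c ξ) • eΩ (flipZ T i) h ξ := fun i =>
    (orthonormal_eΩ (flipZ T i) hh).summable_smul <| by
      refine Summable.of_nonneg_of_le (fun _ => sq_nonneg _) (fun ξ => ?_) hc
      rw [norm_mul, mul_pow]
      exact mul_le_mul_of_nonneg_right (norm_symb_sq_le T h i ξ) (sq_nonneg _)
  choose g hg using hs
  have hg' : ∀ i, HasSum (fun ξ => c ξ • boxLp (loΩ h) hiΩ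
      (continuous_pderiv (contDiff_modeΩ T h ξ) i)) (g i) := fun i => by
    refine (hg i).congr_fun fun ξ => ?_
    rw [boxLp_pderiv_modeΩ, smul_smul, mul_comm]
  have hd := hasWeakDeriv_of_hasSum (loΩ_lt_hiΩ hh) (contDiff_modeΩ T h) hf hg'
  refine ⟨fun i => ⟨_, hd i⟩, ⟨?_, ?_, ?_⟩, fun i => ?_⟩
  · exact periodicTrace_of_hasSum (loΩ_lt_hiΩ hh) (contDiff_modeΩ T h) hf hg' fun ξ y =>
      modeΩ_insertNth_castSucc T h ξ 0 y
  · exact periodicTrace_of_hasSum (loΩ_lt_hiΩ hh) (contDiff_modeΩ T h) hf hg' fun ξ y =>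
      modeΩ_insertNth_castSucc T h ξ 1 y
  · exact hasTrace_zero_of_hasSum (loΩ_lt_hiΩ hh) (contDiff_modeΩ T h) hf hg' fun ξ y =>
      modeΩ_insertNth_two T hh ξ y
  · rw [(hd i).eq]
    exact hg i

lemma hasSum_basisΩ {h : ℝ} (hh : 0 < h) (f : L2Ω h) :
    HasSum (fun ξ => (inner ℂ (eΩ true h ξ) f : ℂ) • eΩ true h ξ) f := by
  have := (basisΩ hh).hasSum_repr f
  simpa only [HilbertBasis.repr_apply_apply, coe_basisΩ] using this

lemma hasSum_norm_sq_inner_eΩ {h : ℝ} (hh : 0 < h) (f : L2Ω h) :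
    HasSum (fun ξ => ‖(inner ℂ (eΩ true h ξ) f : ℂ)‖ ^ 2) (‖f‖ ^ 2) :=
  (orthonormal_eΩ true hh).hasSum_norm_sq (hasSum_basisΩ hh f)

/-- `H¹_per(Ω)` with zero trace on `Γ_b` in terms of Fourier coefficients. -/
lemma memH1perΩ_iff_summable {h : ℝ} (hh : 0 < h) (f : L2Ω h) :
    (MemH1perΩ f ∧ HasTrace 2 (-h) f 0) ↔
      Summable fun ξ => eigΩ h ξ * ‖(inner ℂ (eΩ true h ξ) f : ℂ)‖ ^ 2 := by
  constructor
  · rintro ⟨⟨-, h1, h2⟩, h3⟩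
    have hbc : ModeBC true f := ⟨h1, h2, h3⟩
    have hs : Summable fun ξ => ∑ i, ‖(inner ℂ (eΩ (flipZ true i) h ξ) (weakDeriv i f) : ℂ)‖ ^ 2 :=
      summable_sum fun i _ => (orthonormal_eΩ (flipZ true i) hh).inner_products_summable _
    refine hs.congr fun ξ => ?_
    rw [eigΩ, Finset.sum_mul]
    refine Finset.sum_congr rfl fun i _ => ?_
    rw [ModeBC.inner_weakDeriv hh (T := true) i
      ⟨fun _ => hbc.2.2, fun j hj => hj ▸ hbc.periodicTrace j⟩, norm_mul, mul_pow]
  · intro hs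
    obtain ⟨h1, h2, -⟩ := modeBC_of_hasSum hh (hasSum_basisΩ hh f) hs
    exact ⟨⟨h1, h2.1, h2.2.1⟩, h2.2.2⟩

/-- The norm of the gradient in terms of Fourier coefficients. -/
lemma hasSum_norm_sq_weakDeriv {h : ℝ} (hh : 0 < h) {f : L2Ω h}
    (hf : Summable fun ξ => eigΩ h ξ * ‖(inner ℂ (eΩ true h ξ) f : ℂ)‖ ^ 2) :
    HasSum (fun ξ => eigΩ h ξ * ‖(inner ℂ (eΩ true h ξ) f : ℂ)‖ ^ 2)
      (∑ i, ‖weakDeriv i f‖ ^ 2) := by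
  obtain ⟨-, -, h3⟩ := modeBC_of_hasSum hh (hasSum_basisΩ hh f) hf
  have h4 := hasSum_sum fun i (_ : i ∈ Finset.univ) =>
    (orthonormal_eΩ (flipZ true i) hh).hasSum_norm_sq (h3 i)
  refine h4.congr_fun fun ξ => ?_
  rw [eigΩ, Finset.sum_mul]
  exact Finset.sum_congr rfl fun i _ => by rw [norm_mul, mul_pow]

/-- The scalar regularity and boundary conditions entering `D(A₂)`. -/
def MemDomScalar {h : ℝ} (f : L2Ω h) : Prop :=
  MemH2perΩ f ∧ HasTrace 2 0 (weakDeriv 2 f) 0 ∧ HasTrace 2 (-h) f 0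

/-- The Fourier coefficients of the Laplacian. -/
lemma MemDomScalar.inner_laplacian {h : ℝ} (hh : 0 < h) {f : L2Ω h} (hf : MemDomScalar f)
    (ξ : ModeIdx) : inner ℂ (eΩ true h ξ) (∑ i : Fin 3, weakDeriv i (weakDeriv i f))
      = -(eigΩ h ξ : ℂ) * inner ℂ (eΩ true h ξ) f := by
  obtain ⟨⟨-, p0, p1, q0, q1⟩, ht, hb⟩ := hf
  have hbc : ModeBC true f := ⟨p0, p1, hb⟩
  have key : ∀ i, inner ℂ (eΩ true h ξ) (weakDeriv i (weakDeriv i f))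
      = -((‖symb true h i ξ‖ ^ 2 : ℝ) : ℂ) * inner ℂ (eΩ true h ξ) f := by
    intro i
    have h1 := ModeBC.inner_weakDeriv hh (T := true) (f := f) i
      ⟨fun _ => hbc.2.2, fun j hj => hj ▸ hbc.periodicTrace j⟩ ξ
    have h2 := ModeBC.inner_weakDeriv hh (T := flipZ true i) (f := weakDeriv i f) i
      ⟨fun hi => by subst hi; exact ht, fun j hj => by
        subst hj
        fin_cases j
        · exact q0
        · exact q1⟩ ξ
    rw [flipZ_flipZ] at h2
    rw [h2, h1, ← mul_assoc, symb_mul_symb]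
  rw [inner_sum, Finset.sum_congr rfl fun i _ => key i, ← Finset.sum_mul, Finset.sum_neg_distrib,
    eigΩ]
  push_cast
  rfl

lemma memDomScalar_iff_summable {h : ℝ} (hh : 0 < h) (f : L2Ω h) :
    MemDomScalar f ↔ Summable fun ξ => eigΩ h ξ ^ 2 * ‖(inner ℂ (eΩ true h ξ) f : ℂ)‖ ^ 2 := by
  constructor
  · intro hf
    have hs := (orthonormal_eΩ true hh).inner_products_summable
      (∑ i : Fin 3, weakDeriv i (weakDeriv i f))
    refine hs.congr fun ξ => ?_
    rw [hf.inner_laplacian hh, norm_mul, norm_neg, Complex.norm_real,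
      Real.norm_of_nonneg (eigΩ_nonneg h ξ), mul_pow]
  · intro hs
    have hs1 : Summable fun ξ => eigΩ h ξ * ‖(inner ℂ (eΩ true h ξ) f : ℂ)‖ ^ 2 := by
      refine Summable.of_nonneg_of_le (fun ξ => mul_nonneg (eigΩ_nonneg h ξ) (sq_nonneg _))
        (fun ξ => ?_) ((hasSum_norm_sq_inner_eΩ hh f).summable.add hs)
      have h1 : eigΩ h ξ ≤ 1 + eigΩ h ξ ^ 2 := by nlinarith [sq_nonneg (eigΩ h ξ - 1)]
      have h2 := mul_le_mul_of_nonneg_right h1 (sq_nonneg ‖(inner ℂ (eΩ true h ξ) f : ℂ)‖)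
      linarith
    obtain ⟨h1, h2, h3⟩ := modeBC_of_hasSum hh (hasSum_basisΩ hh f) hs1
    have h4 : ∀ i, MemH1 (weakDeriv i f) ∧ ModeBC (flipZ true i) (weakDeriv i f) := fun i => by
      obtain ⟨k1, k2, -⟩ := modeBC_of_hasSum hh (h3 i) (by
        refine Summable.of_nonneg_of_le (fun ξ => mul_nonneg (eigΩ_nonneg h ξ) (sq_nonneg _))
          (fun ξ => ?_) hs
        rw [norm_mul, mul_pow, sq (eigΩ h ξ), mul_assoc]
        refine mul_le_mul_of_nonneg_left ?_ (eigΩ_nonneg h ξ)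
        exact mul_le_mul_of_nonneg_right (norm_symb_sq_le true h i ξ) (sq_nonneg _))
      exact ⟨k1, k2⟩
    exact ⟨⟨⟨h1, fun i => (h4 i).1⟩, h2.1, h2.2.1, (h4 0).2.1, (h4 1).2.2.1⟩, (h4 2).2.2.2, h2.2.2⟩

lemma inner_eG (k : Fin 2 → ℤ) (f : L2G) :
    inner ℂ (eG k) f = ∫ y in openBox loG hiG, f y * conj (expG k y) := inner_boxLp _ f

lemma inner_eG_weakDeriv {φ : L2G} (j : Fin 2) (hφ : PeriodicTrace j φ) (k : Fin 2 → ℤ) :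
    inner ℂ (eG k) (weakDeriv j φ) = 2 * Real.pi * Complex.I * k j * inner ℂ (eG k) φ := by
  have h1 := hφ.integral_weakDeriv_mul loG_lt_hiG (contDiff_conj (contDiff_expG k)) fun y => by
    rw [expG_insertNth]
  rw [inner_eG, inner_eG, h1, ← integral_neg, ← integral_const_mul]
  refine integral_congr_ae (Eventually.of_forall fun y => ?_)
  simp only []
  rw [pderiv_conj (contDiff_expG k), pderiv_expG]
  simp only [map_mul, Complex.conj_ofReal, Complex.conj_I, Complex.conj_ofNat, map_intCast]
  ring

lemma boxLp_pderiv_expG (k : Fin 2 → ℤ) (j : Fin 2) :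
    boxLp loG hiG (continuous_pderiv (contDiff_expG k) j)
      = (2 * Real.pi * Complex.I * k j : ℂ) • eG k := by
  ext1
  filter_upwards [coeFn_boxLp (a := loG) (b := hiG) (continuous_pderiv (contDiff_expG k) j),
    coeFn_boxLp (a := loG) (b := hiG) (contDiff_expG k).continuous,
    Lp.coeFn_smul (2 * Real.pi * Complex.I * k j : ℂ) (eG k)] with x h1 h2 h3
  rw [h1, h3, pderiv_expG, Pi.smul_apply, smul_eq_mul, eG, h2]

/-- Construction of elements of `H¹_per(G)` from Fourier coefficients. -/
lemma exists_memH1perG {q : (Fin 2 → ℤ) → ℂ} (hq : Summable fun k => ‖q k‖ ^ 2)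
    (hq' : ∀ j, Summable fun k => ‖(k j : ℂ) * q k‖ ^ 2) :
    ∃ π : L2G, MemH1perG π ∧ (∀ k, inner ℂ (eG k) π = q k) := by
  obtain ⟨π, hπ⟩ := orthonormal_eG.summable_smul hq
  have hs : ∀ j : Fin 2, Summable fun k => (2 * Real.pi * Complex.I * k j * q k : ℂ) • eG k :=
    fun j => orthonormal_eG.summable_smul <| by
      refine ((hq' j).mul_left (‖(2 * Real.pi * Complex.I : ℂ)‖ ^ 2)).congr fun k => ?_
      rw [← mul_pow, ← norm_mul, mul_assoc _ (k j : ℂ) (q k)]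
  choose g hg using hs
  have hg' : ∀ j, HasSum (fun k => q k • boxLp loG hiG
      (continuous_pderiv (contDiff_expG k) j)) (g j) := fun j => by
    refine (hg j).congr_fun fun k => ?_
    rw [boxLp_pderiv_expG, smul_smul, mul_comm]
  have hd := hasWeakDeriv_of_hasSum loG_lt_hiG contDiff_expG hπ hg'
  have hp : ∀ j, PeriodicTrace j π := fun j =>
    periodicTrace_of_hasSum loG_lt_hiG contDiff_expG hπ hg' fun k y => expG_insertNth k j y
  exact ⟨π, ⟨fun j => ⟨_, hd j⟩, hp 0, hp 1⟩, fun k => orthonormal_eG.inner_of_hasSum hπ k⟩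

/-! ### Lifting functions of the horizontal variables -/

/-- The element `x ↦ g (horiz x)` of `L²(Ω)`, for `g ∈ L²(G)`. -/
def liftFun (h : ℝ) (g : L2G) : L2Ω h :=
  (measurePreserving_memLp_horiz (h := h) (Lp.memLp g)).toLp _

lemma coeFn_liftFun (h : ℝ) (g : L2G) :
    liftFun h g =ᵐ[volume.restrict (openBox (loΩ h) hiΩ)] fun x => g (horiz x) :=
  MemLp.coeFn_toLp _

lemma inner_liftFun {h : ℝ} (g : L2G) (f : L2Ω h) :
    inner ℂ (liftFun h g) f = ∫ x in openBox (loΩ h) hiΩ, f x * conj (g (horiz x)) := by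
  rw [inner_eq_integral]
  refine integral_congr_ae ?_
  filter_upwards [coeFn_liftFun h g] with x hx
  rw [hx]

lemma inner_liftFun_liftFun {h : ℝ} (hh : 0 < h) (g g' : L2G) :
    inner ℂ (liftFun h g) (liftFun h g') = h * inner ℂ g g' := by
  have h1 := integral_tens h (fun y => g' y * conj (g y)) fun _ => 1
  have h2 : ∫ _ in Ioo (-h) 0, (1 : ℂ) = h := by
    simp [Measure.real, hh.le]
  rw [h2] at h1
  rw [inner_liftFun, inner_eq_integral g g', ← h1]
  refine integral_congr_ae ?_
  filter_upwards [coeFn_liftFun h g'] with x hx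
  rw [hx, tens, mul_one]

/-- The embedding of `L²(G)` into `L²(Ω)` as functions independent of the vertical variable. -/
def liftL {h : ℝ} (hh : 0 < h) : L2G →L[ℂ] L2Ω h :=
  LinearMap.mkContinuous
    { toFun := liftFun h
      map_add' := fun g g' => by
        ext1
        filter_upwards [coeFn_liftFun h (g + g'), coeFn_liftFun h g, coeFn_liftFun h g',
          Lp.coeFn_add (liftFun h g) (liftFun h g'), ae_comp_horiz (h := h) (Lp.coeFn_add g g')]
          with x h1 h2 h3 h4 h5
        rw [h1, h4, h5, Pi.add_apply, Pi.add_apply, h2, h3]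
      map_smul' := fun r g => by
        ext1
        filter_upwards [coeFn_liftFun h (r • g), coeFn_liftFun h g,
          Lp.coeFn_smul r (liftFun h g), ae_comp_horiz (h := h) (Lp.coeFn_smul r g)]
          with x h1 h2 h3 h4
        rw [h1, RingHom.id_apply, h3, h4, Pi.smul_apply, Pi.smul_apply, h2] }
    (Real.sqrt h) fun g => by
      refine (abs_le_of_sq_le_sq' ?_ (by positivity)).2
      have h1 := inner_liftFun_liftFun hh g g
      rw [inner_self_eq_norm_sq_to_K, inner_self_eq_norm_sq_to_K] at h1
      have h2 : ((‖liftFun h g‖ ^ 2 : ℝ) : ℂ) = ((h * ‖g‖ ^ 2 : ℝ) : ℂ) := by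
        push_cast
        exact h1
      have h3 := Complex.ofReal_injective h2
      rw [mul_pow, Real.sq_sqrt hh.le]
      exact h3.le

lemma coeFn_liftL {h : ℝ} (hh : 0 < h) (g : L2G) :
    liftL hh g =ᵐ[volume.restrict (openBox (loΩ h) hiΩ)] fun x => g (horiz x) :=
  coeFn_liftFun h g

lemma inner_liftL {h : ℝ} (hh : 0 < h) (g : L2G) (f : L2Ω h) :
    inner ℂ (liftL hh g) f = ∫ x in openBox (loΩ h) hiΩ, f x * conj (g (horiz x)) :=
  inner_liftFun g f

lemma inner_liftL_liftL {h : ℝ} (hh : 0 < h) (g g' : L2G) :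
    inner ℂ (liftL hh g) (liftL hh g') = h * inner ℂ g g' :=
  inner_liftFun_liftFun hh g g'

lemma inner_liftL_boxLp {h : ℝ} (hh : 0 < h) {F : (Fin 2 → ℝ) → ℂ} (hF : Continuous F)
    (f : L2Ω h) : inner ℂ (liftL hh (boxLp loG hiG hF)) f
      = ∫ x in openBox (loΩ h) hiΩ, f x * conj (F (horiz x)) := by
  rw [inner_liftL]
  refine integral_congr_ae ?_
  filter_upwards [ae_comp_horiz (h := h) (coeFn_boxLp (a := loG) (b := hiG) hF)] with x hx
  rw [hx]

lemma integral_vertAvg_mul_conj {h : ℝ} (hh : 0 < h) (g : L2G) (f : L2Ω h) :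
    ∫ y in openBox loG hiG, vertAvg f y * conj (g y) = (h : ℂ)⁻¹ * inner ℂ (liftL hh g) f := by
  rw [integral_vertAvg_mul f (memLp_conj g), inner_liftL]

lemma integral_vertAvg_mul_continuous {h : ℝ} (hh : 0 < h) {F : (Fin 2 → ℝ) → ℂ}
    (hF : Continuous F) (hF' : Continuous fun y => conj (F y)) (f : L2Ω h) :
    ∫ y in openBox loG hiG, vertAvg f y * F y
      = (h : ℂ)⁻¹ * inner ℂ (liftL hh (boxLp loG hiG hF')) f := by
  rw [integral_vertAvg_mul f (hF.memLp_openBox _ _ _), inner_liftL_boxLp]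
  simp only [Complex.conj_conj]

/-- Integration by parts in a horizontal direction against a periodic function of the horizontal
variables. -/
lemma PeriodicTrace.integral_weakDeriv_mul_horiz {h : ℝ} (hh : 0 < h) {f : L2Ω h} {j : Fin 2}
    (hf : PeriodicTrace j.castSucc f) {η : (Fin 2 → ℝ) → ℂ} (hη : ContDiff ℝ ∞ η)
    (hper : ∀ y, η (j.insertNth (loG j) y) = η (j.insertNth (hiG j) y)) :
    ∫ x in openBox (loΩ h) hiΩ, weakDeriv j.castSucc f x * η (horiz x)
      = -∫ x in openBox (loΩ h) hiΩ, f x * pderiv j η (horiz x) := by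
  have hs : ContDiff ℝ ∞ fun _ : ℝ => (1 : ℂ) := contDiff_const
  have e1 : loΩ h j.castSucc = loG j := by fin_cases j <;> rfl
  have e2 : hiΩ j.castSucc = hiG j := by fin_cases j <;> rfl
  have := hf.integral_weakDeriv_mul (loΩ_lt_hiΩ hh) (contDiff_tens hη hs) fun y => by
    rw [tens, tens, (horiz_insertNth_castSucc j _ y).1, (horiz_insertNth_castSucc j _ y).1, e1, e2,
      hper]
  rw [pderiv_castSucc_tens hη hs] at this
  simpa only [tens, mul_one] using this

/-! ### Solenoidal fields in terms of Fourier coefficients -/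

/-- The fields whose vertical average is divergence free, expressed by the Fourier coefficients:
`∑ⱼ kⱼ ⟪e_k, v̄ⱼ⟫ = 0` for all frequencies `k`. The coefficient `⟪e_k, v̄ⱼ⟫` is written, up to the
factor `h`, as the inner product of `vⱼ` in `L²(Ω)` with the lift of `e_k`. -/
def solenoidal {h : ℝ} (hh : 0 < h) : Submodule ℂ (L2Ωvec h) where
  carrier := {v | ∀ k : Fin 2 → ℤ, ∑ j, (k j : ℂ) * inner ℂ (liftL hh (eG k)) (v j) = 0}
  add_mem' := fun {v w} hv hw k => by
    simp only [PiLp.add_apply, inner_add_right, mul_add, Finset.sum_add_distrib, hv k, hw k,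
      add_zero]
  zero_mem' := fun k => by simp
  smul_mem' := fun r v hv k => by
    have := hv k
    simp only [PiLp.smul_apply, inner_smul_right, mul_left_comm _ r, ← Finset.mul_sum, this,
      mul_zero]

lemma isClosed_solenoidal {h : ℝ} (hh : 0 < h) : IsClosed (solenoidal hh : Set (L2Ωvec h)) := by
  have : (solenoidal hh : Set (L2Ωvec h)) = ⋂ k : Fin 2 → ℤ,
      {v | ∑ j, (k j : ℂ) * inner ℂ (liftL hh (eG k)) (v j) = 0} := by
    ext v
    simp only [mem_iInter, mem_ofPred_eq]
    rfl
  rw [this]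
  refine isClosed_iInter fun k => isClosed_eq ?_ continuous_const
  fun_prop

lemma hasSum_basisG (g : L2G) : HasSum (fun k => (inner ℂ (eG k) g : ℂ) • eG k) g := by
  have := basisG.hasSum_repr g
  simpa only [HilbertBasis.repr_apply_apply, coe_basisG] using this

/-- Solenoidal fields are orthogonal to the lifts of fields which are gradients on the Fourier
side. -/
lemma sum_inner_liftL_eq_zero {h : ℝ} (hh : 0 < h) {w : L2Ωvec h} (hw : w ∈ solenoidal hh)
    {g : Fin 2 → L2G} {p : (Fin 2 → ℤ) → ℂ} (hg : ∀ j k, inner ℂ (eG k) (g j) = k j * p k) :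
    ∑ j, inner ℂ (liftL hh (g j)) (w j) = 0 := by
  have h1 : ∀ j, HasSum (fun k : Fin 2 → ℤ =>
      (k j * p k : ℂ) * inner ℂ (w j) (liftL hh (eG k))) (inner ℂ (w j) (liftL hh (g j))) := by
    intro j
    have := ((hasSum_basisG (g j)).mapL (liftL hh)).mapL (innerSL ℂ (w j))
    simpa only [hg, map_smul, innerSL_apply_apply, smul_eq_mul] using this
  have h2 := hasSum_sum fun j (_ : j ∈ Finset.univ) => h1 j
  have h3 : ∀ k : Fin 2 → ℤ,
      ∑ j, (k j * p k : ℂ) * inner ℂ (w j) (liftL hh (eG k)) = 0 := fun k => by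
    have := congrArg conj (hw k)
    simp only [map_sum, map_mul, map_intCast, inner_conj_symm, map_zero] at this
    calc _ = p k * ∑ j, (k j : ℂ) * inner ℂ (w j) (liftL hh (eG k)) := by
          rw [Finset.mul_sum]
          exact Finset.sum_congr rfl fun j _ => by ring
      _ = 0 := by rw [this, mul_zero]
  simp only [h3] at h2
  have h4 := congrArg conj (h2.unique hasSum_zero)
  simpa only [map_sum, inner_conj_symm, map_zero] using h4

lemma memH1perG_eG (k : Fin 2 → ℤ) : MemH1perG (eG k) :=
  have hp : ∀ j, PeriodicTrace j (eG k) := fun j =>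
    periodicTrace_of_tendsto_boxLp loG_lt_hiG (fun _ => contDiff_expG k) tendsto_const_nhds
      (fun _ => tendsto_const_nhds) fun _ y => expG_insertNth k j y
  ⟨fun j => ⟨_, hasWeakDeriv_boxLp loG_lt_hiG j (contDiff_expG k)⟩, hp 0, hp 1⟩

lemma MemH1perG.periodicTrace {φ : L2G} (hφ : MemH1perG φ) (j : Fin 2) : PeriodicTrace j φ := by
  fin_cases j
  · exact hφ.2.1
  · exact hφ.2.2

lemma weakDeriv_eG (k : Fin 2 → ℤ) (j : Fin 2) :
    weakDeriv j (eG k) = (2 * Real.pi * Complex.I * k j : ℂ) • eG k := by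
  rw [← boxLp_pderiv_expG]
  exact (hasWeakDeriv_boxLp loG_lt_hiG j (contDiff_expG k)).eq

lemma integral_eq_inner_eG_zero (φ : L2G) :
    ∫ y in openBox loG hiG, φ y = inner ℂ (eG 0) φ := by
  rw [inner_eG]
  simp [expG_zero]

lemma isPressure_iff {h : ℝ} (hh : 0 < h) (v : L2Ωvec h) (π : L2G) :
    IsPressure v π ↔ MemH1perG π ∧ inner ℂ (eG 0) π = 0 ∧
      WithLp.toLp 2 (fun j => v j - liftL hh (weakDeriv j π)) ∈ solenoidal hh := by
  have hh' : (h : ℂ) ≠ 0 := by exact_mod_cast hh.ne'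
  rw [IsPressure, integral_eq_inner_eG_zero]
  refine and_congr_right fun hπ => and_congr_right fun h0 => ?_
  have key : ∀ φ : L2G,
      (∑ j : Fin 2, ∫ y in openBox loG hiG, weakDeriv j π y * conj (weakDeriv j φ y)
        = ∑ j : Fin 2, ∫ y in openBox loG hiG, vertAvg (v j) y * conj (weakDeriv j φ y)) ↔
      ∑ j, inner ℂ (liftL hh (weakDeriv j φ)) (v j - liftL hh (weakDeriv j π)) = 0 := by
    intro φ
    simp only [← inner_eq_integral, integral_vertAvg_mul_conj hh, inner_sub_right,
      inner_liftL_liftL, Finset.sum_sub_distrib, ← Finset.mul_sum]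
    rw [sub_eq_zero, eq_comm, inv_mul_eq_iff_eq_mul₀ hh']
  simp only [key, integral_eq_inner_eG_zero]
  constructor
  · intro H k
    by_cases hk : k = 0
    · subst hk; simp
    have h1 := H (eG k) (memH1perG_eG k) (by
      rw [(orthonormal_iff_ite.1 orthonormal_eG), if_neg (Ne.symm hk)])
    simp only [weakDeriv_eG, map_smul, inner_smul_left, map_mul, Complex.conj_ofReal,
      Complex.conj_I, Complex.conj_ofNat, map_intCast, mul_assoc, ← Finset.mul_sum] at h1
    simpa [Real.pi_ne_zero] using h1
  · intro H φ hφ _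
    refine sum_inner_liftL_eq_zero hh H
      (p := fun k => 2 * Real.pi * Complex.I * inner ℂ (eG k) φ) fun j k => ?_
    rw [inner_eG_weakDeriv j (hφ.periodicTrace j)]
    ring

lemma isHelmholtz_iff {h : ℝ} (hh : 0 < h) (v u : L2Ωvec h) :
    IsHelmholtz v u ↔ u ∈ solenoidal hh ∧ ∃ π, MemH1perG π ∧ inner ℂ (eG 0) π = 0 ∧
      ∀ j, u j = v j - liftL hh (weakDeriv j π) := by
  have key : ∀ π : L2G, (∀ j : Fin 2, u j =ᵐ[volume.restrict (openBox (loΩ h) hiΩ)]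
      fun x => v j x - weakDeriv j π (horiz x)) ↔ ∀ j, u j = v j - liftL hh (weakDeriv j π) := by
    refine fun π => forall_congr' fun j => ?_
    have : (fun x => v j x - weakDeriv j π (horiz x))
        =ᵐ[volume.restrict (openBox (loΩ h) hiΩ)] (v j - liftL hh (weakDeriv j π) : L2Ω h) := by
      filter_upwards [Lp.coeFn_sub (v j) (liftL hh (weakDeriv j π)),
        coeFn_liftL hh (weakDeriv j π)] with x h1 h2
      rw [h1, Pi.sub_apply, h2]
    rw [Lp.ext_iff]
    exact ⟨fun H => H.trans this, fun H => H.trans this.symm⟩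
  constructor
  · rintro ⟨π, h1, h2⟩
    rw [key] at h2
    obtain ⟨a1, a2, a3⟩ := (isPressure_iff hh v π).1 h1
    refine ⟨?_, π, a1, a2, h2⟩
    convert a3 using 1
    ext1 j
    exact h2 j
  · rintro ⟨h1, π, a1, a2, h2⟩
    refine ⟨π, (isPressure_iff hh v π).2 ⟨a1, a2, ?_⟩, (key π).2 h2⟩
    convert h1 using 1
    ext1 j
    exact (h2 j).symm

lemma mem_X2_iff {h : ℝ} (hh : 0 < h) (v : L2Ωvec h) : v ∈ X2 h ↔ v ∈ solenoidal hh := by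
  have h1 : v ∈ X2 h ↔ ∃ w, IsHelmholtz w v := by
    constructor
    · rintro ⟨w, rfl⟩
      exact ⟨w, (mem_graph_helmholtz (_, _)).1 ((helmholtz h).mem_graph w)⟩
    · rintro ⟨w, hw⟩
      obtain ⟨y, -, hy⟩ := (LinearPMap.mem_graph_iff _).1 ((mem_graph_helmholtz (w, v)).2 hw)
      exact ⟨y, hy⟩
  rw [h1]
  constructor
  · rintro ⟨w, hw⟩
    exact ((isHelmholtz_iff hh w v).1 hw).1
  · intro hv
    refine ⟨v, (isHelmholtz_iff hh v v).2 ⟨hv, 0, memH1perG_zero, inner_zero_right _, fun j => ?_⟩⟩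
    rw [weakDeriv_zero, map_zero, sub_zero]

lemma divFreeAvg_of_mem_solenoidal {h : ℝ} (hh : 0 < h) {v : L2Ωvec h}
    (hv : v ∈ solenoidal hh) : DivFreeAvg v := by
  intro φ hφ
  have hc := contDiff_conj hφ.1
  have hc' : ∀ j, Continuous fun y => conj (pderiv j φ y) := fun j =>
    Complex.continuous_conj.comp (continuous_pderiv hφ.1 j)
  have hp : ∀ j, PeriodicTrace j (boxLp loG hiG hc.continuous) := fun j =>
    periodicTrace_of_tendsto_boxLp loG_lt_hiG (fun _ => hc) tendsto_const_nhds
      (fun _ => tendsto_const_nhds) fun _ y => by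
        rw [hφ.insertNth_eq_zero (Or.inl rfl), hφ.insertNth_eq_zero (Or.inr rfl)]
  have e : ∀ j, boxLp loG hiG (hc' j) = weakDeriv j (boxLp loG hiG hc.continuous) := fun j => by
    rw [(hasWeakDeriv_boxLp loG_lt_hiG j hc).eq]
    exact boxLp_congr _ _ fun y => (pderiv_conj hφ.1 j y).symm
  simp only [fun j => integral_vertAvg_mul_continuous hh (continuous_pderiv hφ.1 j) (hc' j) (v j),
    ← Finset.mul_sum, e]
  rw [sum_inner_liftL_eq_zero hh hv (p := fun k => 2 * Real.pi * Complex.I *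
    inner ℂ (eG k) (boxLp loG hiG hc.continuous)) fun j k => ?_, mul_zero]
  rw [inner_eG_weakDeriv j (hp j)]
  ring

/-- For fields with periodic traces, the distributional condition `div_H v̄ = 0` also controls the
flux through the lateral boundary, so that it can be tested with all Fourier modes. -/
lemma mem_solenoidal_of_divFreeAvg {h : ℝ} (hh : 0 < h) {v : L2Ωvec h} (hv : DivFreeAvg v)
    (hp : ∀ j i : Fin 2, PeriodicTrace i.castSucc (v j)) : v ∈ solenoidal hh := by
  set D : L2Ω h := ∑ j : Fin 2, weakDeriv j.castSucc (v j) with hD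
  have hinner : ∀ {F : (Fin 2 → ℝ) → ℂ} (hF : ContDiff ℝ ∞ F)
      (_ : ∀ (j : Fin 2) y, F (j.insertNth (loG j) y) = F (j.insertNth (hiG j) y)),
      inner ℂ (liftL hh (boxLp loG hiG hF.continuous)) D
        = -∑ j, ∫ x in openBox (loΩ h) hiΩ, v j x * conj (pderiv j F (horiz x)) := by
    intro F hF hper
    rw [hD, inner_sum, ← Finset.sum_neg_distrib]
    refine Finset.sum_congr rfl fun j _ => ?_
    rw [inner_liftL_boxLp, (hp j j).integral_weakDeriv_mul_horiz hh (contDiff_conj hF) fun y => by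
      rw [hper]]
    simp only [pderiv_conj hF]
  -- The vertical average of the divergence vanishes as a distribution on `G`.
  have hzero : (liftL hh).adjoint D = 0 := by
    refine HasWeakDeriv.unique (i := 0) (f := 0) (fun φ hφ => ?_) (hasWeakDeriv_zero 0)
    have hc := contDiff_conj hφ.1
    have h1 : ∫ y in openBox loG hiG, (0 : L2G) y * pderiv 0 φ y = 0 := by
      have := integral_L2_smul_mul 0 (0 : L2G) (pderiv 0 φ)
      rwa [zero_smul, zero_mul] at this
    have h2 : ∫ y in openBox loG hiG, (liftL hh).adjoint D y * φ y
        = inner ℂ (boxLp loG hiG hc.continuous) ((liftL hh).adjoint D) := by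
      rw [inner_boxLp]
      simp only [Complex.conj_conj]
    have h3 := hv φ hφ
    simp only [fun j => integral_vertAvg_mul (v j) (hφ.memLp_pderiv (openBox loG hiG) j),
      ← Finset.mul_sum] at h3
    have h4 := (mul_eq_zero.1 h3).resolve_left (inv_ne_zero (by exact_mod_cast hh.ne'))
    rw [h1, h2, ContinuousLinearMap.adjoint_inner_right, hinner hc fun j y => by
      rw [hφ.insertNth_eq_zero (Or.inl rfl), hφ.insertNth_eq_zero (Or.inr rfl)]]
    simp only [pderiv_conj hφ.1, Complex.conj_conj]
    rw [h4, neg_zero, neg_zero]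
  intro k
  have h1 : inner ℂ (liftL hh (eG k)) D = 0 := by
    rw [← ContinuousLinearMap.adjoint_inner_right, hzero, inner_zero_right]
  rw [eG, hinner (contDiff_expG k) (expG_insertNth k), neg_eq_zero] at h1
  have h2 : ∀ j, ∫ x in openBox (loΩ h) hiΩ, v j x * conj (pderiv j (expG k) (horiz x))
      = -(2 * Real.pi * Complex.I) * (k j * inner ℂ (liftL hh (eG k)) (v j)) := fun j => by
    rw [eG, inner_liftL_boxLp, ← integral_const_mul, ← integral_const_mul]
    refine integral_congr_ae (Eventually.of_forall fun x => ?_)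
    simp only [pderiv_expG, map_mul, Complex.conj_ofReal, Complex.conj_I, Complex.conj_ofNat,
      map_intCast]
    ring
  simp only [h2, ← Finset.mul_sum] at h1
  exact (mul_eq_zero.1 h1).resolve_left (by simp [Real.pi_ne_zero])

/-! ### The square root of the resolvent of the Laplacian -/

lemma ext_inner_eΩ {h : ℝ} (hh : 0 < h) {f g : L2Ω h}
    (H : ∀ ξ, inner ℂ (eΩ true h ξ) f = inner ℂ (eΩ true h ξ) g) : f = g :=
  sub_eq_zero.1 <| eq_zero_of_inner_eΩ hh fun ξ => by rw [inner_sub_right, H, sub_self]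

lemma exists_inner_eΩ {h : ℝ} (hh : 0 < h) {c : ModeIdx → ℂ} (hc : Summable fun ξ => ‖c ξ‖ ^ 2) :
    ∃ f : L2Ω h, ∀ ξ, inner ℂ (eΩ true h ξ) f = c ξ := by
  obtain ⟨f, hf⟩ := (orthonormal_eΩ true hh).summable_smul hc
  exact ⟨f, fun ξ => (orthonormal_eΩ true hh).inner_of_hasSum hf ξ⟩

lemma hasSum_inner_mul_inner_eΩ {h : ℝ} (hh : 0 < h) (f g : L2Ω h) :
    HasSum (fun ξ => conj (inner ℂ (eΩ true h ξ) f : ℂ) * inner ℂ (eΩ true h ξ) g)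
      (inner ℂ f g) := by
  simpa only [coe_basisΩ, inner_conj_symm] using (basisΩ hh).hasSum_inner_mul_inner f g

/-- The symbol `(1 + λ)^{-1/2}` of `(1 - Δ)^{-1/2}`, where `λ` are the eigenvalues of `-Δ`. -/
def invSqrt (h : ℝ) (ξ : ModeIdx) : ℝ := (Real.sqrt (1 + eigΩ h ξ))⁻¹

lemma invSqrt_pos (h : ℝ) (ξ : ModeIdx) : 0 < invSqrt h ξ := by
  have := eigΩ_nonneg h ξ
  unfold invSqrt
  positivity

lemma invSqrt_sq_mul (h : ℝ) (ξ : ModeIdx) : invSqrt h ξ ^ 2 * (1 + eigΩ h ξ) = 1 := by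
  have := eigΩ_nonneg h ξ
  rw [invSqrt, inv_pow, Real.sq_sqrt (by linarith), inv_mul_cancel₀ (by linarith)]

lemma invSqrt_le_one (h : ℝ) (ξ : ModeIdx) : invSqrt h ξ ≤ 1 := by
  have := eigΩ_nonneg h ξ
  exact inv_le_one_of_one_le₀ (Real.one_le_sqrt.2 (by linarith))

lemma norm_invSqrt_mul_sq (h : ℝ) (ξ : ModeIdx) (c : ℂ) :
    ‖(invSqrt h ξ : ℂ) * c‖ ^ 2 = invSqrt h ξ ^ 2 * ‖c‖ ^ 2 := by
  rw [norm_mul, mul_pow, Complex.norm_real, Real.norm_of_nonneg (invSqrt_pos h ξ).le]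

lemma norm_invSqrt_mul_sq_le (h : ℝ) (ξ : ModeIdx) (c : ℂ) :
    ‖(invSqrt h ξ : ℂ) * c‖ ^ 2 ≤ ‖c‖ ^ 2 := by
  rw [norm_invSqrt_mul_sq]
  exact mul_le_of_le_one_left (sq_nonneg _)
    (pow_le_one₀ (invSqrt_pos h ξ).le (invSqrt_le_one h ξ))

lemma exists_sobolevRoot {h : ℝ} (hh : 0 < h) : ∃ S : L2Ω h →L[ℂ] L2Ω h,
    ∀ f ξ, inner ℂ (eΩ true h ξ) (S f) = invSqrt h ξ * inner ℂ (eΩ true h ξ) f := by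
  have hex : ∀ f : L2Ω h, ∃ g : L2Ω h, ∀ ξ,
      inner ℂ (eΩ true h ξ) g = invSqrt h ξ * inner ℂ (eΩ true h ξ) f := fun f =>
    exists_inner_eΩ hh <| Summable.of_nonneg_of_le (fun _ => sq_nonneg _)
      (fun ξ => norm_invSqrt_mul_sq_le h ξ _) (hasSum_norm_sq_inner_eΩ hh f).summable
  choose S hS using hex
  refine ⟨LinearMap.mkContinuous
    { toFun := S
      map_add' := fun f g => ext_inner_eΩ hh fun ξ => by
        rw [inner_add_right, hS, hS, hS, inner_add_right, mul_add]
      map_smul' := fun r f => ext_inner_eΩ hh fun ξ => by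
        rw [RingHom.id_apply, inner_smul_right, hS, hS, inner_smul_right, mul_left_comm] } 1
    fun f => ?_, hS⟩
  rw [one_mul]
  refine (abs_le_of_sq_le_sq' ?_ (norm_nonneg _)).2
  refine hasSum_le (fun ξ => ?_) (hasSum_norm_sq_inner_eΩ hh (S f)) (hasSum_norm_sq_inner_eΩ hh f)
  rw [hS]
  exact norm_invSqrt_mul_sq_le h ξ _

/-- The operator `(1 - Δ)^{-1/2}` in `L²(Ω)`, where `Δ` carries the boundary conditions of the sine
modes: an isomorphism from `L²(Ω)` onto the functions in `H¹_per(Ω)` vanishing on `Γ_b`. -/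
def sobolevRoot {h : ℝ} (hh : 0 < h) : L2Ω h →L[ℂ] L2Ω h := (exists_sobolevRoot hh).choose

lemma inner_sobolevRoot {h : ℝ} (hh : 0 < h) (f : L2Ω h) (ξ : ModeIdx) :
    inner ℂ (eΩ true h ξ) (sobolevRoot hh f) = invSqrt h ξ * inner ℂ (eΩ true h ξ) f :=
  (exists_sobolevRoot hh).choose_spec f ξ

lemma sobolevRoot_symm {h : ℝ} (hh : 0 < h) (f g : L2Ω h) :
    inner ℂ (sobolevRoot hh f) g = inner ℂ f (sobolevRoot hh g) := by
  refine (hasSum_inner_mul_inner_eΩ hh _ _).unique ?_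
  refine (hasSum_inner_mul_inner_eΩ hh _ _).congr_fun fun ξ => ?_
  rw [inner_sobolevRoot, inner_sobolevRoot, map_mul, Complex.conj_ofReal]
  ring

lemma sobolevRoot_injective {h : ℝ} (hh : 0 < h) : Function.Injective (sobolevRoot hh) := by
  intro f g H
  refine ext_inner_eΩ hh fun ξ => ?_
  have h1 := congrArg (inner ℂ (eΩ true h ξ)) H
  rw [inner_sobolevRoot, inner_sobolevRoot] at h1
  exact mul_left_cancel₀ (by exact_mod_cast (invSqrt_pos h ξ).ne') h1

lemma inner_sobolevRoot_sobolevRoot {h : ℝ} (hh : 0 < h) (f : L2Ω h) (ξ : ModeIdx) :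
    inner ℂ (eΩ true h ξ) (sobolevRoot hh (sobolevRoot hh f))
      = (invSqrt h ξ ^ 2 : ℝ) * inner ℂ (eΩ true h ξ) f := by
  rw [inner_sobolevRoot, inner_sobolevRoot]
  push_cast
  ring

lemma summable_eigΩ_sobolevRoot {h : ℝ} (hh : 0 < h) (f : L2Ω h) :
    Summable fun ξ => eigΩ h ξ * ‖(inner ℂ (eΩ true h ξ) (sobolevRoot hh f) : ℂ)‖ ^ 2 := by
  refine Summable.of_nonneg_of_le (fun ξ => mul_nonneg (eigΩ_nonneg h ξ) (sq_nonneg _))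
    (fun ξ => ?_) (hasSum_norm_sq_inner_eΩ hh f).summable
  rw [inner_sobolevRoot, norm_invSqrt_mul_sq, ← mul_assoc]
  refine mul_le_of_le_one_left (sq_nonneg _) ?_
  have := invSqrt_sq_mul h ξ
  nlinarith [sq_nonneg (invSqrt h ξ)]

/-- `(1 - Δ)^{-1/2}` is isometric from `L²` to `H¹`. -/
lemma norm_sq_eq_sobolevRoot {h : ℝ} (hh : 0 < h) (f : L2Ω h) :
    ‖f‖ ^ 2 = ‖sobolevRoot hh f‖ ^ 2 + ∑ i, ‖weakDeriv i (sobolevRoot hh f)‖ ^ 2 := by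
  refine (hasSum_norm_sq_inner_eΩ hh f).unique ?_
  refine ((hasSum_norm_sq_inner_eΩ hh _).add
    (hasSum_norm_sq_weakDeriv hh (summable_eigΩ_sobolevRoot hh f))).congr_fun fun ξ => ?_
  rw [inner_sobolevRoot, norm_invSqrt_mul_sq]
  linear_combination (-‖(inner ℂ (eΩ true h ξ) f : ℂ)‖ ^ 2) * invSqrt_sq_mul h ξ

lemma exists_sobolevRoot_eq {h : ℝ} (hh : 0 < h) {f : L2Ω h}
    (hf : Summable fun ξ => eigΩ h ξ * ‖(inner ℂ (eΩ true h ξ) f : ℂ)‖ ^ 2) :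
    ∃ g, sobolevRoot hh g = f := by
  obtain ⟨g, hg⟩ := exists_inner_eΩ hh
    (c := fun ξ => (invSqrt h ξ : ℂ)⁻¹ * inner ℂ (eΩ true h ξ) f) (by
    refine ((hasSum_norm_sq_inner_eΩ hh f).summable.add hf).congr fun ξ => ?_
    rw [norm_mul, mul_pow, norm_inv, inv_pow, Complex.norm_real,
      Real.norm_of_nonneg (invSqrt_pos h ξ).le,
      inv_eq_of_mul_eq_one_right (invSqrt_sq_mul h ξ)]
    ring)
  refine ⟨g, ext_inner_eΩ hh fun ξ => ?_⟩
  rw [inner_sobolevRoot, hg, mul_inv_cancel_left₀ (by exact_mod_cast (invSqrt_pos h ξ).ne')]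

lemma memDomScalar_sobolevRoot_sobolevRoot {h : ℝ} (hh : 0 < h) (f : L2Ω h) :
    MemDomScalar (sobolevRoot hh (sobolevRoot hh f)) := by
  rw [memDomScalar_iff_summable hh]
  refine Summable.of_nonneg_of_le (fun ξ => by positivity) (fun ξ => ?_)
    (hasSum_norm_sq_inner_eΩ hh f).summable
  rw [inner_sobolevRoot_sobolevRoot, norm_mul, mul_pow, Complex.norm_real, Real.norm_eq_abs, sq_abs,
    ← mul_assoc, ← mul_pow]
  refine mul_le_of_le_one_left (sq_nonneg _) (pow_le_one₀ ?_ ?_)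
  · exact mul_nonneg (eigΩ_nonneg h ξ) (sq_nonneg _)
  · nlinarith [sq_nonneg (invSqrt h ξ), invSqrt_sq_mul h ξ]

lemma sub_laplacian_sobolevRoot_sobolevRoot {h : ℝ} (hh : 0 < h) (f : L2Ω h) :
    sobolevRoot hh (sobolevRoot hh f)
      - ∑ i : Fin 3, weakDeriv i (weakDeriv i (sobolevRoot hh (sobolevRoot hh f))) = f := by
  refine ext_inner_eΩ hh fun ξ => ?_
  rw [inner_sub_right, (memDomScalar_sobolevRoot_sobolevRoot hh f).inner_laplacian hh,
    inner_sobolevRoot_sobolevRoot]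
  have h1 : ((invSqrt h ξ ^ 2 : ℝ) : ℂ) * (1 + eigΩ h ξ) = 1 := by
    exact_mod_cast invSqrt_sq_mul h ξ
  linear_combination (inner ℂ (eΩ true h ξ) f) * h1

lemma MemDomScalar.sobolevRoot_sub_laplacian {h : ℝ} (hh : 0 < h) {f : L2Ω h}
    (hf : MemDomScalar f) : sobolevRoot hh (sobolevRoot hh
      (f - ∑ i : Fin 3, weakDeriv i (weakDeriv i f))) = f := by
  refine ext_inner_eΩ hh fun ξ => ?_
  rw [inner_sobolevRoot_sobolevRoot, inner_sub_right, hf.inner_laplacian hh]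
  have h1 : ((invSqrt h ξ ^ 2 : ℝ) : ℂ) * (1 + eigΩ h ξ) = 1 := by
    exact_mod_cast invSqrt_sq_mul h ξ
  linear_combination (inner ℂ (eΩ true h ξ) f) * h1

/-! ### The stationary problem with pressure -/

/-- The integral of a vertical sine mode. -/
def meanZ (h : ℝ) (n : ℕ) : ℂ := ∫ z in Ioo (-h) 0, trigZ true h n z

lemma meanZ_ne_zero {h : ℝ} (hh : 0 < h) (n : ℕ) : meanZ h n ≠ 0 := by
  have hμ := freqZ_pos hh n
  have h1 : ∫ z in Ioo (-h) 0, Real.sqrt (2 / h) * Real.sin (freqZ h n * (z + h))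
      = Real.sqrt (2 / h) / freqZ h n := by
    rw [← integral_Ioc_eq_integral_Ioo, ← intervalIntegral.integral_of_le (by linarith),
      intervalIntegral.integral_const_mul]
    have : ∫ z in (-h)..0, Real.sin (freqZ h n * (z + h)) = (freqZ h n)⁻¹ := by
      simp only [mul_add]
      rw [intervalIntegral.integral_comp_mul_add (fun x => Real.sin x) hμ.ne', integral_sin]
      simp [cos_freqZ_mul hh]
    rw [this]
    exact (div_eq_mul_inv _ _).symm
  have h2 : meanZ h n = ((Real.sqrt (2 / h) / freqZ h n : ℝ) : ℂ) := by
    rw [← h1, ← integral_complex_ofReal, meanZ]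
    simp [trigZ]
  rw [h2]
  have : 0 < Real.sqrt (2 / h) / freqZ h n := by positivity
  exact_mod_cast this.ne'

lemma inner_eΩ_liftL {h : ℝ} (hh : 0 < h) (g : L2G) (ξ : ModeIdx) :
    inner ℂ (eΩ true h ξ) (liftL hh g) = meanZ h ξ.2 * inner ℂ (eG ξ.1) g := by
  rw [inner_eΩ, inner_eG, meanZ, ← integral_tens]
  refine integral_congr_ae ?_
  filter_upwards [coeFn_liftL hh g] with x hx
  rw [hx, modeΩ, tens, tens, map_mul, conj_trigZ]
  ring

/-- The function `(1 - Δ)⁻¹ e_k` for the horizontal mode `e_k`. -/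
def resMode {h : ℝ} (hh : 0 < h) (k : Fin 2 → ℤ) : L2Ω h :=
  sobolevRoot hh (sobolevRoot hh (liftL hh (eG k)))

lemma inner_eG_eG (k l : Fin 2 → ℤ) : (inner ℂ (eG k) (eG l) : ℂ) = if k = l then 1 else 0 :=
  (orthonormal_iff_ite.1 orthonormal_eG) k l

lemma inner_eΩ_resMode {h : ℝ} (hh : 0 < h) (k : Fin 2 → ℤ) (ξ : ModeIdx) :
    inner ℂ (eΩ true h ξ) (resMode hh k)
      = (invSqrt h ξ ^ 2 : ℝ) * (meanZ h ξ.2 * if ξ.1 = k then 1 else 0) := by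
  rw [resMode, inner_sobolevRoot_sobolevRoot, inner_eΩ_liftL, inner_eG_eG]

lemma inner_liftL_sobolevRoot_sobolevRoot {h : ℝ} (hh : 0 < h) (k : Fin 2 → ℤ) (f : L2Ω h) :
    inner ℂ (liftL hh (eG k)) (sobolevRoot hh (sobolevRoot hh f)) = inner ℂ (resMode hh k) f := by
  rw [resMode, sobolevRoot_symm, sobolevRoot_symm]

/-- `⟪(1 - Δ)⁻¹ e_k, g⟫ = ⟪e_k, (1 - Δ)⁻¹ e_k⟫ ⟪e_k, g⟫_{L²(G)}` for `g` independent of `z`. -/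
lemma inner_resMode_liftL {h : ℝ} (hh : 0 < h) (k : Fin 2 → ℤ) (g : L2G) :
    inner ℂ (resMode hh k) (liftL hh g)
      = (‖sobolevRoot hh (liftL hh (eG k))‖ ^ 2 : ℝ) * inner ℂ (eG k) g := by
  have h1 : ((‖sobolevRoot hh (liftL hh (eG k))‖ ^ 2 : ℝ) : ℂ)
      = inner ℂ (resMode hh k) (liftL hh (eG k)) := by
    rw [resMode, sobolevRoot_symm, inner_self_eq_norm_sq_to_K]
    push_cast
    rfl
  rw [h1]
  refine (hasSum_inner_mul_inner_eΩ hh _ _).unique ?_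
  refine ((hasSum_inner_mul_inner_eΩ hh _ _).mul_right _).congr_fun fun ξ => ?_
  rw [inner_eΩ_resMode, inner_eΩ_liftL, inner_eΩ_liftL, inner_eG_eG]
  split_ifs with hk
  · rw [hk]; ring
  · simp

lemma norm_resMode_pos {h : ℝ} (hh : 0 < h) (k : Fin 2 → ℤ) : 0 < ‖resMode hh k‖ := by
  rw [norm_pos_iff]
  intro H
  have h1 := inner_eΩ_resMode hh k (k, 0)
  rw [H, inner_zero_right, if_pos rfl, mul_one] at h1
  have h2 : ((invSqrt h (k, 0) ^ 2 : ℝ) : ℂ) ≠ 0 := by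
    exact_mod_cast (pow_pos (invSqrt_pos h (k, 0)) 2).ne'
  exact mul_ne_zero h2 (meanZ_ne_zero hh 0) h1.symm

/-- The functions `(1 - Δ)⁻¹ e_k` are orthogonal, because their horizontal frequencies differ. -/
lemma orthonormal_resMode {h : ℝ} (hh : 0 < h) :
    Orthonormal ℂ fun k => ((‖resMode hh k‖ : ℂ)⁻¹) • resMode hh k := by
  refine ⟨fun k => ?_, fun k l hkl => ?_⟩
  · have := norm_resMode_pos hh k
    rw [norm_smul, norm_inv, Complex.norm_real, norm_norm, inv_mul_cancel₀ this.ne']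
  · change inner ℂ (((‖resMode hh k‖ : ℂ)⁻¹) • resMode hh k)
      (((‖resMode hh l‖ : ℂ)⁻¹) • resMode hh l) = 0
    rw [inner_smul_left, inner_smul_right]
    have : inner ℂ (resMode hh k) (resMode hh l) = 0 := by
      refine (hasSum_inner_mul_inner_eΩ hh _ _).unique ?_
      refine hasSum_zero.congr_fun fun ξ => ?_
      rw [inner_eΩ_resMode, inner_eΩ_resMode]
      by_cases h1 : ξ.1 = k
      · rw [if_neg (c := ξ.1 = l) (by rw [h1]; exact hkl)]
        simp
      · simp [h1]
    rw [this, mul_zero, mul_zero]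

lemma eigΩ_zero_le {h : ℝ} (hh : 0 < h) (ξ : ModeIdx) : eigΩ h (ξ.1, 0) ≤ eigΩ h ξ := by
  rw [eigΩ_eq, eigΩ_eq]
  have h1 : freqZ h 0 ≤ freqZ h ξ.2 := by
    unfold freqZ
    have := Real.pi_pos
    gcongr
    simp
  have := freqZ_pos hh 0
  gcongr

lemma invSqrt_le_invSqrt_zero {h : ℝ} (hh : 0 < h) (ξ : ModeIdx) :
    invSqrt h ξ ≤ invSqrt h (ξ.1, 0) := by
  have h1 := eigΩ_nonneg h (ξ.1, 0)
  have h2 := eigΩ_zero_le hh ξ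
  unfold invSqrt
  gcongr

/-- On the horizontal frequency `k` the resolvent `(1 - Δ)⁻¹` and its quadratic form at the
horizontal mode are comparable, uniformly in `k`. -/
lemma norm_resMode_le {h : ℝ} (hh : 0 < h) (k : Fin 2 → ℤ) :
    ‖resMode hh k‖ ≤ Real.sqrt h / ‖meanZ h 0‖ ^ 2 * ‖sobolevRoot hh (liftL hh (eG k))‖ ^ 2 := by
  have hm : 0 < ‖meanZ h 0‖ := norm_pos_iff.2 (meanZ_ne_zero hh 0)
  have h1 : ‖liftL hh (eG k)‖ ^ 2 = h := by
    have := inner_liftL_liftL hh (eG k) (eG k)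
    rw [inner_self_eq_norm_sq_to_K, inner_eG_eG, if_pos rfl, mul_one] at this
    apply Complex.ofReal_injective
    push_cast
    exact this
  have h2 : ‖resMode hh k‖ ^ 2 ≤ (invSqrt h (k, 0) ^ 2) ^ 2 * h := by
    have h0 := (hasSum_norm_sq_inner_eΩ hh (liftL hh (eG k))).mul_left ((invSqrt h (k, 0) ^ 2) ^ 2)
    rw [h1] at h0
    refine hasSum_le (fun ξ => ?_) (hasSum_norm_sq_inner_eΩ hh _) h0
    rw [inner_eΩ_resMode, inner_eΩ_liftL, inner_eG_eG]
    split_ifs with hk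
    · rw [norm_mul, mul_pow, Complex.norm_real, Real.norm_of_nonneg (sq_nonneg _), ← hk]
      have := invSqrt_le_invSqrt_zero hh ξ
      have := (invSqrt_pos h ξ).le
      gcongr
    · simp
  have h3 : ‖resMode hh k‖ ≤ invSqrt h (k, 0) ^ 2 * Real.sqrt h := by
    refine (abs_le_of_sq_le_sq' ?_ (by positivity)).2
    rw [mul_pow, Real.sq_sqrt hh.le]
    exact h2
  have h4 : invSqrt h (k, 0) * ‖meanZ h 0‖ ≤ ‖sobolevRoot hh (liftL hh (eG k))‖ := by
    have := norm_inner_le_norm (𝕜 := ℂ) (eΩ true h (k, 0)) (sobolevRoot hh (liftL hh (eG k)))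
    rw [(orthonormal_eΩ true hh).1, one_mul, inner_sobolevRoot, inner_eΩ_liftL, inner_eG_eG,
      if_pos rfl, mul_one, norm_mul, Complex.norm_real,
      Real.norm_of_nonneg (invSqrt_pos h _).le] at this
    exact this
  have h5 := pow_le_pow_left₀ (mul_nonneg (invSqrt_pos h (k, 0)).le hm.le) h4 2
  calc _ ≤ invSqrt h (k, 0) ^ 2 * Real.sqrt h := h3
    _ = Real.sqrt h / ‖meanZ h 0‖ ^ 2 * (invSqrt h (k, 0) * ‖meanZ h 0‖) ^ 2 := by
      field_simp
    _ ≤ _ := by gcongr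

lemma norm_sobolevRoot_liftL_pos {h : ℝ} (hh : 0 < h) (k : Fin 2 → ℤ) :
    0 < ‖sobolevRoot hh (liftL hh (eG k))‖ ^ 2 := by
  by_contra H
  have h1 : ‖sobolevRoot hh (liftL hh (eG k))‖ ^ 2 = 0 :=
    le_antisymm (not_lt.1 H) (sq_nonneg _)
  have h2 := norm_resMode_le hh k
  rw [h1, mul_zero] at h2
  exact (norm_resMode_pos hh k).not_ge h2

/-- The Fourier coefficients of the pressure in the problem `u - Δu + ∇_H π = x`. At `k = 0` the
division by zero gives the value `0`, which is the required normalisation. -/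
def presCoef {h : ℝ} (hh : 0 < h) (x : L2Ωvec h) (k : Fin 2 → ℤ) : ℂ :=
  (∑ j, (k j : ℂ) * inner ℂ (resMode hh k) (x j)) /
    (2 * Real.pi * Complex.I * (∑ j, (k j : ℂ) ^ 2) *
      (‖sobolevRoot hh (liftL hh (eG k))‖ ^ 2 : ℝ))

lemma presCoef_zero {h : ℝ} (hh : 0 < h) (x : L2Ωvec h) : presCoef hh x 0 = 0 := by
  simp [presCoef]

lemma sum_sq_pos {k : Fin 2 → ℤ} (hk : k ≠ 0) : (0 : ℝ) < ∑ j, (k j : ℝ) ^ 2 := by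
  obtain ⟨j, hj⟩ := Function.ne_iff.1 hk
  have : (k j : ℝ) ≠ 0 := by exact_mod_cast hj
  exact Finset.sum_pos' (fun _ _ => sq_nonneg _) ⟨j, Finset.mem_univ j, by positivity⟩

lemma mul_presCoef {h : ℝ} (hh : 0 < h) (x : L2Ωvec h) (k : Fin 2 → ℤ) :
    ∑ j, (k j : ℂ) * inner ℂ (resMode hh k) (x j) =
      2 * Real.pi * Complex.I * (∑ j, (k j : ℂ) ^ 2) *
        (‖sobolevRoot hh (liftL hh (eG k))‖ ^ 2 : ℝ) * presCoef hh x k := by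
  by_cases hk : k = 0
  · subst hk; simp
  have h1 : (∑ j, (k j : ℂ) ^ 2) ≠ 0 := by exact_mod_cast (sum_sq_pos hk).ne'
  have h2 : ((‖sobolevRoot hh (liftL hh (eG k))‖ ^ 2 : ℝ) : ℂ) ≠ 0 := by
    exact_mod_cast (norm_sobolevRoot_liftL_pos hh k).ne'
  rw [presCoef, mul_div_cancel₀]
  exact mul_ne_zero (mul_ne_zero Complex.two_pi_I_ne_zero h1) h2

/-- The pressure gradient is controlled by the right hand side, frequency by frequency. -/
lemma norm_mul_presCoef_le {h : ℝ} (hh : 0 < h) (x : L2Ωvec h) (k : Fin 2 → ℤ) (i : Fin 2) :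
    ‖(k i : ℂ) * presCoef hh x k‖ ≤ Real.sqrt h / ‖meanZ h 0‖ ^ 2 *
      ∑ j, ‖(inner ℂ (((‖resMode hh k‖ : ℂ)⁻¹) • resMode hh k) (x j) : ℂ)‖ := by
  by_cases hk : k = 0
  · subst hk
    simp only [Pi.zero_apply, Int.cast_zero, zero_mul, norm_zero]
    positivity
  have hK := sum_sq_pos hk
  have hb := norm_sobolevRoot_liftL_pos hh k
  have hr := norm_resMode_pos hh k
  set b := ‖sobolevRoot hh (liftL hh (eG k))‖ ^ 2 with hbdef
  set K : ℝ := ∑ j, (k j : ℝ) ^ 2 with hKdef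
  have h1 : ∀ j, |(k i : ℝ)| * |(k j : ℝ)| ≤ K := fun j => by
    have e1 : ∀ l, (k l : ℝ) ^ 2 ≤ K := fun l =>
      Finset.single_le_sum (f := fun l => (k l : ℝ) ^ 2) (fun _ _ => sq_nonneg _)
        (Finset.mem_univ l)
    have e2 := e1 i
    have e3 := e1 j
    rw [← sq_abs] at e2 e3
    nlinarith [sq_nonneg (|(k i : ℝ)| - |(k j : ℝ)|)]
  have h2 : ∀ j, ‖(inner ℂ (resMode hh k) (x j) : ℂ)‖ = ‖resMode hh k‖ *
      ‖(inner ℂ (((‖resMode hh k‖ : ℂ)⁻¹) • resMode hh k) (x j) : ℂ)‖ := fun j => by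
    rw [inner_smul_left, norm_mul, RCLike.norm_conj, norm_inv, Complex.norm_real, norm_norm,
      mul_inv_cancel_left₀ hr.ne']
  have h3 : ‖presCoef hh x k‖ ≤ (∑ j, |(k j : ℝ)| * ‖(inner ℂ (resMode hh k) (x j) : ℂ)‖) /
      (K * b) := by
    have e1 : (2 * Real.pi * Complex.I * (∑ j, (k j : ℂ) ^ 2) * (b : ℂ) : ℂ)
        = ((2 * Real.pi * (K * b) : ℝ) : ℂ) * Complex.I := by
      rw [hKdef]
      push_cast
      ring
    rw [presCoef, ← hbdef, e1, norm_div, norm_mul, Complex.norm_I, mul_one, Complex.norm_real,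
      Real.norm_of_nonneg (by have := Real.pi_pos; positivity)]
    refine div_le_div₀ (Finset.sum_nonneg fun _ _ => by positivity) ?_ (by positivity) ?_
    · refine (norm_sum_le _ _).trans (Finset.sum_le_sum fun j _ => ?_)
      rw [norm_mul, ← Complex.ofReal_intCast, Complex.norm_real, Real.norm_eq_abs]
    · refine le_mul_of_one_le_left (by positivity) ?_
      linarith [Real.pi_gt_three]
  rw [norm_mul, ← Complex.ofReal_intCast, Complex.norm_real, Real.norm_eq_abs]
  calc |(k i : ℝ)| * ‖presCoef hh x k‖
      ≤ |(k i : ℝ)| * ((∑ j, |(k j : ℝ)| * ‖(inner ℂ (resMode hh k) (x j) : ℂ)‖) / (K * b)) := by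
        gcongr
    _ = (∑ j, |(k i : ℝ)| * |(k j : ℝ)| * ‖(inner ℂ (resMode hh k) (x j) : ℂ)‖) / (K * b) := by
        rw [← mul_div_assoc, Finset.mul_sum]
        simp only [mul_assoc]
    _ ≤ (∑ j, K * ‖(inner ℂ (resMode hh k) (x j) : ℂ)‖) / (K * b) := by
        gcongr with j
        exact h1 j
    _ = ‖resMode hh k‖ / b *
        ∑ j, ‖(inner ℂ (((‖resMode hh k‖ : ℂ)⁻¹) • resMode hh k) (x j) : ℂ)‖ := by
        simp only [h2]
        rw [← Finset.mul_sum, ← Finset.mul_sum]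
        field_simp
    _ ≤ _ := by
        refine mul_le_mul_of_nonneg_right ?_ (Finset.sum_nonneg fun _ _ => norm_nonneg _)
        rw [div_le_iff₀ hb]
        exact norm_resMode_le hh k

lemma norm_presCoef_le {h : ℝ} (hh : 0 < h) (x : L2Ωvec h) (k : Fin 2 → ℤ) :
    ‖presCoef hh x k‖ ≤ Real.sqrt h / ‖meanZ h 0‖ ^ 2 *
      ∑ j, ‖(inner ℂ (((‖resMode hh k‖ : ℂ)⁻¹) • resMode hh k) (x j) : ℂ)‖ := by
  by_cases hk : k = 0
  · subst hk
    rw [presCoef_zero, norm_zero]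
    positivity
  obtain ⟨i, hi⟩ := Function.ne_iff.1 hk
  refine le_trans ?_ (norm_mul_presCoef_le hh x k i)
  rw [norm_mul]
  refine le_mul_of_one_le_left (norm_nonneg _) ?_
  rw [Complex.norm_intCast]
  exact_mod_cast Int.one_le_abs hi

lemma summable_sq_of_le_resMode {h : ℝ} (hh : 0 < h) (x : L2Ωvec h) {a : (Fin 2 → ℤ) → ℂ} {C : ℝ}
    (ha : ∀ k, ‖a k‖ ≤ C *
      ∑ j, ‖(inner ℂ (((‖resMode hh k‖ : ℂ)⁻¹) • resMode hh k) (x j) : ℂ)‖) :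
    Summable fun k => ‖a k‖ ^ 2 := by
  have h1 := fun j => (orthonormal_resMode hh).inner_products_summable (x j)
  refine Summable.of_nonneg_of_le (fun _ => sq_nonneg _) (fun k => ?_)
    (((h1 0).add (h1 1)).mul_left (2 * C ^ 2))
  refine (pow_le_pow_left₀ (norm_nonneg _) (ha k) 2).trans ?_
  rw [Fin.sum_univ_two, mul_pow]
  set p := ‖(inner ℂ (((‖resMode hh k‖ : ℂ)⁻¹) • resMode hh k) (x 0) : ℂ)‖
  set q := ‖(inner ℂ (((‖resMode hh k‖ : ℂ)⁻¹) • resMode hh k) (x 1) : ℂ)‖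
  nlinarith [mul_nonneg (sq_nonneg C) (sq_nonneg (p - q))]

/-- Solvability of the stationary problem `u - Δu + ∇_H π = x`, `div_H ū = 0`, with
`u` in the domain of the hydrostatic Stokes operator. -/
lemma exists_stokes_solution {h : ℝ} (hh : 0 < h) (x : L2Ωvec h) :
    ∃ u ∈ solenoidal hh, (∀ j, MemDomScalar (u j)) ∧ ∃ π, MemH1perG π ∧ inner ℂ (eG 0) π = 0 ∧
      ∀ j, u j - ∑ i : Fin 3, weakDeriv i (weakDeriv i (u j)) = x j - liftL hh (weakDeriv j π) := by
  obtain ⟨π, hπ, hc⟩ := exists_memH1perG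
    (summable_sq_of_le_resMode hh x (norm_presCoef_le hh x))
    (fun i => summable_sq_of_le_resMode hh x fun k => norm_mul_presCoef_le hh x k i)
  refine ⟨WithLp.toLp 2 fun j => sobolevRoot hh (sobolevRoot hh (x j - liftL hh (weakDeriv j π))),
    fun k => ?_, fun j => memDomScalar_sobolevRoot_sobolevRoot hh _, π, hπ, ?_,
    fun j => sub_laplacian_sobolevRoot_sobolevRoot hh _⟩
  · simp only [inner_liftL_sobolevRoot_sobolevRoot, inner_sub_right, inner_resMode_liftL,
      inner_eG_weakDeriv _ (hπ.periodicTrace _), hc, mul_sub, Finset.sum_sub_distrib,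
      mul_presCoef]
    rw [sub_eq_zero, Finset.mul_sum, Finset.sum_mul, Finset.sum_mul]
    exact Finset.sum_congr rfl fun j _ => by ring
  · rw [hc, presCoef_zero]

/-! ### The form domain of the hydrostatic Stokes operator -/

/-- The operator `(1 - Δ)^{-1/2}` acting componentwise on `L²(Ω)²`. -/
def vecSobolevRoot {h : ℝ} (hh : 0 < h) : L2Ωvec h →L[ℂ] L2Ωvec h :=
  (PiLp.continuousLinearEquiv 2 ℂ fun _ : Fin 2 => L2Ω h).symm.toContinuousLinearMap ∘L
    ContinuousLinearMap.pi fun j => sobolevRoot hh ∘L PiLp.proj 2 (fun _ : Fin 2 => L2Ω h) j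

lemma vecSobolevRoot_apply {h : ℝ} (hh : 0 < h) (a : L2Ωvec h) (j : Fin 2) :
    vecSobolevRoot hh a j = sobolevRoot hh (a j) := rfl

/-- The Hilbert space parametrising `V_σ`: the fields `a ∈ L²(Ω)²` for which `(1 - Δ)^{-1/2} a` is
solenoidal. -/
def FormDomain {h : ℝ} (hh : 0 < h) : Submodule ℂ (L2Ωvec h) :=
  (solenoidal hh).comap (vecSobolevRoot hh).toLinearMap

lemma isClosed_formDomain {h : ℝ} (hh : 0 < h) : IsClosed (FormDomain hh : Set (L2Ωvec h)) :=
  (isClosed_solenoidal hh).preimage (vecSobolevRoot hh).continuous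

lemma isClosed_X2 {h : ℝ} (hh : 0 < h) : IsClosed (X2 h : Set (L2Ωvec h)) := by
  have : (X2 h : Set (L2Ωvec h)) = solenoidal hh := Set.ext (mem_X2_iff hh)
  rw [this]
  exact isClosed_solenoidal hh

instance (h : ℝ) : InnerProductSpace ℂ (X2 h) := Submodule.innerProductSpace _

/-- The parametrisation `a ↦ (1 - Δ)^{-1/2} a` of `V_σ`. -/
def formIncl {h : ℝ} (hh : 0 < h) : FormDomain hh →L[ℂ] X2 h :=
  (vecSobolevRoot hh ∘L (FormDomain hh).subtypeL).codRestrict (X2 h)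
    fun a => (mem_X2_iff hh _).2 a.2

lemma coe_formIncl {h : ℝ} (hh : 0 < h) (a : FormDomain hh) :
    (formIncl hh a : L2Ωvec h) = vecSobolevRoot hh a := rfl

lemma formIncl_injective {h : ℝ} (hh : 0 < h) : Function.Injective (formIncl hh) := by
  intro a b H
  have h1 : vecSobolevRoot hh a = vecSobolevRoot hh b := congrArg Subtype.val H
  refine Subtype.ext ?_
  ext1 j
  refine sobolevRoot_injective hh ?_
  rw [← vecSobolevRoot_apply, ← vecSobolevRoot_apply, h1]

lemma mem_Vσ_iff {h : ℝ} (hh : 0 < h) (v : L2Ωvec h) : v ∈ Vσ h ↔ v ∈ solenoidal hh ∧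
    ∀ j, Summable fun ξ => eigΩ h ξ * ‖(inner ℂ (eΩ true h ξ) (v j) : ℂ)‖ ^ 2 := by
  simp only [← memH1perΩ_iff_summable hh]
  constructor
  · rintro ⟨h1, h2, h3⟩
    refine ⟨mem_solenoidal_of_divFreeAvg hh h2 fun j i => ?_, fun j => ⟨h1 j, h3 j⟩⟩
    fin_cases i
    · exact (h1 j).2.1
    · exact (h1 j).2.2
  · rintro ⟨h1, h2⟩
    exact ⟨fun j => (h2 j).1, divFreeAvg_of_mem_solenoidal hh h1, fun j => (h2 j).2⟩

lemma range_formIncl {h : ℝ} (hh : 0 < h) :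
    (Subtype.val '' Set.range (formIncl hh) : Set (L2Ωvec h)) = Vσ h := by
  ext v
  rw [mem_Vσ_iff hh]
  constructor
  · rintro ⟨-, ⟨a, rfl⟩, rfl⟩
    exact ⟨a.2, fun j => summable_eigΩ_sobolevRoot hh _⟩
  · rintro ⟨h1, h2⟩
    choose a ha using fun j => exists_sobolevRoot_eq hh (h2 j)
    have e : vecSobolevRoot hh (WithLp.toLp 2 a) = v := by
      ext1 j
      exact ha j
    exact ⟨_, ⟨⟨WithLp.toLp 2 a, by
      change vecSobolevRoot hh (WithLp.toLp 2 a) ∈ solenoidal hh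
      rwa [e]⟩, rfl⟩, e⟩

lemma H1norm_formIncl {h : ℝ} (hh : 0 < h) (a : FormDomain hh) :
    H1norm (formIncl hh a : L2Ωvec h) = ‖a‖ := by
  rw [H1norm, Submodule.coe_norm, PiLp.norm_eq_of_L2]
  congr 1
  refine Finset.sum_congr rfl fun j _ => ?_
  rw [coe_formIncl, vecSobolevRoot_apply]
  exact (norm_sq_eq_sobolevRoot hh _).symm

lemma memDomA2_iff {h : ℝ} (hh : 0 < h) {v : L2Ωvec h} (hv : v ∈ solenoidal hh) :
    MemDomA2 v ↔ ∀ j, MemDomScalar (v j) :=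
  ⟨fun H j => ⟨H.1 j, H.2.2.1 j, H.2.2.2 j⟩, fun H => ⟨fun j => (H j).1,
    divFreeAvg_of_mem_solenoidal hh hv, fun j => (H j).2.1, fun j => (H j).2.2⟩⟩

lemma mem_graph_stokesOperator_iff {h : ℝ} (hh : 0 < h) (p : X2 h × X2 h) :
    p ∈ (stokesOperator h).graph ↔ (∀ j, MemDomScalar ((p.1 : L2Ωvec h) j)) ∧
      ∃ π, MemH1perG π ∧ inner ℂ (eG 0) π = 0 ∧ ∀ j, (p.1 : L2Ωvec h) j
        - ∑ i : Fin 3, weakDeriv i (weakDeriv i ((p.1 : L2Ωvec h) j))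
          = ((p.1 + p.2 : X2 h) : L2Ωvec h) j - liftL hh (weakDeriv j π) := by
  have hp1 := (mem_X2_iff hh _).1 p.1.2
  have hp2 := (solenoidal hh).neg_mem ((mem_X2_iff hh _).1 p.2.2)
  rw [mem_graph_stokesOperator, mem_graph_helmholtz, isHelmholtz_iff hh, memDomA2_iff hh hp1]
  refine and_congr_right fun _ => ?_
  rw [and_iff_right hp2]
  refine exists_congr fun π => and_congr_right fun _ => and_congr_right fun _ =>
    forall_congr' fun j => ?_
  rw [PiLp.neg_apply, Submodule.coe_add, PiLp.add_apply, vecLaplacian]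
  have key : ∀ a b c d : L2Ω h, -b = c - d ↔ a - c = a + b - d := fun a b c d => by
    rw [← sub_eq_zero, ← sub_eq_zero (a := a - c), show a - c - (a + b - d) = -b - (c - d) by abel]
  exact key _ _ _ _

/-- The weak formulation: if `v ∈ D(A₂)` and `(1 + A₂) v = x`, then `v` is the solution of the
variational problem for the form of `1 + A₂`, that is `v = J J† x`. -/
lemma eq_formIncl_of_mem_graph {h : ℝ} (hh : 0 < h) [CompleteSpace (X2 h)]
    [CompleteSpace (FormDomain hh)] {p : X2 h × X2 h} (hp : p ∈ (stokesOperator h).graph) :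
    p.1 = formIncl hh ((formIncl hh).adjoint (p.1 + p.2)) := by
  obtain ⟨h1, π, hπ, -, h2⟩ := (mem_graph_stokesOperator_iff hh p).1 hp
  set a : L2Ωvec h := WithLp.toLp 2 fun j => sobolevRoot hh ((p.1 : L2Ωvec h) j
    - ∑ i : Fin 3, weakDeriv i (weakDeriv i ((p.1 : L2Ωvec h) j))) with ha
  have e : vecSobolevRoot hh a = p.1 := by
    ext1 j
    exact (h1 j).sobolevRoot_sub_laplacian hh
  have haV : a ∈ FormDomain hh := by
    change vecSobolevRoot hh a ∈ solenoidal hh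
    rw [e]
    exact (mem_X2_iff hh _).1 p.1.2
  have e2 : (formIncl hh).adjoint (p.1 + p.2) = ⟨a, haV⟩ := by
    refine ext_inner_left ℂ fun b => ?_
    rw [ContinuousLinearMap.adjoint_inner_right, Submodule.coe_inner, Submodule.coe_inner,
      coe_formIncl, PiLp.inner_apply, PiLp.inner_apply]
    -- The pressure gradient is orthogonal to the solenoidal field `(1 - Δ)^{-1/2} b`.
    have horth := sum_inner_liftL_eq_zero hh (w := vecSobolevRoot hh b) b.2
      (g := fun j => weakDeriv j π) (p := fun k => 2 * Real.pi * Complex.I * inner ℂ (eG k) π)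
      fun j k => by
        rw [inner_eG_weakDeriv j (hπ.periodicTrace j)]
        ring
    have horth' := congrArg conj horth
    simp only [map_sum, inner_conj_symm, map_zero] at horth'
    have h3 : ∀ j, ((p.1 + p.2 : X2 h) : L2Ωvec h) j = ((p.1 : L2Ωvec h) j
        - ∑ i : Fin 3, weakDeriv i (weakDeriv i ((p.1 : L2Ωvec h) j)))
          + liftL hh (weakDeriv j π) := fun j => by rw [h2, sub_add_cancel]
    simp only [h3, inner_add_right, Finset.sum_add_distrib, horth', add_zero]
    refine Finset.sum_congr rfl fun j _ => ?_
    rw [vecSobolevRoot_apply, sobolevRoot_symm]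
  rw [e2]
  exact Subtype.ext e.symm

lemma mem_graph_stokesOperator_iff_eq {h : ℝ} (hh : 0 < h) [CompleteSpace (X2 h)]
    [CompleteSpace (FormDomain hh)] (p : X2 h × X2 h) : p ∈ (stokesOperator h).graph ↔
      p.1 = formIncl hh ((formIncl hh).adjoint (p.1 + p.2)) := by
  refine ⟨eq_formIncl_of_mem_graph hh, fun hp => ?_⟩
  obtain ⟨u, hu, hu1, hu2⟩ := exists_stokes_solution hh ((p.1 + p.2 : X2 h) : L2Ωvec h)
  set u' : X2 h := ⟨u, (mem_X2_iff hh u).2 hu⟩ with hu'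
  have hmem : (u', p.1 + p.2 - u') ∈ (stokesOperator h).graph := by
    rw [mem_graph_stokesOperator_iff hh]
    refine ⟨hu1, ?_⟩
    rw [add_sub_cancel]
    exact hu2
  have h1 := eq_formIncl_of_mem_graph hh hmem
  rw [add_sub_cancel, ← hp] at h1
  change u' = p.1 at h1
  rw [h1, add_sub_cancel_left] at hmem
  exact hmem

end

theorem mainTheorem8 (h : ℝ) (hh : 0 < h) :
    VInterp h (1 / 2) = Vσ h ∧
      ∃ c C : ℝ, 0 < c ∧ 0 < C ∧ ∀ v : X2 h, (v : L2Ωvec h) ∈ Vσ h →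
        c * H1norm (v : L2Ωvec h) ≤ VInterpNorm h (1 / 2) v ∧
          VInterpNorm h (1 / 2) v ≤ C * H1norm (v : L2Ωvec h) := by
  have : CompleteSpace (X2 h) := (isClosed_X2 hh).completeSpace_coe
  have : CompleteSpace (FormDomain hh) := (isClosed_formDomain hh).completeSpace_coe
  obtain ⟨h1, C, hC, h2⟩ := complexInterp_half_of_inverse (formIncl_injective hh)
    (mem_graph_stokesOperator_iff_eq hh)
  refine ⟨by rw [VInterp, h1, range_formIncl], 1, C, one_pos, hC, fun v hv => ?_⟩
  rw [← range_formIncl hh] at hv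
  obtain ⟨-, ⟨a, rfl⟩, ha⟩ := hv
  obtain rfl := Subtype.ext ha
  rw [H1norm_formIncl, one_mul]
  exact h2 a
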